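/- **Setting.** Let $f(x,y)=\tfrac12x^TAx+x^TBy-\tfrac12y^TCy+u^Tx+v^Ty$ on $\mathbb R^n\times\mathbb R^m$ with $A,C$ symmetric, $m_xI\preceq A\preceq L_xI$, $m_yI\preceq C\preceq L_yI$, $\|B\|_2\le L_{xy}$, where $L_x=L_y\ge m_y$ and $0<m_x<m_y<L_{xy}$. Put $L=\max\{L_x,L_{xy},L_y\}$, $\kappa=L^2/(m_xm_y)$, $J=\begin{bmatrix}A&B\\-B^T&C\end{bmatrix}$, $b=[-u;v]$; let $z^*$ be the saddle point of $f$, that is, the solution of $Jz=b$. The norm of $z=[x;y]$ is Euclidean. **Algorithm.** RHSS($k$), $k\ge1$, takes the parameters $(m_x,m_y,L_x,L_{xy},L_y)$, the problem, a relative precision $\epsilon'$ and an initial point $z_0$. It produces $z_1,z_2,\dots$ and returns the first $z_t$, $t\ge1$, with $\|Jz_t-b\|\le\tilde\epsilon\,\|Jz_0-b\|$, where $\tilde\epsilon=m_x\epsilon'/(L_{xy}+L_x)$. *Case $k\ge2$.* Let $\alpha=\frac{m_x}{m_y}$, $\beta=L_{xy}^{-2/k}m_y^{-(k-2)/k}$,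 $\eta=L_{xy}^{1/k}m_y^{1-1/k}$, $M_1=\frac{192L^5}{m_x^2m_y^3}$, $M_2=\frac{16L_{xy}}{m_y}$, $G=\mathrm{diag}(A,C)$, $S=J-G$, $P=\mathrm{diag}(\alpha I+\beta A,\,I+\beta C)$. Given $z_t$, the conjugate gradient method, started at $z_t$ and run (for at least one step) until the residual norm has dropped by the factor $1/M_1$, is applied to $(\eta P+G)z=(\eta P-S)z_t+b$ and gives $z_{t+1/2}$. Then $z_{t+1}$ is the output of RHSS($k-1$), with initial point $z_t$ and relative precision $1/M_2$, on the saddle point problem equivalent to $(\eta P+S)z=(\eta P-G)z_{t+1/2}+b$, with the parameters $m_x'=\eta\alpha$, $m_y'=\eta$, $L_x'=\eta(1+\beta L_x)$, $L_y'=\eta(1+\beta L_y)$, $L_{xy}'=L_{xy}$. *Case $k=1$ (Proximal Best Response).* For $\kappa'\ge 1$ let $\theta(\kappa')=\frac{2\sqrt{\kappa'}-1}{2\sqrt{\kappa'}+1}$ and $\tau(\kappa')=\frac1{2\sqrt{\kappa'}+4\kappa'}$. Let $\beta_1=\max\{m_x,L_{xy}\}$, $\beta_2=\max\{m_y,L_{xy}\}$,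 $\bar M_1=\frac{80L^3}{m_x^{1.5}m_y^{1.5}}$, $\bar M_2=\frac{96L^{2.5}}{m_xm_y^{1.5}}$. - Outer loop: start with $\hat x_0=x_0$. Let $z_t=[x_t;y_t]$ be the result of the middle loop for $g(x,y)=f(x,y)+\beta_1\|x-\hat x_{t-1}\|^2$ from $z_{t-1}$, and $\hat x_t=x_t+\theta(x_t-x_{t-1})+\tau(x_t-\hat x_{t-1})$ with $\theta,\tau$ taken at $\beta_1/m_x$. - Middle loop, for $g$ from $w_0=[p_0;q_0]$: start with $\hat q_0=q_0$. Let $w_s=[p_s;q_s]$ be the result of the inner loop for $h(x,y)=g(x,y)-\beta_2\|y-\hat q_{s-1}\|^2$ from $w_{s-1}$, and $\hat q_s=q_s+\theta(q_s-q_{s-1})+\tau(q_s-\hat q_{s-1})$ with $\theta,\tau$ taken at $\beta_2/m_y$. Return the first $w_s$, $s\ge1$, with $\|\nabla g(w_s)\|\le\frac{\min\{m_x,m_y\}}{9L\bar M_1}\|\nabla g(w_0)\|$. - Inner loop (Alternating Best Response), for $h$: let $\kappa_x=\frac{3L}{2\beta_1}$, $\kappa_y=\frac{3L}{2\beta_2}$.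 Repeat $\lceil\log_2(4\sqrt{\kappa_x+\kappa_y}\,\bar M_2)\rceil+1$ times: update $x$ by $\lceil2\sqrt{\kappa_x}\ln(24\kappa_x)\rceil$ steps of Nesterov's accelerated gradient descent on $h(\cdot,y)$ from the current $x$, then update $y$ by $\lceil2\sqrt{\kappa_y}\ln(24\kappa_y)\rceil$ such steps on $-h(x,\cdot)$ from the current $y$. Here accelerated gradient descent on an $l$-smooth, $\mu$-strongly convex $\phi$ from $\xi_0=\tilde\xi_0$ is $\xi_i=\tilde\xi_{i-1}-\frac1l\nabla\phi(\tilde\xi_{i-1})$, $\tilde\xi_i=\xi_i+\frac{\sqrt{l/\mu}-1}{\sqrt{l/\mu}+1}(\xi_i-\xi_{i-1})$, with $l=3L$ and $\mu=2\beta_1$ for $x$, $\mu=2\beta_2$ for $y$. *Cost.* The cost is the number of matrix-vector products with $A,B,B^T,C$, in all gradients, residuals, conjugate gradient steps, stopping tests and recursive calls. **Corollary 3.** When $k=\Theta\bigl(\sqrt{\ln\kappa/\ln\ln\kappa}\bigr)$, RHSS($k$) finds an $\epsilon$-close point within $$\sqrt{\frac{L_{xy}^2}{m_xm_y}+\frac{L_x}{m_x}+\frac{L_y}{m_y}}\cdot\ln\Bigl(\frac{\|z_0-z^*\|}{\epsilon}\Bigr)\cdot\Bigl(\frac{L^2}{m_xm_y}\Bigr)^{o(1)}$$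 matrix-vector products, where the logarithm is read as $\max\{1,\ln(\cdot)\}$. Precisely: for all $0<c_1\le c_2$ there is a function $\omega:\mathbb R\to\mathbb R$ with $\omega(s)\to0$ as $s\to\infty$, depending only on $c_1,c_2$, such that for all dimensions $n,m$, all parameters and problems as above with $\kappa>e$, all integers $k$ with $c_1\sqrt{\ln\kappa/\ln\ln\kappa}\le k\le c_2\sqrt{\ln\kappa/\ln\ln\kappa}$, all $z_0$ and all $0<\epsilon<\|z_0-z^*\|$: RHSS($k$), run from $z_0$ with relative precision $\epsilon/\|z_0-z^*\|$, terminates, its output $z$ satisfies $\|z-z^*\|\le\epsilon$, and its cost is at most $$\sqrt{\frac{L_{xy}^2}{m_xm_y}+\frac{L_x}{m_x}+\frac{L_y}{m_y}}\cdot\max\Bigl\{1,\ln\frac{\|z_0-z^*\|}{\epsilon}\Bigr\}\cdot\kappa^{\,\omega(\kappa)} .$$ -/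

import Mathlib

open Filter Topology

/-! ## Computations that count matrix-vector products -/

/-- A possibly non-terminating deterministic computation.  If it terminates, it returns a value of
type `α` together with the number of matrix-vector products that were carried out. -/
def Counted (α : Type) : Type := Part (α × ℕ)

namespace Counted

/-- The computation `c` terminates, returns `a`, and uses exactly `N` matrix-vector products. -/
def Returns {α : Type} (c : Counted α) (a : α) (N : ℕ) : Prop :=
  (a, N) ∈ (show Part (α × ℕ) from c)

instance : Monad Counted where
  pure a := Part.some (a, 0)
  bind c f := Part.bind c fun p => Part.map (fun q => (q.1, p.2 + q.2)) (f p.1)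

/-- Run `body` exactly `T` times. -/
def iter {σ : Type} (body : σ → Counted σ) : ℕ → σ → Counted σ
  | 0, s => pure s
  | T + 1, s => do
      let s' ← body s
      iter body T s'

open Classical in
/-- `repeat s ← body s until test s`; the body is executed at least once, and the products used in
evaluating the stopping test are counted as well. -/
noncomputable def repeatUntil {σ : Type} (body : σ → Counted σ) (test : σ → Counted Prop)
    (s₀ : σ) : Counted σ :=
  PFun.fix
    (fun q : σ × ℕ =>
      Part.map
        (fun r : (σ × Prop) × ℕ =>
          if r.1.2 then Sum.inl (r.1.1, q.2 + r.2) else Sum.inr (r.1.1, q.2 + r.2))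
        (show Counted (σ × Prop) from do
          let s ← body q.1
          let b ← test s
          pure (s, b)))
    (s₀, 0)

end Counted

/-- One matrix-vector product, at unit cost. -/
noncomputable def matVec {m n : ℕ} (M : Matrix (Fin m) (Fin n) ℝ) (x : EuclideanSpace ℝ (Fin n)) :
    Counted (EuclideanSpace ℝ (Fin m)) :=
  Part.some (Matrix.toEuclideanLin M x, 1)

/-! ## Quadratic saddle point problems -/

/-- The space of `z = [x; y]`, with `‖z‖² = ‖x‖² + ‖y‖²`. -/
abbrev ZSpace (n m : ℕ) : Type :=
  WithLp 2 (EuclideanSpace ℝ (Fin n) × EuclideanSpace ℝ (Fin m))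

/-- The vector `[x; y]`. -/
noncomputable def mkZ {n m : ℕ} (x : EuclideanSpace ℝ (Fin n)) (y : EuclideanSpace ℝ (Fin m)) :
    ZSpace n m :=
  WithLp.toLp 2 (x, y)

/-- The data of `f(x, y) = ½ xᵀAx + xᵀBy - ½ yᵀCy + uᵀx + vᵀy`. -/
structure QuadProblem (n m : ℕ) where
  A : Matrix (Fin n) (Fin n) ℝ
  B : Matrix (Fin n) (Fin m) ℝ
  C : Matrix (Fin m) (Fin m) ℝ
  u : EuclideanSpace ℝ (Fin n)
  v : EuclideanSpace ℝ (Fin m)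

/-- The parameters `m_x, m_y, L_x, L_xy, L_y` of the function class. -/
structure Params where
  mx : ℝ
  my : ℝ
  Lx : ℝ
  Lxy : ℝ
  Ly : ℝ

namespace Params

/-- `L = max {L_x, L_xy, L_y}`. -/
noncomputable def L (p : Params) : ℝ := max p.Lx (max p.Lxy p.Ly)

/-- The condition number `L² / (m_x m_y)`. -/
noncomputable def cond (p : Params) : ℝ := p.L ^ 2 / (p.mx * p.my)

/-- The standing assumptions `0 < m_x < m_y < L_xy`, `m_y ≤ L_y` and `L_x = L_y`. -/
structure Standing (p : Params) : Prop where
  mx_pos : 0 < p.mx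
  mx_lt_my : p.mx < p.my
  my_lt_Lxy : p.my < p.Lxy
  my_le_Ly : p.my ≤ p.Ly
  Lx_eq_Ly : p.Lx = p.Ly

end Params

namespace QuadProblem

variable {n m : ℕ}

/-- The objective function. -/
noncomputable def f (P : QuadProblem n m) (x : EuclideanSpace ℝ (Fin n))
    (y : EuclideanSpace ℝ (Fin m)) : ℝ :=
  1 / 2 * inner ℝ x (Matrix.toEuclideanLin P.A x) + inner ℝ x (Matrix.toEuclideanLin P.B y)
    - 1 / 2 * inner ℝ y (Matrix.toEuclideanLin P.C y) + inner ℝ P.u x + inner ℝ P.v y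

/-- `z` is a saddle point of `f`. -/
def IsSaddlePoint (P : QuadProblem n m) (z : ZSpace n m) : Prop :=
  ∀ (x : EuclideanSpace ℝ (Fin n)) (y : EuclideanSpace ℝ (Fin m)),
    P.f z.fst z.snd ≤ P.f x z.snd ∧ P.f z.fst y ≤ P.f z.fst z.snd

/-- `m_x I ≼ A ≼ L_x I`, `m_y I ≼ C ≼ L_y I`, `‖B‖₂ ≤ L_xy` (with `A` and `C` symmetric). -/
structure InClass (P : QuadProblem n m) (p : Params) : Prop where
  A_lower : (P.A - p.mx • (1 : Matrix (Fin n) (Fin n) ℝ)).PosSemidef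
  A_upper : (p.Lx • (1 : Matrix (Fin n) (Fin n) ℝ) - P.A).PosSemidef
  C_lower : (P.C - p.my • (1 : Matrix (Fin m) (Fin m) ℝ)).PosSemidef
  C_upper : (p.Ly • (1 : Matrix (Fin m) (Fin m) ℝ) - P.C).PosSemidef
  B_norm : ‖LinearMap.toContinuousLinearMap (Matrix.toEuclideanLin P.B)‖ ≤ p.Lxy

/-- `∇_x f(x, y) = A x + B y + u`, two products. -/
noncomputable def gradX (P : QuadProblem n m) (x : EuclideanSpace ℝ (Fin n))
    (y : EuclideanSpace ℝ (Fin m)) : Counted (EuclideanSpace ℝ (Fin n)) := do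
  let a ← matVec P.A x
  let b ← matVec P.B y
  pure (a + b + P.u)

/-- `∇_y f(x, y) = Bᵀ x - C y + v`, two products. -/
noncomputable def gradY (P : QuadProblem n m) (x : EuclideanSpace ℝ (Fin n))
    (y : EuclideanSpace ℝ (Fin m)) : Counted (EuclideanSpace ℝ (Fin m)) := do
  let b ← matVec P.B.transpose x
  let c ← matVec P.C y
  pure (b - c + P.v)

/-- `‖J z - b‖` for `J = [A, B; -Bᵀ, C]`, `b = [-u; v]`.  Its blocks are `∇_x f` and `-∇_y f`. -/
noncomputable def residualNorm (P : QuadProblem n m) (z : ZSpace n m) : Counted ℝ := do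
  let gx ← P.gradX z.fst z.snd
  let gy ← P.gradY z.fst z.snd
  pure ‖mkZ gx (-gy)‖

end QuadProblem

/-! ## The building blocks: AGD, ABR, APPA-ABR, Proximal Best Response, CG -/

/-- `T` steps of Nesterov's accelerated gradient descent for an `l`-smooth, `μ`-strongly convex
function with gradient oracle `grad`.  The state is the pair `(x_t, x̃_t)`. -/
noncomputable def agd {d : ℕ} (grad : EuclideanSpace ℝ (Fin d) → Counted (EuclideanSpace ℝ (Fin d)))
    (l μ : ℝ) (x₀ : EuclideanSpace ℝ (Fin d)) (T : ℕ) : Counted (EuclideanSpace ℝ (Fin d)) := do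
  let κ := l / μ
  let θ := (√κ - 1) / (√κ + 1)
  let s ← Counted.iter
    (fun s : EuclideanSpace ℝ (Fin d) × EuclideanSpace ℝ (Fin d) => do
      let g ← grad s.2
      let x := s.2 - (1 / l) • g
      pure (x, x + θ • (x - s.1)))
    T (x₀, x₀)
  pure s.1

/-- Alternating Best Response for a function `g` given by its partial gradients. -/
noncomputable def abr {n m : ℕ}
    (gX : EuclideanSpace ℝ (Fin n) → EuclideanSpace ℝ (Fin m) → Counted (EuclideanSpace ℝ (Fin n)))
    (gY : EuclideanSpace ℝ (Fin n) → EuclideanSpace ℝ (Fin m) → Counted (EuclideanSpace ℝ (Fin m)))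
    (z₀ : ZSpace n m) (ε mx my Lx Ly : ℝ) : Counted (ZSpace n m) :=
  let κx := Lx / mx
  let κy := Ly / my
  let T := ⌈Real.logb 2 (4 * √(κx + κy) / ε)⌉₊
  Counted.iter
    (fun z : ZSpace n m => do
      let x ← agd (fun x => gX x z.snd) Lx mx z.fst ⌈2 * √κx * Real.log (24 * κx)⌉₊
      let y ← agd (fun y => do let g ← gY x y; pure (-g)) Ly my z.snd
        ⌈2 * √κy * Real.log (24 * κy)⌉₊
      pure (mkZ x y))
    (T + 1) z₀

/-- The extrapolation weight `θ = (2√κ - 1)/(2√κ + 1)` of the accelerated proximal point method. -/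
noncomputable def appaTheta (κ : ℝ) : ℝ := (2 * √κ - 1) / (2 * √κ + 1)

/-- The extrapolation weight `τ = 1/(2√κ + 4κ)` of the accelerated proximal point method. -/
noncomputable def appaTau (κ : ℝ) : ℝ := 1 / (2 * √κ + 4 * κ)

/-- APPA-ABR on `g` given by its partial gradients, with precision parameter `M₁`; `p` are the
parameters of the original objective.  The state is the pair `(z_t, ŷ_t)`. -/
noncomputable def appaAbr {n m : ℕ} (p : Params)
    (gX : EuclideanSpace ℝ (Fin n) → EuclideanSpace ℝ (Fin m) → Counted (EuclideanSpace ℝ (Fin n)))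
    (gY : EuclideanSpace ℝ (Fin n) → EuclideanSpace ℝ (Fin m) → Counted (EuclideanSpace ℝ (Fin m)))
    (z₀ : ZSpace n m) (M₁ : ℝ) : Counted (ZSpace n m) := do
  let β₁ := max p.mx p.Lxy
  let β₂ := max p.my p.Lxy
  let M₂ := 96 * p.L ^ (5 / 2 : ℝ) / (p.mx * p.my ^ (3 / 2 : ℝ))
  let κ := β₂ / p.my
  let gradNorm := fun z : ZSpace n m => (do
    let a ← gX z.fst z.snd
    let b ← gY z.fst z.snd
    pure ‖mkZ a b‖ : Counted ℝ)
  let g₀ ← gradNorm z₀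
  let s ← Counted.repeatUntil
    (fun s : ZSpace n m × EuclideanSpace ℝ (Fin m) => do
      let z ← abr gX (fun x y => do let g ← gY x y; pure (g - (2 * β₂) • (y - s.2)))
        s.1 (1 / M₂) (2 * β₁) (2 * β₂) (3 * p.L) (3 * p.L)
      pure (z, z.snd + appaTheta κ • (z.snd - s.1.snd) + appaTau κ • (z.snd - s.2)))
    (fun s => do
      let g ← gradNorm s.1
      pure (g ≤ min p.mx p.my / (9 * p.L * M₁) * g₀))
    (z₀, z₀.snd)
  pure s.1

/-- The tolerance `ε̃ = m_x ε / (L_xy + L_x)` on the residual. -/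
noncomputable def Params.tol (p : Params) (ε : ℝ) : ℝ := p.mx * ε / (p.Lxy + p.Lx)

/-- Proximal Best Response, run until `‖J z_t - b‖ ≤ ε̃ ‖J z_0 - b‖`.
The state is the pair `(z_t, x̂_t)`. -/
noncomputable def pbr {n m : ℕ} (p : Params) (P : QuadProblem n m) (ε : ℝ) (z₀ : ZSpace n m) :
    Counted (ZSpace n m) := do
  let β₁ := max p.mx p.Lxy
  let M₁ := 80 * p.L ^ 3 / (p.mx ^ (3 / 2 : ℝ) * p.my ^ (3 / 2 : ℝ))
  let κ := β₁ / p.mx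
  let ρ₀ ← P.residualNorm z₀
  let s ← Counted.repeatUntil
    (fun s : ZSpace n m × EuclideanSpace ℝ (Fin n) => do
      let z ← appaAbr p (fun x y => do let g ← P.gradX x y; pure (g + (2 * β₁) • (x - s.2)))
        P.gradY s.1 M₁
      pure (z, z.fst + appaTheta κ • (z.fst - s.1.fst) + appaTau κ • (z.fst - s.2)))
    (fun s => do
      let ρ ← P.residualNorm s.1
      pure (ρ ≤ p.tol ε * ρ₀))
    (z₀, z₀.fst)
  pure s.1

/-- State `(x_k, r_k, p_k)` of the conjugate gradient method. -/
structure CGState (V : Type) where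
  x : V
  r : V
  p : V

/-- The conjugate gradient method for `K x = b`, where `K` is given by the oracle `mulK`, from `x₀`
with precision `ε`.  If the residual vanishes, both quotients are `0 / 0 = 0`, so the iterate does
not move and the method stops. -/
noncomputable def conjGrad {n m : ℕ} (mulK : ZSpace n m → Counted (ZSpace n m)) (b x₀ : ZSpace n m)
    (ε : ℝ) : Counted (ZSpace n m) := do
  let k₀ ← mulK x₀
  let r₀ := b - k₀
  let s ← Counted.repeatUntil
    (fun s : CGState (ZSpace n m) => do
      let kp ← mulK s.p
      let a : ℝ := inner ℝ s.r s.r / inner ℝ s.p kp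
      let r := s.r - a • kp
      let c : ℝ := inner ℝ r r / inner ℝ s.r s.r
      pure ⟨s.x + a • s.p, r, r + c • s.p⟩)
    (fun s => pure (‖s.r‖ ≤ ε * ‖r₀‖))
    ⟨x₀, r₀, r₀⟩
  pure s.x

/-! ## RHSS(k) -/

namespace Params

/-- `α = m_x / m_y`. -/
noncomputable def hssAlpha (p : Params) : ℝ := p.mx / p.my

/-- `β = L_xy ^ (-2/k) * m_y ^ (-(k-2)/k)`. -/
noncomputable def hssBeta (p : Params) (k : ℕ) : ℝ :=
  p.Lxy ^ (-2 / (k : ℝ)) * p.my ^ (-((k : ℝ) - 2) / (k : ℝ))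

/-- `η = L_xy ^ (1/k) * m_y ^ (1 - 1/k)`. -/
noncomputable def hssEta (p : Params) (k : ℕ) : ℝ :=
  p.Lxy ^ (1 / (k : ℝ)) * p.my ^ (1 - 1 / (k : ℝ))

/-- Parameters of the subproblem with matrix `ηP + S`: its diagonal blocks `η(αI + βA)` and
`η(I + βC)` are at least `ηα` and `η`, and at most `η(1 + β L_x)` and `η(1 + β L_y)`. -/
noncomputable def sub (p : Params) (k : ℕ) : Params where
  mx := p.hssEta k * p.hssAlpha
  my := p.hssEta k
  Lx := p.hssEta k * (1 + p.hssBeta k * p.Lx)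
  Lxy := p.Lxy
  Ly := p.hssEta k * (1 + p.hssBeta k * p.Ly)

end Params

/-- The saddle point problem equivalent to the linear system
`[η(αI + βA), B; -Bᵀ, η(I + βC)] z = w`.  A product with one of its matrices costs one product
with the corresponding matrix of the given problem. -/
noncomputable def QuadProblem.sub {n m : ℕ} (P : QuadProblem n m) (p : Params) (k : ℕ)
    (w : ZSpace n m) : QuadProblem n m where
  A := p.hssEta k • (p.hssAlpha • (1 : Matrix (Fin n) (Fin n) ℝ) + p.hssBeta k • P.A)
  B := P.B
  C := p.hssEta k • ((1 : Matrix (Fin m) (Fin m) ℝ) + p.hssBeta k • P.C)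
  u := -w.fst
  v := w.snd

/-- One iteration of RHSS(k), `k ≥ 2`, from `z = z_t`; `solve` is RHSS(k-1), taking the parameters,
the problem, the relative precision and the initial point. -/
noncomputable def rhssStep {n m : ℕ}
    (solve : Params → QuadProblem n m → ℝ → ZSpace n m → Counted (ZSpace n m))
    (k : ℕ) (p : Params) (P : QuadProblem n m) (z : ZSpace n m) : Counted (ZSpace n m) := do
  let α := p.hssAlpha
  let β := p.hssBeta k
  let η := p.hssEta k
  let M₁ := 192 * p.L ^ 5 / (p.mx ^ 2 * p.my ^ 3)
  let M₂ := 16 * p.Lxy / p.my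
  let ax ← matVec P.A z.fst
  let bY ← matVec P.B z.snd
  let btx ← matVec P.B.transpose z.fst
  let cy ← matVec P.C z.snd
  let r := mkZ (η • (α • z.fst + β • ax) - bY - P.u) (btx + η • (z.snd + β • cy) + P.v)
  let zh ← conjGrad
    (fun q => do
      let aq ← matVec P.A q.fst
      let cq ← matVec P.C q.snd
      pure (mkZ (η • (α • q.fst + β • aq) + aq) (η • (q.snd + β • cq) + cq)))
    r z (1 / M₁)
  let ah ← matVec P.A zh.fst
  let ch ← matVec P.C zh.snd
  let w := mkZ (η • (α • zh.fst + β • ah) - ah - P.u) (η • (zh.snd + β • ch) - ch + P.v)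
  solve (p.sub k) (P.sub p k w) (1 / M₂) z

/-- RHSS(k) with relative precision `ε` and initial point `z₀`: Proximal Best Response for `k = 1`,
and for `k ≥ 2` the recursive Hermitian-skew-Hermitian split, run until
`‖J z_t - b‖ ≤ ε̃ ‖J z_0 - b‖`.  (The value at `k = 0` is irrelevant.) -/
noncomputable def rhss {n m : ℕ} :
    ℕ → Params → QuadProblem n m → ℝ → ZSpace n m → Counted (ZSpace n m)
  | 0, _, _, _, z₀ => pure z₀
  | 1, p, P, ε, z₀ => pbr p P ε z₀
  | k + 2, p, P, ε, z₀ => do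
      let ρ₀ ← P.residualNorm z₀
      Counted.repeatUntil
        (rhssStep (rhss (k + 1)) (k + 2) p P)
        (fun z => do
          let ρ ← P.residualNorm z
          pure (ρ ≤ p.tol ε * ρ₀))
        z₀

/-! Write `e = z - z*` and `r = (L_xy / m_y)^(1/k)`. An exact iteration of the splitting `J = G + S`
is a product of two Cayley-type maps. In the norm of `P⁻¹` the factor `(ηP - S)(ηP + S)⁻¹` is an
isometry because `S` is skew. The factor `(ηP - G)(ηP + G)⁻¹` contracts by `1 - 2/(5r)`, because
`η`, `α`, `β` are chosen so that `G` lies between `ηP / (r + 1/r)` and `r ηP`. The precisions of the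
two inner solvers still leave `1 - 1/(6r)` (`HssData.step`), so about `r` iterations suffice, up to
logarithms.

The system with `ηP + G` has condition number at most `3L/m_x` and is left to conjugate gradients.
The system with `ηP + S` is again a saddle point problem: `m_x` and `m_y` are multiplied by `r` and
`L_xy` is unchanged, so its own ratio, taken at depth `k - 1`, is the same `r` (`ratio_sub`). The
factor `r` in the number of iterations is paid for by the better conditioning, since `r * scale' ≤ 2
* scale` (`ratio_mul_scale_sub_le`). At depth one, Proximal Best Response costs too much only by
logarithms and by `√(L_xy/m_y)`, and there `L_xy/m_y` has shrunk to `r`. Hence the cost at depth `k`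
is at most `(10⁸ X⁴)^k * r² * scale` times the logarithm of the inverse precision, where `X` is of
order `log κ + k` (`rhss_cost`). The exponents `k log log κ` and `(log κ)/k` balance at `k ≈ √(log κ
/ log log κ)`, where both are `o(log κ)`.

Proximal Best Response consists of two nested inexact accelerated proximal point loops around an
alternating best response. Both loops are instances of one abstract estimate for a Schur complement
(`AppaData.potential_step`). The conjugate gradient bound is obtained without Chebyshev polynomials,
by comparison with accelerated gradient descent in the same Krylov space (`CGInvariant`). -/

/-! ### Program logic for computations that count matrix-vector products. -/

namespace Counted

/-- Total correctness with a cost bound: `c` terminates, uses at most `N` matrix-vector products,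
and its value satisfies `Q`. -/
def Spec {α : Type} (c : Counted α) (N : ℝ) (Q : α → Prop) : Prop :=
  ∃ (a : α) (k : ℕ), c.Returns a k ∧ (k : ℝ) ≤ N ∧ Q a

theorem Spec.mono {α : Type} {c : Counted α} {N N' : ℝ} {Q Q' : α → Prop} (h : c.Spec N Q)
    (hN : N ≤ N') (hQ : ∀ a, Q a → Q' a) : c.Spec N' Q' := by
  obtain ⟨a, k, h1, h2, h3⟩ := h
  exact ⟨a, k, h1, h2.trans hN, hQ a h3⟩

theorem returns_pure {α : Type} (a : α) : (pure a : Counted α).Returns a 0 :=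
  Part.mem_some _

theorem Returns.bind {α β : Type} {c : Counted α} {f : α → Counted β} {a : α} {b : β} {k l : ℕ}
    (h : c.Returns a k) (h' : (f a).Returns b l) : (c >>= f).Returns b (k + l) := by
  refine Part.mem_bind_iff.2 ⟨(a, k), h, ?_⟩
  exact (Part.mem_map_iff _).2 ⟨(b, l), h', rfl⟩

theorem Spec.ret {α : Type} {a : α} {Q : α → Prop} (h : Q a) : (pure a : Counted α).Spec 0 Q :=
  ⟨a, 0, returns_pure a, by simp, h⟩

theorem Spec.bind {α β : Type} {c : Counted α} {f : α → Counted β} {N N' : ℝ} {R : α → Prop}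
    {Q : β → Prop} (h : c.Spec N R) (h' : ∀ a, R a → (f a).Spec N' Q) :
    (c >>= f).Spec (N + N') Q := by
  obtain ⟨a, k, h1, h2, h3⟩ := h
  obtain ⟨b, l, g1, g2, g3⟩ := h' a h3
  exact ⟨b, k + l, h1.bind g1, by push_cast; linarith, g3⟩

theorem Spec.bind_pure {α β : Type} {c : Counted α} {f : α → β} {N : ℝ} {R : α → Prop}
    {Q : β → Prop} (h : c.Spec N R) (h' : ∀ a, R a → Q (f a)) :
    (c >>= fun a => Pure.pure (f a)).Spec N Q :=
  (Spec.bind h fun a ha => Spec.ret (h' a ha)).mono (by simp) fun _ h => h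

theorem Spec.iter {σ : Type} {body : σ → Counted σ} {c : ℝ} (Inv : ℕ → σ → Prop)
    (hstep : ∀ t s, Inv t s → (body s).Spec c (Inv (t + 1))) (T : ℕ) {t : ℕ} {s : σ}
    (h0 : Inv t s) : (iter body T s).Spec (T * c) (Inv (t + T)) := by
  induction T generalizing t s with
  | zero => exact (Spec.ret h0).mono (by simp) fun _ h => h
  | succ T ih =>
    refine (Spec.bind (hstep t s h0) fun a ha => ih ha).mono ?_ ?_
    · push_cast; linarith
    · intro a ha
      rwa [show t + (T + 1) = t + 1 + T by ring]

open Classical in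
/-- One round of the loop `repeatUntil`, with the number of products used so far. -/
noncomputable def loopRound {σ : Type} (body : σ → Counted σ) (test : σ → Counted Prop) :
    σ × ℕ →. (σ × ℕ) ⊕ (σ × ℕ) :=
  fun q => Part.map
    (fun r : (σ × Prop) × ℕ =>
      if r.1.2 then Sum.inl (r.1.1, q.2 + r.2) else Sum.inr (r.1.1, q.2 + r.2))
    (show Counted (σ × Prop) from do
      let s ← body q.1
      let b ← test s
      Pure.pure (s, b))

theorem repeatUntil_eq_fix {σ : Type} (body : σ → Counted σ) (test : σ → Counted Prop) (s₀ : σ) :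
    repeatUntil body test s₀ = PFun.fix (loopRound body test) (s₀, 0) := rfl

theorem mem_loopRound {σ : Type} {body : σ → Counted σ} {test : σ → Counted Prop} {s a : σ}
    {b : Prop} {k l : ℕ} (h : (body s).Returns a k) (h' : (test a).Returns b l) (N : ℕ) :
    (b → Sum.inl (a, N + (k + l)) ∈ loopRound body test (s, N)) ∧
      (¬ b → Sum.inr (a, N + (k + l)) ∈ loopRound body test (s, N)) := by
  have key : Returns (body s >>= fun s' => test s' >>= fun b' => pure (s', b')) (a, b)
      (k + (l + 0)) := h.bind (h'.bind (returns_pure (a, b)))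
  constructor <;> intro hb <;>
    refine (Part.mem_map_iff _).2 ⟨((a, b), k + (l + 0)), key, ?_⟩
  · exact if_pos hb
  · exact if_neg hb

/-- The invariant is indexed by the round, and at round `T` it must imply the stopping condition;
that gives termination. Since the loop may stop earlier, the final state satisfies the invariant
only for some round. -/
theorem Spec.repeatUntil {σ : Type} {body : σ → Counted σ} {test : σ → Counted Prop} {s₀ : σ}
    {c c' : ℝ} (Inv : ℕ → σ → Prop) (Stop : σ → Prop) (hc : 0 ≤ c + c') {T : ℕ} (hT : 0 < T)
    (h0 : Inv 0 s₀) (hbody : ∀ t s, Inv t s → (body s).Spec c (Inv (t + 1)))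
    (htest : ∀ s, (test s).Spec c' fun b => b ↔ Stop s)
    (hend : ∀ s, Inv T s → Stop s) :
    (repeatUntil body test s₀).Spec (T * (c + c')) fun s => (∃ t, Inv t s) ∧ Stop s := by
  -- `j + 1` is the number of rounds left before `T`. The number `N` of products used so far is
  -- arbitrary, because the counter is part of the state on which the fixed point recurses.
  suffices H : ∀ (j t : ℕ) (s : σ) (N : ℕ), t + (j + 1) = T → Inv t s →
      ∃ (a : σ) (k : ℕ), (a, N + k) ∈ PFun.fix (loopRound body test) (s, N) ∧ (k : ℝ) ≤ ((j : ℝ) + 1) * (c + c') ∧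
        (∃ t, Inv t a) ∧ Stop a by
    obtain ⟨a, k, h1, h2, h3⟩ := H (T - 1) 0 s₀ 0 (by omega) h0
    refine ⟨a, k, ?_, ?_, h3⟩
    · rw [Nat.zero_add] at h1
      rw [repeatUntil_eq_fix]
      exact h1
    · have : ((T - 1 : ℕ) : ℝ) + 1 = T := by
        have : T - 1 + 1 = T := by omega
        exact_mod_cast this
      rwa [this] at h2
  intro j
  induction j with
  | zero =>
    intro t s N ht hs
    obtain ⟨a, k, h1, h2, h3⟩ := hbody t s hs
    obtain ⟨b, l, g1, g2, g3⟩ := htest a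
    have hdone : Stop a := hend a (by rw [← ht]; exact h3)
    refine ⟨a, k + l, PFun.fix_stop ((mem_loopRound h1 g1 N).1 (g3.2 hdone)), ?_, ⟨_, h3⟩,
      hdone⟩
    · push_cast; linarith
  | succ j ih =>
    intro t s N ht hs
    obtain ⟨a, k, h1, h2, h3⟩ := hbody t s hs
    obtain ⟨b, l, g1, g2, g3⟩ := htest a
    by_cases hdone : Stop a
    · refine ⟨a, k + l, PFun.fix_stop ((mem_loopRound h1 g1 N).1 (g3.2 hdone)), ?_, ⟨_, h3⟩,
        hdone⟩
      -- Stopping early leaves the budget of `j` rounds unspent.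
      have : 0 ≤ (j : ℝ) * (c + c') := by positivity
      push_cast; linarith
    · obtain ⟨a', k', i1, i2, i3⟩ := ih (t + 1) a (N + (k + l)) (by omega) h3
      refine ⟨a', k + l + k', ?_, ?_, i3⟩
      · rw [← add_assoc, PFun.fix_fwd_eq ((mem_loopRound h1 g1 N).2 fun hb => hdone (g3.1 hb))]
        exact i1
      · push_cast; linarith

end Counted

theorem matVec_spec {m n : ℕ} (M : Matrix (Fin m) (Fin n) ℝ) (x : EuclideanSpace ℝ (Fin n)) :
    (matVec M x).Spec 1 (· = Matrix.toEuclideanLin M x) :=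
  ⟨_, 1, Part.mem_some _, by simp, rfl⟩

/-! ### Symmetric operators with spectral bounds. -/

section LinearAlgebra

open scoped InnerProductSpace

variable {E : Type*} [NormedAddCommGroup E] [InnerProductSpace ℝ E]

/-- `K` is symmetric with `μ I ≼ K ≼ l I`. -/
structure HasBounds (K : E →ₗ[ℝ] E) (μ l : ℝ) : Prop where
  symm : ∀ x y, ⟪K x, y⟫_ℝ = ⟪x, K y⟫_ℝ
  lower : ∀ x, μ * ‖x‖ ^ 2 ≤ ⟪x, K x⟫_ℝ
  upper : ∀ x, ⟪x, K x⟫_ℝ ≤ l * ‖x‖ ^ 2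

theorem HasBounds.mono {K : E →ₗ[ℝ] E} {μ l μ' l' : ℝ} (h : HasBounds K μ l) (hμ : μ' ≤ μ)
    (hl : l ≤ l') : HasBounds K μ' l' where
  symm := h.symm
  lower x := (mul_le_mul_of_nonneg_right hμ (sq_nonneg _)).trans (h.lower x)
  upper x := (h.upper x).trans (mul_le_mul_of_nonneg_right hl (sq_nonneg _))

theorem HasBounds.add_smul_id {K : E →ₗ[ℝ] E} {μ l : ℝ} (h : HasBounds K μ l) (c : ℝ) :
    HasBounds (K + c • LinearMap.id) (μ + c) (l + c) where
  symm x y := by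
    simp [inner_add_left, inner_add_right, real_inner_smul_left, real_inner_smul_right, h.symm]
  lower x := by
    have := h.lower x
    simp only [LinearMap.add_apply, LinearMap.smul_apply, LinearMap.id_apply, inner_add_right,
      real_inner_smul_right, real_inner_self_eq_norm_sq]
    linarith
  upper x := by
    have := h.upper x
    simp only [LinearMap.add_apply, LinearMap.smul_apply, LinearMap.id_apply, inner_add_right,
      real_inner_smul_right, real_inner_self_eq_norm_sq]
    linarith

theorem HasBounds.smul {K : E →ₗ[ℝ] E} {μ l : ℝ} (h : HasBounds K μ l) {c : ℝ} (hc : 0 ≤ c) :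
    HasBounds (c • K) (c * μ) (c * l) where
  symm x y := by simp [real_inner_smul_left, real_inner_smul_right, h.symm]
  lower x := by
    have := mul_le_mul_of_nonneg_left (h.lower x) hc
    simp only [LinearMap.smul_apply, real_inner_smul_right]
    linarith
  upper x := by
    have := mul_le_mul_of_nonneg_left (h.upper x) hc
    simp only [LinearMap.smul_apply, real_inner_smul_right]
    linarith

/-- If `a + 2 c t + b t²` is nonnegative for all `t`, then `√(a + 2 c + b) ≤ √a + √b`. -/
theorem sqrt_add_le_of_quadratic_nonneg {a b c : ℝ} (h : ∀ t : ℝ, 0 ≤ a + 2 * c * t + b * t ^ 2) :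
    c ^ 2 ≤ a * b ∧ √(a + 2 * c + b) ≤ √a + √b := by
  have ha : 0 ≤ a := by simpa using h 0
  have hd := discrim_le_zero (a := b) (b := 2 * c) (c := a)
    fun t => by linarith [h t, sq t, mul_assoc b t t]
  have hcs : c ^ 2 ≤ a * b := by
    rw [discrim] at hd
    linarith
  have hb : 0 ≤ b := by
    by_contra hb
    push Not at hb
    have hc : c = 0 := by nlinarith
    -- A negative `b` forces `c = 0`, and at this point the quadratic then takes the value `a - (a +
    -- 1) = -1`.
    have h1 := h (√((a + 1) / -b))
    rw [Real.sq_sqrt (div_nonneg (by linarith) (by linarith)), hc] at h1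
    have : b * ((a + 1) / -b) = -(a + 1) := by
      rw [mul_div_assoc', div_neg, mul_div_cancel_left₀ _ hb.ne]
    linarith
  refine ⟨hcs, Real.sqrt_le_iff.2 ⟨by positivity, ?_⟩⟩
  have hc : c ≤ √a * √b := by
    rw [← Real.sqrt_mul ha]
    exact Real.le_sqrt_of_sq_le hcs
  nlinarith [Real.sq_sqrt ha, Real.sq_sqrt hb]

theorem quadratic_line {K : E →ₗ[ℝ] E} (hs : ∀ x y, ⟪K x, y⟫_ℝ = ⟪x, K y⟫_ℝ) (x y : E) (t : ℝ) :
    ⟪x + t • y, K (x + t • y)⟫_ℝ = ⟪x, K x⟫_ℝ + 2 * ⟪x, K y⟫_ℝ * t + ⟪y, K y⟫_ℝ * t ^ 2 := by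
  simp only [map_add, map_smul, inner_add_left, inner_add_right, real_inner_smul_left,
    real_inner_smul_right]
  rw [← hs x y, real_inner_comm (K x) y]
  ring

theorem psd_cauchy_schwarz {K : E →ₗ[ℝ] E} (hs : ∀ x y, ⟪K x, y⟫_ℝ = ⟪x, K y⟫_ℝ)
    (hK : ∀ x, 0 ≤ ⟪x, K x⟫_ℝ) (x y : E) : ⟪x, K y⟫_ℝ ^ 2 ≤ ⟪x, K x⟫_ℝ * ⟪y, K y⟫_ℝ :=
  (sqrt_add_le_of_quadratic_nonneg fun t => by
    rw [← quadratic_line hs]; exact hK _).1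

theorem psd_sqrt_add_le {K : E →ₗ[ℝ] E} (hs : ∀ x y, ⟪K x, y⟫_ℝ = ⟪x, K y⟫_ℝ)
    (hK : ∀ x, 0 ≤ ⟪x, K x⟫_ℝ) (x y : E) :
    √⟪x + y, K (x + y)⟫_ℝ ≤ √⟪x, K x⟫_ℝ + √⟪y, K y⟫_ℝ := by
  have := (sqrt_add_le_of_quadratic_nonneg (a := ⟪x, K x⟫_ℝ) (b := ⟪y, K y⟫_ℝ) (c := ⟪x, K y⟫_ℝ)
    fun t => by rw [← quadratic_line hs]; exact hK _).2
  have h1 := quadratic_line hs x y 1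
  simp only [one_smul, mul_one, one_pow] at h1
  rwa [h1]

/-- For `0 ≼ G ≼ c P`, the operator `G P⁻¹ G` is dominated by `c G`. -/
theorem inner_inv_le {G : E →ₗ[ℝ] E} (hs : ∀ x y, ⟪G x, y⟫_ℝ = ⟪x, G y⟫_ℝ)
    (hG : ∀ x, 0 ≤ ⟪x, G x⟫_ℝ) {c : ℝ} (hc : 0 ≤ c) {x d : E}
    (h : ⟪d, G d⟫_ℝ ≤ c * ⟪G x, d⟫_ℝ) : ⟪G x, d⟫_ℝ ≤ c * ⟪x, G x⟫_ℝ := by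
  -- `d` stands for `P⁻¹ G x`, so that `h` is `G ≼ c P` tested at `d`. Cauchy–Schwarz for `G` gives
  -- `⟪G x, d⟫² ≤ c ⟪x, G x⟫ ⟪G x, d⟫`, and one factor cancels.
  have h1 := psd_cauchy_schwarz hs hG x d
  rw [← hs] at h1
  by_contra hcon
  push Not at hcon
  have h0 : 0 < ⟪G x, d⟫_ℝ := lt_of_le_of_lt (mul_nonneg hc (hG x)) hcon
  nlinarith [hG x, mul_le_mul_of_nonneg_left h (hG x)]

namespace HasBounds

variable {K : E →ₗ[ℝ] E} {μ l : ℝ}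

theorem inner_nonneg (h : HasBounds K μ l) (hμ : 0 ≤ μ) (x : E) : 0 ≤ ⟪x, K x⟫_ℝ :=
  (mul_nonneg hμ (sq_nonneg _)).trans (h.lower x)

/-- The case `P = I`, `d = K x` of `inner_inv_le`: `K² ≼ l K` without a spectral decomposition. With
`mul_inner_le`, which is `μ K ≼ K²`, it converts between energies and residual norms at the price of
the condition number. -/
theorem norm_sq_apply_le (h : HasBounds K μ l) (hμ : 0 ≤ μ) (hl : 0 ≤ l) (x : E) :
    ‖K x‖ ^ 2 ≤ l * ⟪x, K x⟫_ℝ := by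
  have := inner_inv_le h.symm (h.inner_nonneg hμ) hl (x := x) (d := K x)
    (by rw [real_inner_self_eq_norm_sq]; exact h.upper _)
  rwa [real_inner_self_eq_norm_sq] at this

theorem norm_apply_le (h : HasBounds K μ l) (hμ : 0 ≤ μ) (hl : 0 ≤ l) (x : E) :
    ‖K x‖ ≤ l * ‖x‖ := by
  refine abs_le_of_sq_le_sq' ?_ (by positivity) |>.2
  calc ‖K x‖ ^ 2 ≤ l * ⟪x, K x⟫_ℝ := h.norm_sq_apply_le hμ hl x
    _ ≤ l * (l * ‖x‖ ^ 2) := by gcongr; exact h.upper x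
    _ = (l * ‖x‖) ^ 2 := by ring

theorem mul_inner_le (h : HasBounds K μ l) (hμ : 0 ≤ μ) (x : E) :
    μ * ⟪x, K x⟫_ℝ ≤ ‖K x‖ ^ 2 := by
  have h1 := real_inner_le_norm x (K x)
  have h2 := h.lower x
  have h3 := h.inner_nonneg hμ x
  by_cases hx : ‖x‖ = 0
  · rw [hx, zero_mul] at h1
    have : ⟪x, K x⟫_ℝ = 0 := le_antisymm h1 h3
    rw [this]; simp
  have hx : 0 < ‖x‖ := lt_of_le_of_ne (norm_nonneg _) (Ne.symm hx)
  have h4 : μ * ‖x‖ ≤ ‖K x‖ := by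
    have : μ * ‖x‖ * ‖x‖ ≤ ‖K x‖ * ‖x‖ := by nlinarith
    exact le_of_mul_le_mul_right this hx
  calc μ * ⟪x, K x⟫_ℝ ≤ μ * (‖x‖ * ‖K x‖) := by gcongr
    _ = (μ * ‖x‖) * ‖K x‖ := by ring
    _ ≤ ‖K x‖ * ‖K x‖ := by gcongr
    _ = ‖K x‖ ^ 2 := by ring

theorem norm_le (h : HasBounds K μ l) (x : E) : μ * ‖x‖ ≤ ‖K x‖ := by
  by_cases hx : ‖x‖ = 0
  · rw [hx]; simp
  have hx : 0 < ‖x‖ := lt_of_le_of_ne (norm_nonneg _) (Ne.symm hx)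
  have : μ * ‖x‖ * ‖x‖ ≤ ‖K x‖ * ‖x‖ := by
    have h1 := real_inner_le_norm x (K x)
    have h2 := h.lower x
    nlinarith
  exact le_of_mul_le_mul_right this hx

theorem exists_inverse [FiniteDimensional ℝ E] (h : HasBounds K μ l) (hμ : 0 < μ) :
    ∃ Ki : E →ₗ[ℝ] E, (∀ x, K (Ki x) = x) ∧ (∀ x, Ki (K x) = x) ∧
      (∀ x y, ⟪Ki x, y⟫_ℝ = ⟪x, Ki y⟫_ℝ) ∧ (∀ x, μ * ‖Ki x‖ ≤ ‖x‖) ∧ ∀ x, 0 ≤ ⟪x, Ki x⟫_ℝ := by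
  have hinj : Function.Injective K := by
    refine (injective_iff_map_eq_zero K).2 fun x hx => ?_
    have := h.norm_le x
    rw [hx, norm_zero] at this
    have : ‖x‖ ≤ 0 := nonpos_of_mul_nonpos_right this hμ
    exact norm_le_zero_iff.1 this
  let e := LinearEquiv.ofInjectiveEndo K hinj
  have h1 : ∀ x, K (e.symm x) = x := fun x => e.apply_symm_apply x
  have h2 : ∀ x, e.symm (K x) = x := fun x => e.symm_apply_apply x
  refine ⟨e.symm.toLinearMap, h1, h2, fun x y => ?_, fun x => ?_, fun x => ?_⟩
  · have := h.symm (e.symm x) (e.symm y)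
    rw [h1, h1] at this
    exact this.symm
  · have := h.norm_le (e.symm x)
    rwa [h1] at this
  · have := h.inner_nonneg hμ.le (e.symm x)
    rwa [h1, real_inner_comm] at this

end HasBounds

/-! ### Accelerated gradient descent on a quadratic function -/

/-- One step of accelerated gradient descent on `½ ⟪x, K x⟫ - ⟪b, x⟫`. -/
noncomputable def agdStep (K : E →ₗ[ℝ] E) (b : E) (l θ : ℝ) (s : E × E) : E × E :=
  let x := s.2 - (1 / l) • (K s.2 - b)
  (x, x + θ • (x - s.1))

/-- The Lyapunov function of accelerated gradient descent with `s² = l / μ`, in terms of the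
errors of the two iterates. -/
noncomputable def agdPotential (K : E →ₗ[ℝ] E) (μ s : ℝ) (e : E × E) : ℝ :=
  ⟪e.1, K e.1⟫_ℝ + μ * ‖(s + 1) • e.2 - s • e.1‖ ^ 2

theorem norm_sq_smul_add₃ (a b c : ℝ) (x y z : E) :
    ‖a • x + b • y + c • z‖ ^ 2 = a ^ 2 * ‖x‖ ^ 2 + b ^ 2 * ‖y‖ ^ 2 + c ^ 2 * ‖z‖ ^ 2 +
      2 * (a * b) * ⟪x, y⟫_ℝ + 2 * (a * c) * ⟪x, z⟫_ℝ + 2 * (b * c) * ⟪y, z⟫_ℝ := by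
  rw [norm_add_sq_real, norm_add_sq_real, norm_smul, norm_smul, norm_smul]
  simp only [inner_add_left, real_inner_smul_left, real_inner_smul_right, mul_pow,
    Real.norm_eq_abs, sq_abs]
  ring

/-- The gradient step at `y` lowers `⟪y, K y⟫` by at least `‖g‖² / l`. What remains of the decrease
is a sum of three nonnegative terms: the `K`-energy of `x - y`, the slack in `μ I ≼ K` at `y`, and a
multiple of `‖x - y‖²`. -/
theorem agdPotential_step {K : E →ₗ[ℝ] E} {μ l s : ℝ} (h : HasBounds K μ l) (hμ : 0 < μ)
    (hs : 1 ≤ s) (hl : l = μ * s ^ 2) (e : E × E) :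
    agdPotential K μ s (agdStep K 0 l ((s - 1) / (s + 1)) e) ≤
      (1 - 1 / s) * agdPotential K μ s e := by
  obtain ⟨x, y⟩ := e
  have hs0 : 0 < s := by linarith
  have hl0 : 0 < l := by rw [hl]; positivity
  set g := K y with hg
  have hx' : (agdStep K 0 l ((s - 1) / (s + 1)) (x, y)).1 = y - (1 / l) • g := by
    simp [agdStep, hg]
  have hv' : (s + 1) • (agdStep K 0 l ((s - 1) / (s + 1)) (x, y)).2 -
      s • (agdStep K 0 l ((s - 1) / (s + 1)) (x, y)).1 =
      s • y + (1 - s) • x + (-(s / l)) • g := by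
    simp only [agdStep, sub_zero, ← hg, smul_add, smul_smul, smul_sub]
    rw [mul_div_cancel₀ _ (by linarith : s + 1 ≠ 0)]
    match_scalars <;> field_simp <;> ring
  have hv : (s + 1) • y - s • x = (s + 1) • y + (-s) • x + (0 : ℝ) • g := by module
  unfold agdPotential
  rw [hv', hx', hv, norm_sq_smul_add₃, norm_sq_smul_add₃]
  have e1 : ⟪y - (1 / l) • g, K (y - (1 / l) • g)⟫_ℝ =
      ⟪y, g⟫_ℝ - 2 / l * ‖g‖ ^ 2 + (1 / l) ^ 2 * ⟪g, K g⟫_ℝ := by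
    simp only [map_sub, map_smul, inner_sub_left, inner_sub_right, real_inner_smul_left,
      real_inner_smul_right, ← hg, real_inner_self_eq_norm_sq]
    rw [← h.symm y g, ← hg, real_inner_self_eq_norm_sq]
    ring
  have e2 : (1 / l) ^ 2 * ⟪g, K g⟫_ℝ ≤ 1 / l * ‖g‖ ^ 2 := by
    calc (1 / l) ^ 2 * ⟪g, K g⟫_ℝ ≤ (1 / l) ^ 2 * (l * ‖g‖ ^ 2) := by gcongr; exact h.upper g
      _ = 1 / l * ‖g‖ ^ 2 := by field_simp
  have e3 : 0 ≤ ⟪x, K x⟫_ℝ - 2 * ⟪x, g⟫_ℝ + ⟪y, g⟫_ℝ := by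
    have := h.inner_nonneg hμ.le (x - y)
    simp only [map_sub, inner_sub_left, inner_sub_right, ← hg] at this
    rw [← h.symm y x, ← hg, real_inner_comm x g] at this
    linarith
  have e4 := h.lower y
  rw [← hg] at e4
  have e5 : 0 ≤ ‖y‖ ^ 2 - 2 * ⟪y, x⟫_ℝ + ‖x‖ ^ 2 := by
    rw [← norm_sub_sq_real]; positivity
  rw [e1]
  set yg := ⟪y, g⟫_ℝ
  set xg := ⟪x, g⟫_ℝ
  set gg := ‖g‖ ^ 2
  set xx := ‖x‖ ^ 2
  set yy := ‖y‖ ^ 2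
  set xy := ⟪y, x⟫_ℝ
  set xKx := ⟪x, K x⟫_ℝ
  -- An identity. The `‖g‖²` terms cancel because `l = μ s²`.
  have key : (1 - 1 / s) * (xKx + μ * ((s + 1) ^ 2 * yy + (-s) ^ 2 * xx + 0 ^ 2 * gg +
      2 * ((s + 1) * -s) * xy + 2 * ((s + 1) * 0) * yg + 2 * (-s * 0) * xg)) -
      (yg - 2 / l * gg + 1 / l * gg + μ * (s ^ 2 * yy + (1 - s) ^ 2 * xx + (-(s / l)) ^ 2 * gg +
      2 * (s * (1 - s)) * xy + 2 * (s * -(s / l)) * yg + 2 * ((1 - s) * -(s / l)) * xg)) =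
      (1 - 1 / s) * (xKx - 2 * xg + yg) + 1 / s * (yg - μ * yy) +
      μ * (s - 1) * (yy - 2 * xy + xx) := by
    rw [hl]
    field_simp
    ring
  have p1 : 0 ≤ 1 - 1 / s := by
    rw [sub_nonneg, div_le_one hs0]; exact hs
  have p2 : 0 ≤ s - 1 := by linarith
  have p3 : 0 ≤ (1 - 1 / s) * (xKx - 2 * xg + yg) := mul_nonneg p1 e3
  have p4 : 0 ≤ 1 / s * (yg - μ * yy) := mul_nonneg (by positivity) (by linarith)
  have p5 : 0 ≤ μ * (s - 1) * (yy - 2 * xy + xx) := by positivity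
  linarith

/-- In terms of errors the right-hand side is `0`, so the one-step estimate is needed only for the
pure quadratic. -/
theorem agdStep_sub {K : E →ₗ[ℝ] E} {b xs : E} (hxs : K xs = b) (l θ : ℝ) (s : E × E) :
    agdStep K 0 l θ (s.1 - xs, s.2 - xs) =
      ((agdStep K b l θ s).1 - xs, (agdStep K b l θ s).2 - xs) := by
  simp only [agdStep, map_sub, hxs, sub_zero, Prod.mk.injEq]
  constructor <;> module

theorem agdPotential_iterate {K : E →ₗ[ℝ] E} {μ l s : ℝ} (h : HasBounds K μ l) (hμ : 0 < μ)
    (hs : 1 ≤ s) (hl : l = μ * s ^ 2) {b xs : E} (hxs : K xs = b) (x₀ : E) (T : ℕ) :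
    agdPotential K μ s (((agdStep K b l ((s - 1) / (s + 1)))^[T] (x₀, x₀)).1 - xs,
      ((agdStep K b l ((s - 1) / (s + 1)))^[T] (x₀, x₀)).2 - xs) ≤
      (1 - 1 / s) ^ T * (⟪x₀ - xs, K (x₀ - xs)⟫_ℝ + μ * ‖x₀ - xs‖ ^ 2) := by
  induction T with
  | zero =>
    simp only [Function.iterate_zero, id, pow_zero, one_mul, agdPotential]
    rw [show (s + 1) • (x₀ - xs) - s • (x₀ - xs) = x₀ - xs by module]
  | succ T ih =>
    rw [Function.iterate_succ_apply', ← agdStep_sub hxs, pow_succ', mul_assoc]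
    refine (agdPotential_step h hμ hs hl _).trans (mul_le_mul_of_nonneg_left ih ?_)
    rw [sub_nonneg, div_le_one (by linarith)]
    exact hs

theorem pow_one_sub_le_exp {q : ℝ} (hq : q ≤ 1) (T : ℕ) : (1 - q) ^ T ≤ Real.exp (-(q * T)) := by
  calc (1 - q) ^ T ≤ Real.exp (-q) ^ T := by
        refine pow_le_pow_left₀ (by linarith) ?_ T
        have := Real.add_one_le_exp (-q)
        linarith
    _ = Real.exp (-(q * T)) := by rw [← Real.exp_nat_mul]; ring_nf

end LinearAlgebra

/-! ### Conjugate gradients, compared with accelerated gradient descent. -/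

section ConjugateGradient

open scoped InnerProductSpace

variable {E : Type} [NormedAddCommGroup E] [InnerProductSpace ℝ E]

/-- One step of the conjugate gradient method. -/
noncomputable def cgStep (K : E →ₗ[ℝ] E) (s : CGState E) : CGState E :=
  let a : ℝ := ⟪s.r, s.r⟫_ℝ / ⟪s.p, K s.p⟫_ℝ
  let r := s.r - a • K s.p
  let c : ℝ := ⟪r, r⟫_ℝ / ⟪s.r, s.r⟫_ℝ
  ⟨s.x + a • s.p, r, r + c • s.p⟩

/-- The orthogonality relations of the conjugate gradient method for `K x = b`, where `V` is the
span of the previous directions, together with the membership of the iterates `w` of accelerated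
gradient descent in the affine space `x₀ + V`. -/
structure CGInvariant (K : E →ₗ[ℝ] E) (b x₀ : E) (V : Submodule ℝ E) (s : CGState E)
    (w : E × E) : Prop where
  residual : s.r = b - K s.x
  orthogonal : ∀ d ∈ V, ⟪s.r, d⟫_ℝ = 0
  conjugate : ∀ d ∈ V, ⟪K s.p, d⟫_ℝ = 0
  map_mem : ∀ d ∈ V, K d ∈ V ⊔ Submodule.span ℝ {s.p}
  sub_mem : s.x - x₀ ∈ V
  direction_mem : s.r - s.p ∈ V
  initial_mem : b - K x₀ ∈ V ⊔ Submodule.span ℝ {s.p}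
  fst_mem : w.1 - x₀ ∈ V
  snd_mem : w.2 - x₀ ∈ V

theorem CGInvariant.init (K : E →ₗ[ℝ] E) (b x₀ : E) :
    CGInvariant K b x₀ ⊥ ⟨x₀, b - K x₀, b - K x₀⟩ (x₀, x₀) where
  residual := rfl
  orthogonal d hd := by rw [(Submodule.mem_bot ℝ).1 hd, inner_zero_right]
  conjugate d hd := by rw [(Submodule.mem_bot ℝ).1 hd, inner_zero_right]
  map_mem d hd := by rw [(Submodule.mem_bot ℝ).1 hd, map_zero]; exact Submodule.zero_mem _
  sub_mem := by simp
  direction_mem := by simp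
  initial_mem := Submodule.mem_sup_right (Submodule.mem_span_singleton_self _)
  fst_mem := by simp
  snd_mem := by simp

/-- Accelerated gradient descent only ever adds combinations of gradients, so both of its iterates
stay in the growing Krylov space over which conjugate gradients minimise. -/
theorem agdStep_mem {K : E →ₗ[ℝ] E} {b x₀ : E} {V V' : Submodule ℝ E} (hV : V ≤ V')
    (hK : ∀ d ∈ V, K d ∈ V') (h0 : b - K x₀ ∈ V') {w : E × E} (h1 : w.1 - x₀ ∈ V)
    (h2 : w.2 - x₀ ∈ V) (l θ : ℝ) :
    (agdStep K b l θ w).1 - x₀ ∈ V' ∧ (agdStep K b l θ w).2 - x₀ ∈ V' := by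
  have e1 : (agdStep K b l θ w).1 - x₀ ∈ V' := by
    have : (agdStep K b l θ w).1 - x₀ = (w.2 - x₀) - (1 / l) • (K (w.2 - x₀) - (b - K x₀)) := by
      simp only [agdStep, map_sub]
      module
    rw [this]
    exact V'.sub_mem (hV h2) (V'.smul_mem _ (V'.sub_mem (hK _ h2) h0))
  refine ⟨e1, ?_⟩
  have : (agdStep K b l θ w).2 - x₀ = ((agdStep K b l θ w).1 - x₀) +
      θ • (((agdStep K b l θ w).1 - x₀) - (w.1 - x₀)) := by
    simp only [agdStep]
    module
  rw [this]
  exact V'.add_mem e1 (V'.smul_mem _ (V'.sub_mem e1 (hV h1)))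

theorem CGInvariant.step {K : E →ₗ[ℝ] E} {μ L : ℝ} (hK : HasBounds K μ L) (hμ : 0 < μ) {b x₀ : E}
    {V : Submodule ℝ E} {s : CGState E} {w : E × E} (h : CGInvariant K b x₀ V s w) (l θ : ℝ) :
    CGInvariant K b x₀ (V ⊔ Submodule.span ℝ {s.p}) (cgStep K s) (agdStep K b l θ w) := by
  have hw := agdStep_mem le_sup_left h.map_mem h.initial_mem h.fst_mem h.snd_mem l θ
  have hpV : s.p ∈ V ⊔ Submodule.span ℝ {s.p} :=
    Submodule.mem_sup_right (Submodule.mem_span_singleton_self _)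
  have hres : (cgStep K s).r = b - K (cgStep K s).x := by
    simp only [cgStep, h.residual, map_add, map_smul]
    module
  have hrp : ⟪s.r, s.p⟫_ℝ = ⟪s.r, s.r⟫_ℝ := by
    have := h.orthogonal _ h.direction_mem
    rw [inner_sub_right] at this
    linarith
  have hmem : ∀ d ∈ V ⊔ Submodule.span ℝ {s.p}, ∃ v ∈ V, ∃ t : ℝ, d = v + t • s.p := by
    intro d hd
    obtain ⟨v, hv, q, hq, rfl⟩ := Submodule.mem_sup.1 hd
    obtain ⟨t, rfl⟩ := Submodule.mem_span_singleton.1 hq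
    exact ⟨v, hv, t, rfl⟩
  have hdir : (cgStep K s).r - (cgStep K s).p ∈ V ⊔ Submodule.span ℝ {s.p} := by
    have : (cgStep K s).r - (cgStep K s).p =
        (-(⟪(cgStep K s).r, (cgStep K s).r⟫_ℝ / ⟪s.r, s.r⟫_ℝ)) • s.p := by
      simp only [cgStep]
      module
    rw [this]
    exact Submodule.smul_mem _ _ hpV
  have hsub : (cgStep K s).x - x₀ ∈ V ⊔ Submodule.span ℝ {s.p} := by
    have : (cgStep K s).x - x₀ = (s.x - x₀) + (⟪s.r, s.r⟫_ℝ / ⟪s.p, K s.p⟫_ℝ) • s.p := by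
      simp only [cgStep]
      module
    rw [this]
    exact Submodule.add_mem _ (Submodule.mem_sup_left h.sub_mem) (Submodule.smul_mem _ _ hpV)
  have hr' : (cgStep K s).r = s.r - (⟪s.r, s.r⟫_ℝ / ⟪s.p, K s.p⟫_ℝ) • K s.p := rfl
  have hp' : (cgStep K s).p = (cgStep K s).r +
      (⟪(cgStep K s).r, (cgStep K s).r⟫_ℝ / ⟪s.r, s.r⟫_ℝ) • s.p := rfl
  -- The method has already converged. Then `p` lies in `V`, conjugacy gives `⟪p, K p⟫ = 0`, hence
  -- `p = 0`; both quotients are `0 / 0 = 0` and nothing moves.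
  by_cases hr : s.r = 0
  · have hpV' : s.p ∈ V := by
      have := h.direction_mem
      rw [hr, zero_sub] at this
      exact neg_mem_iff.1 this
    have hp : s.p = 0 := by
      have h1 := h.conjugate _ hpV'
      have h2 := hK.lower s.p
      rw [real_inner_comm, h1] at h2
      have : ‖s.p‖ ^ 2 ≤ 0 := nonpos_of_mul_nonpos_right h2 hμ
      simpa using this
    have hrz : (cgStep K s).r = 0 := by rw [hr', hp, hr]; simp
    have hpz : (cgStep K s).p = 0 := by rw [hp', hrz, hp]; simp
    refine ⟨hres, ?_, ?_, ?_, hsub, hdir, ?_, hw.1, hw.2⟩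
    · intro d _; rw [hrz, inner_zero_left]
    · intro d _; rw [hpz, map_zero, inner_zero_left]
    · intro d hd
      obtain ⟨v, hv, t, rfl⟩ := hmem d hd
      rw [hp, smul_zero, add_zero, ← hp]
      exact Submodule.mem_sup_left (h.map_mem v hv)
    · exact Submodule.mem_sup_left h.initial_mem
  · have hrr : 0 < ⟪s.r, s.r⟫_ℝ := real_inner_self_pos.2 hr
    have hp : s.p ≠ 0 := fun hp => by rw [hp, inner_zero_right] at hrp; linarith
    have hpp : 0 < ⟪s.p, K s.p⟫_ℝ :=
      lt_of_lt_of_le (mul_pos hμ (pow_pos (norm_pos_iff.2 hp) 2)) (hK.lower _)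
    set a := ⟪s.r, s.r⟫_ℝ / ⟪s.p, K s.p⟫_ℝ with ha
    have ha0 : 0 < a := div_pos hrr hpp
    have hKp : K s.p = (1 / a) • (s.r - (cgStep K s).r) := by
      rw [hr', sub_sub_cancel, smul_smul, one_div_mul_cancel ha0.ne', one_smul]
    have horth : ∀ d ∈ V ⊔ Submodule.span ℝ {s.p}, ⟪(cgStep K s).r, d⟫_ℝ = 0 := by
      intro d hd
      obtain ⟨v, hv, t, rfl⟩ := hmem d hd
      rw [hr', inner_sub_left, inner_add_right, inner_add_right, real_inner_smul_left,
        real_inner_smul_left, real_inner_smul_right, real_inner_smul_right, h.orthogonal v hv,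
        h.conjugate v hv, hrp, real_inner_comm s.p (K s.p), ha]
      field_simp
      ring
    have hrV : s.r ∈ V ⊔ Submodule.span ℝ {s.p} := by
      have := Submodule.add_mem _ (Submodule.mem_sup_left (T := Submodule.span ℝ {s.p})
        h.direction_mem) hpV
      rwa [sub_add_cancel] at this
    refine ⟨hres, horth, ?_, ?_, hsub, hdir, ?_, hw.1, hw.2⟩
    · intro d hd
      obtain ⟨v, hv, t, rfl⟩ := hmem d hd
      -- Conjugacy of the new direction. Against `V` it is orthogonality of the new residual, since
      -- `K` maps `V` into the enlarged space. Against the old `p` the coefficient `c` is made for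
      -- it, because `K p` is a multiple of the difference of the two residuals.
      have h1 : ⟪(cgStep K s).r, K v⟫_ℝ = 0 := horth _ (h.map_mem v hv)
      have h2 : ⟪(cgStep K s).r, K s.p⟫_ℝ =
          -(1 / a) * ⟪(cgStep K s).r, (cgStep K s).r⟫_ℝ := by
        conv_lhs => rw [hKp]
        rw [real_inner_smul_right, inner_sub_right, horth _ hrV]
        ring
      rw [hK.symm, hp', inner_add_left, map_add, map_smul, inner_add_right, inner_add_right, h1,
        real_inner_smul_right, h2, real_inner_smul_left, real_inner_smul_left,
        real_inner_smul_right, ← hK.symm s.p v, h.conjugate v hv, ha]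
      field_simp
      ring
    · intro d hd
      obtain ⟨v, hv, t, rfl⟩ := hmem d hd
      rw [map_add, map_smul]
      refine Submodule.add_mem _ (Submodule.mem_sup_left (h.map_mem v hv))
        (Submodule.smul_mem _ _ ?_)
      rw [hKp]
      refine Submodule.smul_mem _ _ (Submodule.sub_mem _ (Submodule.mem_sup_left hrV) ?_)
      have := Submodule.add_mem _ (Submodule.mem_sup_left
        (T := Submodule.span ℝ {(cgStep K s).p}) hdir)
        (Submodule.mem_sup_right (Submodule.mem_span_singleton_self _))
      rwa [sub_add_cancel] at this
    · exact Submodule.mem_sup_left h.initial_mem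

/-- Galerkin orthogonality: the residual is orthogonal to `V`, which contains `w.1 - s.x`, so the
energy of `w.1 - xs` splits by Pythagoras into that of `s.x - xs` and a nonnegative rest. -/
theorem CGInvariant.energy_le {K : E →ₗ[ℝ] E} {μ L : ℝ} (hK : HasBounds K μ L) (hμ : 0 ≤ μ)
    {b x₀ xs : E} (hxs : K xs = b) {V : Submodule ℝ E} {s : CGState E} {w : E × E}
    (h : CGInvariant K b x₀ V s w) :
    ⟪s.x - xs, K (s.x - xs)⟫_ℝ ≤ ⟪w.1 - xs, K (w.1 - xs)⟫_ℝ := by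
  have hd : w.1 - s.x ∈ V := by
    have := V.sub_mem h.fst_mem h.sub_mem
    rwa [sub_sub_sub_cancel_right] at this
  have h1 : ⟪K (s.x - xs), w.1 - s.x⟫_ℝ = 0 := by
    have : K (s.x - xs) = -s.r := by rw [h.residual, map_sub, hxs]; abel
    rw [this, inner_neg_left, h.orthogonal _ hd, neg_zero]
  have h2 := quadratic_line hK.symm (s.x - xs) (w.1 - s.x) 1
  rw [← hK.symm (s.x - xs) (w.1 - s.x), h1, one_smul, show s.x - xs + (w.1 - s.x) = w.1 - xs by abel] at h2
  have h3 := hK.inner_nonneg hμ (w.1 - s.x)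
  linarith

/-- The energy decays at the accelerated rate. Going from residual to energy and back costs `l / μ =
s²`, and the factor `2` is due to the second term of the initial potential. -/
theorem CGInvariant.norm_residual_le {K : E →ₗ[ℝ] E} {μ l s : ℝ} (hK : HasBounds K μ l)
    (hμ : 0 < μ) (hs : 1 ≤ s) (hl : l = μ * s ^ 2) {b x₀ xs : E} (hxs : K xs = b)
    {V : Submodule ℝ E} {c : CGState E} {T : ℕ}
    (h : CGInvariant K b x₀ V c ((agdStep K b l ((s - 1) / (s + 1)))^[T] (x₀, x₀))) :
    ‖c.r‖ ^ 2 ≤ 2 * s ^ 2 * (1 - 1 / s) ^ T * ‖b - K x₀‖ ^ 2 := by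
  have hl0 : 0 ≤ l := by rw [hl]; positivity
  have hq : 0 ≤ 1 - 1 / s := by
    rw [sub_nonneg, div_le_one (by linarith)]; exact hs
  have h1 := h.energy_le hK hμ.le hxs
  have h2 := agdPotential_iterate hK hμ hs hl hxs x₀ T
  have h3 : c.r = -K (c.x - xs) := by rw [h.residual, map_sub, hxs]; abel
  have h4 : b - K x₀ = -K (x₀ - xs) := by rw [map_sub, hxs]; abel
  have h5 := hK.norm_sq_apply_le hμ.le hl0 (c.x - xs)
  have h6 := hK.mul_inner_le hμ.le (x₀ - xs)
  have h7 := hK.lower (x₀ - xs)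
  rw [h3, h4, norm_neg, norm_neg]
  unfold agdPotential at h2
  have h8 : (1 - 1 / s) ^ T * (⟪x₀ - xs, K (x₀ - xs)⟫_ℝ + μ * ‖x₀ - xs‖ ^ 2) ≤
      (1 - 1 / s) ^ T * (2 * (‖K (x₀ - xs)‖ ^ 2 / μ)) := by
    refine mul_le_mul_of_nonneg_left ?_ (pow_nonneg hq T)
    have : ⟪x₀ - xs, K (x₀ - xs)⟫_ℝ ≤ ‖K (x₀ - xs)‖ ^ 2 / μ := by
      rw [le_div_iff₀ hμ]; linarith
    linarith
  have h9 : ⟪c.x - xs, K (c.x - xs)⟫_ℝ ≤ (1 - 1 / s) ^ T * (2 * (‖K (x₀ - xs)‖ ^ 2 / μ)) := by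
    refine le_trans ?_ h8
    refine le_trans ?_ h2
    refine h1.trans (le_add_of_nonneg_right (by positivity))
  calc ‖K (c.x - xs)‖ ^ 2 ≤ l * ((1 - 1 / s) ^ T * (2 * (‖K (x₀ - xs)‖ ^ 2 / μ))) :=
        h5.trans (mul_le_mul_of_nonneg_left h9 hl0)
    _ = _ := by rw [hl]; field_simp

end ConjugateGradient

/-- The conjugate gradient method reduces the residual by the factor `ε` at the accelerated rate. -/
theorem conjGrad_spec {n m : ℕ} {mulK : ZSpace n m → Counted (ZSpace n m)}
    {K : ZSpace n m →ₗ[ℝ] ZSpace n m} {μ l s c : ℝ} (hc : 0 ≤ c)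
    (hmul : ∀ q, (mulK q).Spec c (· = K q)) (hK : HasBounds K μ l) (hμ : 0 < μ) (hs : 1 ≤ s)
    (hl : l = μ * s ^ 2) (b x₀ xs : ZSpace n m) (hxs : K xs = b) {ε : ℝ} (hε : 0 < ε) {T : ℕ}
    (hT : 0 < T) (hTε : 2 * s ^ 2 * (1 - 1 / s) ^ T ≤ ε ^ 2) :
    (conjGrad mulK b x₀ ε).Spec (c + T * c)
      fun z => ‖b - K z‖ ≤ ε * ‖b - K x₀‖ := by
  unfold conjGrad
  refine (hmul x₀).bind fun k₀ hk₀ => ?_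
  subst hk₀
  refine Counted.Spec.bind_pure (R := fun st : CGState (ZSpace n m) =>
    ‖b - K st.x‖ ≤ ε * ‖b - K x₀‖) ?_ fun a ha => ha
  refine (Counted.Spec.repeatUntil (c := c) (c' := 0) (T := T)
    -- The iterates of accelerated gradient descent occur in the invariant only; the program does
    -- not compute them.
    (fun t st => ∃ V, CGInvariant K b x₀ V st ((agdStep K b l ((s - 1) / (s + 1)))^[t] (x₀, x₀)))
    (fun st => ‖st.r‖ ≤ ε * ‖b - K x₀‖) (by linarith) hT ⟨⊥, CGInvariant.init K b x₀⟩
    ?_ ?_ ?_).mono (by simp) ?_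
  · rintro t st ⟨V, hV⟩
    refine Counted.Spec.bind_pure (hmul st.p) ?_
    rintro _ rfl
    refine ⟨V ⊔ Submodule.span ℝ {st.p}, ?_⟩
    rw [Function.iterate_succ_apply']
    exact hV.step hK hμ l _
  · exact fun st => Counted.Spec.ret Iff.rfl
  · rintro st ⟨V, hV⟩
    have h1 := hV.norm_residual_le hK hμ hs hl hxs
    refine abs_le_of_sq_le_sq' ?_ (by positivity) |>.2
    rw [mul_pow]
    exact h1.trans (mul_le_mul_of_nonneg_right hTε (sq_nonneg _))
  · rintro st ⟨⟨t, V, hV⟩, hst⟩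
    rwa [hV.residual] at hst

/-! ### Accelerated gradient descent and Alternating Best Response as counted computations. -/

theorem agd_spec {d : ℕ}
    {grad : EuclideanSpace ℝ (Fin d) → Counted (EuclideanSpace ℝ (Fin d))}
    {K : EuclideanSpace ℝ (Fin d) →ₗ[ℝ] EuclideanSpace ℝ (Fin d)}
    {b xs : EuclideanSpace ℝ (Fin d)} {μ l c : ℝ} (hgrad : ∀ x, (grad x).Spec c (· = K x - b))
    (hK : HasBounds K μ l) (hμ : 0 < μ) (hl : μ ≤ l) (hxs : K xs = b)
    (x₀ : EuclideanSpace ℝ (Fin d)) (T : ℕ) :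
    (agd grad l μ x₀ T).Spec (T * c) fun x =>
      μ * ‖x - xs‖ ^ 2 ≤ (1 - 1 / √(l / μ)) ^ T * ((l + μ) * ‖x₀ - xs‖ ^ 2) := by
  have hs : 1 ≤ √(l / μ) := Real.one_le_sqrt.2 ((one_le_div hμ).2 hl)
  have hls : l = μ * √(l / μ) ^ 2 := by
    rw [Real.sq_sqrt (div_nonneg (hμ.le.trans hl) hμ.le), mul_div_cancel₀ _ hμ.ne']
  have hmain := agdPotential_iterate hK hμ hs hls hxs x₀
  unfold agd
  refine Counted.Spec.bind_pure
    (R := fun s => s = (agdStep K b l ((√(l / μ) - 1) / (√(l / μ) + 1)))^[T] (x₀, x₀)) ?_ ?_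
  · have := Counted.Spec.iter (c := c)
      (body := fun s : EuclideanSpace ℝ (Fin d) × EuclideanSpace ℝ (Fin d) => do
        let g ← grad s.2
        let x := s.2 - (1 / l) • g
        pure (x, x + ((√(l / μ) - 1) / (√(l / μ) + 1)) • (x - s.1)))
      (fun t s => s = (agdStep K b l ((√(l / μ) - 1) / (√(l / μ) + 1)))^[t] (x₀, x₀)) ?_ T
      (t := 0) (s := (x₀, x₀)) rfl
    · rwa [zero_add] at this
    · rintro t s hs
      refine Counted.Spec.bind_pure (hgrad s.2) ?_
      rintro _ rfl
      rw [Function.iterate_succ_apply', ← hs]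
      rfl
  · rintro _ rfl
    refine le_trans ?_ ((hmain T).trans (mul_le_mul_of_nonneg_left ?_ (pow_nonneg ?_ T)))
    · refine (hK.lower _).trans (le_add_of_nonneg_right (by positivity))
    · have := hK.upper (x₀ - xs)
      linarith
    · rw [sub_nonneg, div_le_one (by linarith)]
      exact hs

/-- The number of gradient steps in each half of a round of Alternating Best Response. -/
noncomputable def agdSteps (κ : ℝ) : ℕ := ⌈2 * √κ * Real.log (24 * κ)⌉₊

/-- The number of steps brings the geometric factor below `1 / (24 κ)²`. After the initial loss `κ +
1` there remains `(κ + 1) / (24 κ)² ≤ 1 / 16²`. -/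
theorem agd_spec_contraction {d : ℕ}
    {grad : EuclideanSpace ℝ (Fin d) → Counted (EuclideanSpace ℝ (Fin d))}
    {K : EuclideanSpace ℝ (Fin d) →ₗ[ℝ] EuclideanSpace ℝ (Fin d)}
    {b xs : EuclideanSpace ℝ (Fin d)} {μ l c : ℝ} (hgrad : ∀ x, (grad x).Spec c (· = K x - b))
    (hK : HasBounds K μ l) (hμ : 0 < μ) (hl : μ ≤ l) (hxs : K xs = b)
    (x₀ : EuclideanSpace ℝ (Fin d)) :
    (agd grad l μ x₀ (agdSteps (l / μ))).Spec (agdSteps (l / μ) * c) fun x =>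
      ‖x - xs‖ ≤ 1 / 16 * ‖x₀ - xs‖ := by
  refine (agd_spec hgrad hK hμ hl hxs x₀ _).mono le_rfl fun x hx => ?_
  have hκ : 1 ≤ l / μ := (one_le_div hμ).2 hl
  set κ := l / μ with hκd
  have hs : 1 ≤ √κ := Real.one_le_sqrt.2 hκ
  have hlκ : l = μ * κ := by rw [hκd, mul_div_cancel₀ _ hμ.ne']
  have h1 : (1 - 1 / √κ) ^ agdSteps κ ≤ 1 / (24 * κ) ^ 2 := by
    refine (pow_one_sub_le_exp ((div_le_one (by linarith)).2 hs) _).trans ?_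
    have h2 : 2 * √κ * Real.log (24 * κ) ≤ agdSteps κ := Nat.le_ceil _
    have h3 : 2 * Real.log (24 * κ) ≤ 1 / √κ * agdSteps κ := by
      rw [div_mul_eq_mul_div, one_mul, le_div_iff₀ (by linarith)]
      linarith
    calc Real.exp (-(1 / √κ * agdSteps κ)) ≤ Real.exp (-(2 * Real.log (24 * κ))) := by
          gcongr
      _ = 1 / (24 * κ) ^ 2 := by
          rw [Real.exp_neg, two_mul, Real.exp_add, Real.exp_log (by linarith), one_div, sq]
  have h4 : μ * ‖x - xs‖ ^ 2 ≤ μ * (1 / 16 * ‖x₀ - xs‖) ^ 2 := by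
    refine hx.trans ?_
    calc (1 - 1 / √κ) ^ agdSteps κ * ((l + μ) * ‖x₀ - xs‖ ^ 2)
        ≤ 1 / (24 * κ) ^ 2 * ((l + μ) * ‖x₀ - xs‖ ^ 2) :=
          mul_le_mul_of_nonneg_right h1 (mul_nonneg (by linarith) (sq_nonneg _))
      _ = μ * ((κ + 1) / (24 * κ) ^ 2) * ‖x₀ - xs‖ ^ 2 := by rw [hlκ]; ring
      _ ≤ μ * (1 / 16) ^ 2 * ‖x₀ - xs‖ ^ 2 := by
          gcongr
          rw [div_le_iff₀ (by positivity)]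
          nlinarith
      _ = _ := by ring
  have h5 := le_of_mul_le_mul_left h4 hμ
  exact abs_le_of_sq_le_sq' h5 (by positivity) |>.2

theorem norm_ZSpace_sq {n m : ℕ} (z : ZSpace n m) : ‖z‖ ^ 2 = ‖z.fst‖ ^ 2 + ‖z.snd‖ ^ 2 :=
  WithLp.prod_norm_sq_eq_of_L2 z

theorem norm_ZSpace_fst_le {n m : ℕ} (z : ZSpace n m) : ‖z.fst‖ ≤ ‖z‖ := by
  refine abs_le_of_sq_le_sq' ?_ (norm_nonneg _) |>.2
  rw [norm_ZSpace_sq z]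
  linarith [sq_nonneg ‖z.snd‖]

theorem norm_ZSpace_snd_le {n m : ℕ} (z : ZSpace n m) : ‖z.snd‖ ≤ ‖z‖ := by
  refine abs_le_of_sq_le_sq' ?_ (norm_nonneg _) |>.2
  rw [norm_ZSpace_sq z]
  linarith [sq_nonneg ‖z.fst‖]

theorem norm_ZSpace_le {n m : ℕ} (z : ZSpace n m) : ‖z‖ ≤ ‖z.fst‖ + ‖z.snd‖ := by
  refine abs_le_of_sq_le_sq' ?_ (by positivity) |>.2
  rw [norm_ZSpace_sq z]
  nlinarith [norm_nonneg z.fst, norm_nonneg z.snd]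

/-- The number of rounds of Alternating Best Response, less one. -/
noncomputable def abrRounds (κ ε : ℝ) : ℕ := ⌈Real.logb 2 (4 * √(κ + κ) / ε)⌉₊

section ABR

variable {n m : ℕ}
  {gX : EuclideanSpace ℝ (Fin n) → EuclideanSpace ℝ (Fin m) → Counted (EuclideanSpace ℝ (Fin n))}
  {gY : EuclideanSpace ℝ (Fin n) → EuclideanSpace ℝ (Fin m) → Counted (EuclideanSpace ℝ (Fin m))}
  {A : EuclideanSpace ℝ (Fin n) →ₗ[ℝ] EuclideanSpace ℝ (Fin n)}
  {B : EuclideanSpace ℝ (Fin m) →ₗ[ℝ] EuclideanSpace ℝ (Fin n)}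
  {Bt : EuclideanSpace ℝ (Fin n) →ₗ[ℝ] EuclideanSpace ℝ (Fin m)}
  {C : EuclideanSpace ℝ (Fin m) →ₗ[ℝ] EuclideanSpace ℝ (Fin m)}
  {u : EuclideanSpace ℝ (Fin n)} {v : EuclideanSpace ℝ (Fin m)}

/-- Alternating Best Response on a saddle function that is `μ`-strongly convex-concave and
`l`-smooth in each block, with an interaction of size at most `μ / 2`. -/
theorem abr_spec {c μ l ε : ℝ} (hgX : ∀ x y, (gX x y).Spec c (· = A x + B y + u))
    (hgY : ∀ x y, (gY x y).Spec c (· = Bt x - C y + v)) (hμ : 0 < μ) (hl : μ ≤ l)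
    (hA : HasBounds A μ l) (hC : HasBounds C μ l) (hB : ∀ y, ‖B y‖ ≤ μ / 2 * ‖y‖)
    (hBt : ∀ x, ‖Bt x‖ ≤ μ / 2 * ‖x‖) (hε : 0 < ε) {xs : EuclideanSpace ℝ (Fin n)}
    {ys : EuclideanSpace ℝ (Fin m)} (hxs : A xs + B ys + u = 0) (hys : Bt xs - C ys + v = 0)
    (z₀ : ZSpace n m) :
    (abr gX gY z₀ ε μ μ l l).Spec
      (((abrRounds (l / μ) ε + 1 : ℕ) : ℝ) * (agdSteps (l / μ) * c + agdSteps (l / μ) * c))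
      fun z => ‖z - mkZ xs ys‖ ≤ ε * ‖z₀ - mkZ xs ys‖ := by
  obtain ⟨Ai, hAi, -, -, hAn, -⟩ := hA.exists_inverse hμ
  obtain ⟨Ci, hCi, -, -, hCn, -⟩ := hC.exists_inverse hμ
  have hκ : 1 ≤ l / μ := (one_le_div hμ).2 hl
  -- Each best response is `1/2`-Lipschitz in the other variable, and its approximation has relative
  -- error `1/16`. Since `x` is updated before `y`, the weight `4` on the error of `y` makes each
  -- round halve `W`.
  set W : ZSpace n m → ℝ := fun z => ‖z.fst - xs‖ + 4 * ‖z.snd - ys‖ with hW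
  have hround : ∀ (t : ℕ) (z : ZSpace n m), W z ≤ (1 / 2) ^ t * W z₀ →
      (do
        let x ← agd (fun x => gX x z.snd) l μ z.fst ⌈2 * √(l / μ) * Real.log (24 * (l / μ))⌉₊
        let y ← agd (fun y => do let g ← gY x y; pure (-g)) l μ z.snd
          ⌈2 * √(l / μ) * Real.log (24 * (l / μ))⌉₊
        pure (mkZ x y) : Counted (ZSpace n m)).Spec
      (agdSteps (l / μ) * c + agdSteps (l / μ) * c)
      fun z' => W z' ≤ (1 / 2) ^ (t + 1) * W z₀ := by
    intro t z hz
    -- With `y` frozen, the minimiser in `x` is `xs - A⁻¹ B (y - ys)`; similarly for `y` below.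
    have h1 := agd_spec_contraction (grad := fun x => gX x z.snd) (K := A) (c := c)
      (b := -(B z.snd + u)) (xs := xs - Ai (B (z.snd - ys)))
      (fun x => (hgX x z.snd).mono le_rfl fun a ha => by rw [ha]; abel) hA hμ hl
      (by
        rw [map_sub, hAi, map_sub]
        have : A xs = -(B ys + u) := by rw [eq_neg_iff_add_eq_zero, ← hxs]; abel
        rw [this]; abel) z.fst
    refine h1.bind fun x hx => ?_
    have h2 := agd_spec_contraction (grad := fun y => do let g ← gY x y; pure (-g)) (K := C)
      (c := c) (b := Bt x + v) (xs := ys + Ci (Bt (x - xs)))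
      (fun y => Counted.Spec.bind_pure (hgY x y) fun a ha => by rw [ha]; abel) hC hμ hl
      (by
        rw [map_add, hCi, map_sub]
        have : C ys = Bt xs + v := by
          rw [← sub_eq_zero, ← neg_eq_zero, ← hys]; abel
        rw [this]; abel) z.snd
    refine Counted.Spec.bind_pure h2 fun y hy => ?_
    have n1 : ‖Ai (B (z.snd - ys))‖ ≤ 1 / 2 * ‖z.snd - ys‖ := by
      refine le_of_mul_le_mul_left ?_ hμ
      linarith [hAn (B (z.snd - ys)), hB (z.snd - ys)]
    have n2 : ‖Ci (Bt (x - xs))‖ ≤ 1 / 2 * ‖x - xs‖ := by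
      refine le_of_mul_le_mul_left ?_ hμ
      linarith [hCn (Bt (x - xs)), hBt (x - xs)]
    have t1 : ‖x - xs‖ ≤ ‖x - (xs - Ai (B (z.snd - ys)))‖ + ‖Ai (B (z.snd - ys))‖ := by
      rw [show x - xs = x - (xs - Ai (B (z.snd - ys))) - Ai (B (z.snd - ys)) by abel]
      exact norm_sub_le _ _
    have t2 : ‖z.fst - (xs - Ai (B (z.snd - ys)))‖ ≤ ‖z.fst - xs‖ + ‖Ai (B (z.snd - ys))‖ := by
      rw [show z.fst - (xs - Ai (B (z.snd - ys))) = z.fst - xs + Ai (B (z.snd - ys)) by abel]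
      exact norm_add_le _ _
    have t3 : ‖y - ys‖ ≤ ‖y - (ys + Ci (Bt (x - xs)))‖ + ‖Ci (Bt (x - xs))‖ := by
      rw [show y - ys = y - (ys + Ci (Bt (x - xs))) + Ci (Bt (x - xs)) by abel]
      exact norm_add_le _ _
    have t4 : ‖z.snd - (ys + Ci (Bt (x - xs)))‖ ≤ ‖z.snd - ys‖ + ‖Ci (Bt (x - xs))‖ := by
      rw [show z.snd - (ys + Ci (Bt (x - xs))) = z.snd - ys - Ci (Bt (x - xs)) by abel]
      exact norm_sub_le _ _
    have hstep : W (mkZ x y) ≤ 1 / 2 * W z := by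
      change ‖x - xs‖ + 4 * ‖y - ys‖ ≤ 1 / 2 * (‖z.fst - xs‖ + 4 * ‖z.snd - ys‖)
      linarith [norm_nonneg (z.fst - xs), norm_nonneg (z.snd - ys)]
    calc W (mkZ x y) ≤ 1 / 2 * W z := hstep
      _ ≤ 1 / 2 * ((1 / 2) ^ t * W z₀) := by gcongr
      _ = _ := by ring
  have := Counted.Spec.iter (fun t z => W z ≤ (1 / 2) ^ t * W z₀) hround
    (abrRounds (l / μ) ε + 1) (t := 0) (s := z₀) (by simp)
  refine Counted.Spec.mono this le_rfl fun z hz => ?_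
  have hz1 : ‖z - mkZ xs ys‖ ≤ W z := by
    refine (norm_ZSpace_le _).trans ?_
    change ‖z.fst - xs‖ + ‖z.snd - ys‖ ≤ ‖z.fst - xs‖ + 4 * ‖z.snd - ys‖
    linarith [norm_nonneg (z.snd - ys)]
  have hz0 : W z₀ ≤ 5 * ‖z₀ - mkZ xs ys‖ := by
    have h1 : ‖z₀.fst - xs‖ ≤ ‖z₀ - mkZ xs ys‖ := norm_ZSpace_fst_le (z₀ - mkZ xs ys)
    have h2 : ‖z₀.snd - ys‖ ≤ ‖z₀ - mkZ xs ys‖ := norm_ZSpace_snd_le (z₀ - mkZ xs ys)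
    change ‖z₀.fst - xs‖ + 4 * ‖z₀.snd - ys‖ ≤ _
    linarith
  -- The rounding up alone gives `4 ≤ 2^T ε`; the additional round absorbs the factor `5` lost
  -- between `W` and the norm.
  have hpow : 5 * (1 / 2 : ℝ) ^ (abrRounds (l / μ) ε + 1) ≤ ε := by
    have h1 : Real.logb 2 (4 * √(l / μ + l / μ) / ε) ≤ abrRounds (l / μ) ε := Nat.le_ceil _
    have hsq : 1 ≤ √(l / μ + l / μ) := Real.one_le_sqrt.2 (by linarith)
    rw [Real.logb_le_iff_le_rpow (by norm_num) (by positivity), Real.rpow_natCast,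
      div_le_iff₀ hε] at h1
    have h2 : 4 ≤ 2 ^ abrRounds (l / μ) ε * ε := by linarith
    rw [one_div, inv_pow, ← div_eq_mul_inv, div_le_iff₀ (by positivity), pow_succ]
    linarith
  rw [zero_add] at hz
  calc ‖z - mkZ xs ys‖ ≤ (1 / 2) ^ (abrRounds (l / μ) ε + 1) * W z₀ := hz1.trans hz
    _ ≤ (1 / 2) ^ (abrRounds (l / μ) ε + 1) * (5 * ‖z₀ - mkZ xs ys‖) := by gcongr
    _ = 5 * (1 / 2) ^ (abrRounds (l / μ) ε + 1) * ‖z₀ - mkZ xs ys‖ := by ring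
    _ ≤ _ := by gcongr

end ABR

/-! ### The inexact accelerated proximal point method. -/

section PairNorm

open scoped InnerProductSpace

variable {E F : Type*} [NormedAddCommGroup E] [NormedAddCommGroup F]

/-- The Euclidean norm of the pair `[x; y]`. -/
noncomputable def pairNorm (x : E) (y : F) : ℝ := ‖(WithLp.toLp 2 (x, y) : WithLp 2 (E × F))‖

theorem pairNorm_nonneg (x : E) (y : F) : 0 ≤ pairNorm x y := norm_nonneg _

theorem pairNorm_sq (x : E) (y : F) : pairNorm x y ^ 2 = ‖x‖ ^ 2 + ‖y‖ ^ 2 := by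
  rw [pairNorm, WithLp.prod_norm_sq_eq_of_L2]
  rfl

theorem pairNorm_swap (x : E) (y : F) : pairNorm y x = pairNorm x y := by
  refine (pow_left_inj₀ (pairNorm_nonneg _ _) (pairNorm_nonneg _ _) two_ne_zero).1 ?_
  rw [pairNorm_sq, pairNorm_sq, add_comm]

theorem pairNorm_add_le (x x' : E) (y y' : F) :
    pairNorm (x + x') (y + y') ≤ pairNorm x y + pairNorm x' y' :=
  norm_add_le (WithLp.toLp 2 (x, y) : WithLp 2 (E × F)) (WithLp.toLp 2 (x', y'))

theorem norm_left_le_pairNorm (x : E) (y : F) : ‖x‖ ≤ pairNorm x y := by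
  refine abs_le_of_sq_le_sq' ?_ (pairNorm_nonneg _ _) |>.2
  rw [pairNorm_sq]
  linarith [sq_nonneg ‖y‖]

theorem pairNorm_le_add (x : E) (y : F) : pairNorm x y ≤ ‖x‖ + ‖y‖ := by
  refine abs_le_of_sq_le_sq' ?_ (by positivity) |>.2
  rw [pairNorm_sq]
  nlinarith [norm_nonneg x, norm_nonneg y]

end PairNorm

section ProximalPoint

open scoped InnerProductSpace

variable {E F : Type*} [NormedAddCommGroup E] [InnerProductSpace ℝ E] [NormedAddCommGroup F]
  [InnerProductSpace ℝ F]

/-- The Lyapunov function of the accelerated proximal point method for `½ ⟪x, Q x⟫`. -/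
noncomputable def appaEnergy (Q : E →ₗ[ℝ] E) (m : ℝ) (x v : E) : ℝ :=
  1 / 2 * ⟪x, Q x⟫_ℝ + m / 4 * ‖v‖ ^ 2

theorem appaEnergy_nonneg {Q : E →ₗ[ℝ] E} {m q : ℝ} (hQ : HasBounds Q m q) (hm : 0 ≤ m)
    (x v : E) : 0 ≤ appaEnergy Q m x v := by
  have := hQ.inner_nonneg hm x
  unfold appaEnergy
  positivity

/-- The energy is a nonnegative quadratic form in `(x, v)`, so its root is a seminorm. This is why
the errors of inexact steps enter additively. -/
theorem sqrt_appaEnergy_add_le {Q : E →ₗ[ℝ] E} {m q : ℝ} (hQ : HasBounds Q m q) (hm : 0 ≤ m)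
    (x v x' v' : E) :
    √(appaEnergy Q m (x + x') (v + v')) ≤
      √(appaEnergy Q m x v) + √(appaEnergy Q m x' v') := by
  have key : ∀ t : ℝ, appaEnergy Q m (x + t • x') (v + t • v') = appaEnergy Q m x v +
      2 * (1 / 2 * ⟪x, Q x'⟫_ℝ + m / 4 * ⟪v, v'⟫_ℝ) * t + appaEnergy Q m x' v' * t ^ 2 := by
    intro t
    unfold appaEnergy
    rw [quadratic_line hQ.symm, norm_add_sq_real, norm_smul, real_inner_smul_right, mul_pow,
      Real.norm_eq_abs, sq_abs]
    ring
  have := (sqrt_add_le_of_quadratic_nonneg fun t => by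
    rw [← key]; exact appaEnergy_nonneg hQ hm _ _).2
  have h1 := key 1
  simp only [one_smul, mul_one, one_pow] at h1
  rwa [h1]

theorem norm_le_sqrt_appaEnergy {Q : E →ₗ[ℝ] E} {m q : ℝ} (hQ : HasBounds Q m q) (hm : 0 < m)
    (x v : E) : ‖x‖ ≤ 3 / 2 / √m * √(appaEnergy Q m x v) := by
  have h1 : m / 2 * ‖x‖ ^ 2 ≤ appaEnergy Q m x v := by
    have := hQ.lower x
    have : 0 ≤ m / 4 * ‖v‖ ^ 2 := by positivity
    unfold appaEnergy
    linarith
  refine abs_le_of_sq_le_sq' ?_ (by positivity) |>.2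
  rw [mul_pow, Real.sq_sqrt (appaEnergy_nonneg hQ hm.le _ _), div_pow, Real.sq_sqrt hm.le,
    div_mul_eq_mul_div, le_div_iff₀ hm]
  nlinarith [sq_nonneg ‖x‖]

/-- One exact step of the accelerated proximal point method contracts the Lyapunov function. -/
theorem appaEnergy_exact_step {Q : E →ₗ[ℝ] E} {m q β s : ℝ} (hQ : HasBounds Q m q) (hm : 0 < m)
    (hs : 2 ≤ s) (hβ : 4 * β = m * s ^ 2) {x xh xp : E} (hxp : Q xp = (2 * β) • (xh - xp)) :
    appaEnergy Q m xp (x + s • (xp - x) + (1 / s) • (xp - xh)) ≤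
      (1 - 1 / s) * appaEnergy Q m x ((s + 1) • xh - s • x) := by
  have hs0 : 0 < s := by linarith
  set g := Q xp with hg
  have hxh : xh = xp + (2 / (m * s ^ 2)) • g := by
    have : (2 / (m * s ^ 2)) * (2 * β) = 1 := by
      rw [show 2 * β = m * s ^ 2 / 2 by linarith]; field_simp
    rw [hxp, smul_smul, this, one_smul]
    abel
  have e1 : x + s • (xp - x) + (1 / s) • (xp - xh) =
      s • xp + (1 - s) • x + (-(2 / (m * s ^ 3))) • g := by
    rw [hxh]
    match_scalars <;> field_simp <;> ring
  have e2 : (s + 1) • xh - s • x = (s + 1) • xp + (-s) • x + ((s + 1) * (2 / (m * s ^ 2))) • g := by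
    rw [hxh]
    module
  unfold appaEnergy
  rw [e1, e2, norm_sq_smul_add₃, norm_sq_smul_add₃]
  have e3 : 0 ≤ ⟪x, Q x⟫_ℝ - 2 * ⟪x, g⟫_ℝ + ⟪xp, g⟫_ℝ := by
    have := hQ.inner_nonneg hm.le (x - xp)
    simp only [map_sub, inner_sub_left, inner_sub_right, ← hg] at this
    rw [← hQ.symm xp x, ← hg, real_inner_comm x g] at this
    linarith
  have e4 := hQ.lower xp
  rw [← hg] at e4
  have e5 : 0 ≤ ‖s • xp + (-s) • x + ((s + 1) * (2 / (m * s ^ 2))) • g‖ ^ 2 := by positivity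
  rw [norm_sq_smul_add₃] at e5
  have e6 : 0 ≤ ‖g‖ ^ 2 := by positivity
  have e7 : 0 ≤ ‖xp‖ ^ 2 := by positivity
  set pg := ⟪xp, g⟫_ℝ
  set xg := ⟪x, g⟫_ℝ
  set gg := ‖g‖ ^ 2
  set xx := ‖x‖ ^ 2
  set pp := ‖xp‖ ^ 2
  set px := ⟪xp, x⟫_ℝ
  set xQx := ⟪x, Q x⟫_ℝ
  have p1 : 0 ≤ (1 - 1 / s) / 2 * (xQx - 2 * xg + pg) := by
    refine mul_nonneg (div_nonneg ?_ (by norm_num)) e3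
    rw [sub_nonneg, div_le_one hs0]; linarith
  have p2 : 0 ≤ 1 / (2 * s) * (pg - m * pp) := mul_nonneg (by positivity) (by linarith)
  have p3 : 0 ≤ m / 4 * (1 / s * (1 - 1 / s)) * (s ^ 2 * pp + (-s) ^ 2 * xx + ((s + 1) * (2 / (m * s ^ 2))) ^ 2 * gg +
      2 * (s * -s) * px + 2 * (s * ((s + 1) * (2 / (m * s ^ 2)))) * pg +
      2 * (-s * ((s + 1) * (2 / (m * s ^ 2)))) * xg) := by
    refine mul_nonneg (mul_nonneg (by positivity) (mul_nonneg (by positivity) ?_)) e5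
    rw [sub_nonneg, div_le_one hs0]; linarith
  have p4 : 0 ≤ m / 4 * (1 / s) * pp := by positivity
  have p5 : 0 ≤ 1 / (m * s ^ 2) * (1 - 2 / s ^ 2) * gg := by
    refine mul_nonneg (mul_nonneg (by positivity) ?_) e6
    rw [sub_nonneg, div_le_one (by positivity)]
    nlinarith
  have key : (1 - 1 / s) * (1 / 2 * xQx + m / 4 * ((s + 1) ^ 2 * pp + (-s) ^ 2 * xx +
      ((s + 1) * (2 / (m * s ^ 2))) ^ 2 * gg + 2 * ((s + 1) * -s) * px +
      2 * ((s + 1) * ((s + 1) * (2 / (m * s ^ 2)))) * pg +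
      2 * (-s * ((s + 1) * (2 / (m * s ^ 2)))) * xg)) -
      (1 / 2 * pg + m / 4 * (s ^ 2 * pp + (1 - s) ^ 2 * xx + (-(2 / (m * s ^ 3))) ^ 2 * gg +
      2 * (s * (1 - s)) * px + 2 * (s * -(2 / (m * s ^ 3))) * pg +
      2 * ((1 - s) * -(2 / (m * s ^ 3))) * xg)) =
      (1 - 1 / s) / 2 * (xQx - 2 * xg + pg) + 1 / (2 * s) * (pg - m * pp) +
      m / 4 * (1 / s * (1 - 1 / s)) * (s ^ 2 * pp + (-s) ^ 2 * xx + ((s + 1) * (2 / (m * s ^ 2))) ^ 2 * gg +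
      2 * (s * -s) * px + 2 * (s * ((s + 1) * (2 / (m * s ^ 2)))) * pg +
      2 * (-s * ((s + 1) * (2 / (m * s ^ 2)))) * xg) + m / 4 * (1 / s) * pp +
      1 / (m * s ^ 2) * (1 - 2 / s ^ 2) * gg := by
    field_simp
    ring
  linarith

end ProximalPoint

section InexactProximalPoint

open scoped InnerProductSpace

variable {E F : Type*} [NormedAddCommGroup E] [InnerProductSpace ℝ E] [NormedAddCommGroup F]
  [InnerProductSpace ℝ F]

/-- The data of an inexact accelerated proximal point method for a saddle point problem: `Q` is the
Hessian of the function of the primary variable that remains when the secondary variable is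
eliminated, `R` is the best response of the secondary variable, and `ε` is the relative precision
to which the proximal subproblems are solved. -/
structure AppaData (Q : E →ₗ[ℝ] E) (R : E →ₗ[ℝ] F) (m q ρ s β Δ ε : ℝ) : Prop where
  bounds : HasBounds Q m q
  m_pos : 0 < m
  norm_response_le : ∀ x, ‖R x‖ ≤ ρ * ‖x‖
  rho_nonneg : 0 ≤ ρ
  two_le_s : 2 ≤ s
  four_mul_beta : 4 * β = m * s ^ 2
  delta_nonneg : 0 ≤ Δ
  le_delta_sq : q / (2 * m) + (s + 1 / s) ^ 2 / 4 ≤ Δ ^ 2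
  eps_nonneg : 0 ≤ ε
  eps_le : ε * (2 + ρ) ≤ 1 / 8
  eps_delta_le : 10 * ε * Δ * (1 + ρ) * s ≤ 1

/-- The potential of the inexact method at the iterate `(x, y)` with extrapolated point `xh`, if
`xo` is the exact proximal point approximated by `x`. -/
noncomputable def appaPotential (Q : E →ₗ[ℝ] E) (R : E →ₗ[ℝ] F) (m s Δ : ℝ) (x : E) (y : F)
    (xh xo : E) : ℝ :=
  √(appaEnergy Q m x ((s + 1) • xh - s • x)) + √m * Δ / 4 * pairNorm (x - xo) (y - R xo)

namespace AppaData

variable {Q : E →ₗ[ℝ] E} {R : E →ₗ[ℝ] F} {m q ρ s β Δ ε : ℝ}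

theorem pairNorm_response_le (h : AppaData Q R m q ρ s β Δ ε) (x : E) :
    pairNorm x (R x) ≤ (1 + ρ) * ‖x‖ := by
  have := pairNorm_le_add x (R x)
  linarith [h.norm_response_le x]

theorem one_le_delta (h : AppaData Q R m q ρ s β Δ ε) (hq : 0 ≤ q) : 1 ≤ Δ := by
  have h1 := h.le_delta_sq
  have h2 := h.two_le_s
  have h3 : 0 ≤ q / (2 * m) := div_nonneg hq (by linarith [h.m_pos])
  have h4 : 2 ≤ s + 1 / s := by
    have : 0 ≤ 1 / s := by positivity
    linarith
  nlinarith [h.delta_nonneg]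

/-- The purpose of `Δ`: an error `x` in the primary variable, with its effect `c • x` on the
auxiliary variable, changes the root of the energy by at most `√m Δ ‖x‖`. -/
theorem energy_le (h : AppaData Q R m q ρ s β Δ ε) (x : E) {c : ℝ}
    (hc : c ^ 2 ≤ (s + 1 / s) ^ 2) :
    √(appaEnergy Q m x (c • x)) ≤ √m * Δ * ‖x‖ := by
  have hm := h.m_pos
  have hΔ := h.delta_nonneg
  refine Real.sqrt_le_iff.2 ⟨by positivity, ?_⟩
  rw [mul_pow, mul_pow, Real.sq_sqrt hm.le]
  unfold appaEnergy
  have h1 := h.bounds.upper x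
  have h2 : m * (q / (2 * m) + (s + 1 / s) ^ 2 / 4) ≤ m * Δ ^ 2 :=
    mul_le_mul_of_nonneg_left h.le_delta_sq hm.le
  have h3 : m * (q / (2 * m) + (s + 1 / s) ^ 2 / 4) = q / 2 + m / 4 * (s + 1 / s) ^ 2 := by
    field_simp
  have h5 : m / 4 * c ^ 2 ≤ m / 4 * (s + 1 / s) ^ 2 := by gcongr
  have h4 : (q / 2 + m / 4 * c ^ 2) * ‖x‖ ^ 2 ≤ m * Δ ^ 2 * ‖x‖ ^ 2 := by
    gcongr
    linarith
  rw [norm_smul, mul_pow, Real.norm_eq_abs, sq_abs]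
  linarith

/-- The subproblem is solved to an accuracy relative to its warm start, which the energy alone does
not control; hence the distance term in the potential. With `U` the root of the energy and `d` the
distance, `U' ≤ (1 - 1/(2s)) U + √m Δ d'`, and `d'` is at most `d/8` plus a small multiple of `U`.
The weight `√m Δ / 4` absorbs `d/8`, and `eps_delta_le` limits the contribution of `U` to `3/(8s)`.
-/
theorem potential_step (h : AppaData Q R m q ρ s β Δ ε) {x x' xh xh' xo xp : E} {y y' : F}
    (hxp : Q xp = (2 * β) • (xh - xp))
    (hacc : pairNorm (x' - xp) (y' - R xp) ≤ ε * pairNorm (x - xp) (y - R xp))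
    (hxh' : xh' = x' + ((s - 1) / (s + 1)) • (x' - x) + (1 / (s + s ^ 2)) • (x' - xh)) :
    appaPotential Q R m s Δ x' y' xh' xp ≤
      (1 - 1 / (8 * s)) * appaPotential Q R m s Δ x y xh xo := by
  have hm := h.m_pos
  have hρ := h.rho_nonneg
  have hΔ := h.delta_nonneg
  have hs := h.two_le_s
  have hs0 : 0 < s := by linarith
  have hε := h.eps_nonneg
  set U := √(appaEnergy Q m x ((s + 1) • xh - s • x)) with hU
  set d := pairNorm (x - xo) (y - R xo) with hd
  set d' := pairNorm (x' - xp) (y' - R xp) with hd'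
  have hd0 : 0 ≤ d := pairNorm_nonneg _ _
  have hd'0 : 0 ≤ d' := pairNorm_nonneg _ _
  have hU0 : 0 ≤ U := Real.sqrt_nonneg _
  have hq1 : 1 / s ≤ 1 := by rw [div_le_one hs0]; linarith
  have hq2 : 1 / s ≤ 1 / 2 := by gcongr
  -- the exact step
  have hex : √(appaEnergy Q m xp (x + s • (xp - x) + (1 / s) • (xp - xh))) ≤
      (1 - 1 / (2 * s)) * U := by
    refine (Real.sqrt_le_sqrt (appaEnergy_exact_step h.bounds hm hs h.four_mul_beta hxp)).trans ?_
    rw [Real.sqrt_mul (by linarith)]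
    refine mul_le_mul_of_nonneg_right (Real.sqrt_le_iff.2 ⟨?_, ?_⟩) hU0
    · have : 1 / (2 * s) ≤ 1 := by rw [div_le_one (by linarith)]; linarith
      linarith
    · have : 1 / (2 * s) = 1 / s / 2 := by field_simp
      rw [this]
      nlinarith [sq_nonneg (1 / s)]
  have hU' : √(appaEnergy Q m x' ((s + 1) • xh' - s • x')) ≤
      (1 - 1 / (2 * s)) * U + √m * Δ * d' := by
    -- The extrapolation weights are chosen so that the auxiliary variable is that of the exact step
    -- plus `s + 1/s` times the error in `x'`.
    have hv : (s + 1) • xh' - s • x' = (x + s • (xp - x) + (1 / s) • (xp - xh)) +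
        (s + 1 / s) • (x' - xp) := by
      rw [hxh']
      match_scalars <;> field_simp <;> ring
    rw [hv]
    have h1 := sqrt_appaEnergy_add_le h.bounds hm.le xp
      (x + s • (xp - x) + (1 / s) • (xp - xh)) (x' - xp) ((s + 1 / s) • (x' - xp))
    rw [add_sub_cancel] at h1
    have h2 := h.energy_le (x' - xp) (c := s + 1 / s) le_rfl
    have h3 : √m * Δ * ‖x' - xp‖ ≤ √m * Δ * d' := by
      gcongr
      exact norm_left_le_pairNorm _ _
    linarith
  -- the distance to the exact proximal point
  have hxp' : ‖xp‖ ≤ 3 / 2 / √m * U := by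
    refine (norm_le_sqrt_appaEnergy h.bounds hm xp
      (x + s • (xp - x) + (1 / s) • (xp - xh))).trans ?_
    gcongr
    refine hex.trans ?_
    have : 0 ≤ 1 / (2 * s) * U := by positivity
    linarith
  have hx : ‖x‖ ≤ 3 / 2 / √m * U := norm_le_sqrt_appaEnergy h.bounds hm x _
  -- The warm start is near the previous exact point `xo`, and `xo` and `xp` are not far apart
  -- because `x` and `xp` are both bounded by `U / √m`.
  have hdist : pairNorm (x - xp) (y - R xp) ≤ (2 + ρ) * d + (1 + ρ) * (3 / √m * U) := by
    have h1 := pairNorm_add_le (x - xo) (xo - xp) (y - R xo) (R (xo - xp))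
    rw [map_sub, sub_add_sub_cancel, sub_add_sub_cancel, ← map_sub] at h1
    have h2 := h.pairNorm_response_le (xo - xp)
    have h3 : ‖xo - xp‖ ≤ d + 3 / √m * U := by
      have e1 : ‖xo - xp‖ ≤ ‖x - xo‖ + ‖x‖ + ‖xp‖ := by
        rw [show xo - xp = -(x - xo) + x - xp by abel]
        refine (norm_sub_le _ _).trans ?_
        gcongr
        refine (norm_add_le _ _).trans ?_
        rw [norm_neg]
      have e2 := norm_left_le_pairNorm (x - xo) (y - R xo)
      have e3 : 3 / √m * U = 3 / 2 / √m * U + 3 / 2 / √m * U := by ring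
      linarith
    have h4 := mul_le_mul_of_nonneg_left h3 (by linarith : 0 ≤ 1 + ρ)
    linarith
  have hd'' : d' ≤ 1 / 8 * d + ε * (1 + ρ) * (3 / √m) * U := by
    have h1 := mul_le_mul_of_nonneg_left hdist hε
    have h2 := mul_le_mul_of_nonneg_right h.eps_le hd0
    linarith
  have hmm : √m ≠ 0 := (Real.sqrt_pos.2 hm).ne'
  have hfin : 5 / 4 * (√m * Δ * (ε * (1 + ρ) * (3 / √m) * U)) ≤ 3 / 8 * (1 / s) * U := by
    have h1 : 5 / 4 * (√m * Δ * (ε * (1 + ρ) * (3 / √m) * U)) =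
        3 / 8 * (1 / s) * (10 * ε * Δ * (1 + ρ) * s) * U := by
      field_simp
      ring
    rw [h1]
    have h2 : 3 / 8 * (1 / s) * (10 * ε * Δ * (1 + ρ) * s) ≤ 3 / 8 * (1 / s) * 1 :=
      mul_le_mul_of_nonneg_left h.eps_delta_le (by positivity)
    rw [mul_one] at h2
    exact mul_le_mul_of_nonneg_right h2 hU0
  have hm0 : 0 ≤ √m * Δ := by positivity
  have h1 := mul_le_mul_of_nonneg_left hd'' hm0
  have h2 : 1 / (8 * s) * (√m * Δ * d) ≤ 1 / 16 * (√m * Δ * d) := by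
    refine mul_le_mul_of_nonneg_right ?_ (by positivity)
    rw [show 1 / (8 * s) = 1 / s / 8 by field_simp]
    linarith
  have h3 : 0 ≤ √m * Δ * d := by positivity
  unfold appaPotential
  rw [← hU, ← hd, ← hd']
  have e1 : 1 / (8 * s) * U = 1 / 8 * (1 / s) * U := by field_simp
  have e2 : 1 / (2 * s) * U = 1 / 2 * (1 / s) * U := by field_simp
  nlinarith

/-- All quantities are errors, so the solution is the origin. Before the first round it plays the
role of the exact proximal point, hence the final argument `0`. -/
theorem potential_init (h : AppaData Q R m q ρ s β Δ ε) (x : E) (y : F) :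
    appaPotential Q R m s Δ x y x 0 ≤ 5 / 4 * (√m * Δ) * pairNorm x y := by
  have hs : 0 < s := by linarith [h.two_le_s]
  have hc : (1 : ℝ) ^ 2 ≤ (s + 1 / s) ^ 2 := by
    have : 0 ≤ 1 / s := by positivity
    exact pow_le_pow_left₀ (by norm_num) (by linarith [h.two_le_s]) 2
  have h1 := h.energy_le x hc
  have h2 : √m * Δ * ‖x‖ ≤ √m * Δ * pairNorm x y := by
    have := h.delta_nonneg
    gcongr
    exact norm_left_le_pairNorm x y
  unfold appaPotential
  rw [show (s + 1) • x - s • x = (1 : ℝ) • x by module, map_zero, sub_zero, sub_zero]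
  linarith

/-- The energy does not see `y`. It is recovered from its distance to the best response `R xo`,
where `xo` is controlled by `x` and the distance term. -/
theorem pairNorm_le_potential (h : AppaData Q R m q ρ s β Δ ε) (hq : 0 ≤ q) (x : E) (y : F)
    (xh xo : E) :
    pairNorm x y ≤ (10 + 6 * ρ) / √m * appaPotential Q R m s Δ x y xh xo := by
  have hm := h.m_pos
  have hρ := h.rho_nonneg
  have hΔ := h.one_le_delta hq
  have hmm : 0 < √m := Real.sqrt_pos.2 hm
  unfold appaPotential
  set U := √(appaEnergy Q m x ((s + 1) • xh - s • x)) with hU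
  set d := pairNorm (x - xo) (y - R xo) with hd
  have hd0 : 0 ≤ d := pairNorm_nonneg _ _
  have hU0 : 0 ≤ U := Real.sqrt_nonneg _
  have hx : ‖x‖ ≤ 3 / 2 / √m * U := norm_le_sqrt_appaEnergy h.bounds hm x _
  have h1 := pairNorm_add_le (x - xo) xo (y - R xo) (R xo)
  rw [sub_add_cancel, sub_add_cancel] at h1
  have h2 := h.pairNorm_response_le xo
  have h3 : ‖xo‖ ≤ d + ‖x‖ := by
    have e1 := norm_left_le_pairNorm (x - xo) (y - R xo)
    have e2 : ‖xo‖ ≤ ‖x - xo‖ + ‖x‖ := by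
      have := norm_sub_le x (x - xo)
      rw [sub_sub_cancel] at this
      linarith
    linarith
  have h4 : pairNorm x y ≤ (2 + ρ) * d + (1 + ρ) * (3 / 2 / √m * U) := by
    have := mul_le_mul_of_nonneg_left (h3.trans (add_le_add_right hx d))
      (by linarith : 0 ≤ 1 + ρ)
    linarith
  have h5 : d ≤ 4 / √m * (√m * Δ / 4 * d) := by
    have : 4 / √m * (√m * Δ / 4 * d) = Δ * d := by field_simp
    rw [this]
    nlinarith
  have h6 := mul_le_mul_of_nonneg_left h5 (by linarith : 0 ≤ 2 + ρ)
  refine (h4.trans (add_le_add_left h6 _)).trans ?_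
  rw [mul_add, add_comm]
  have hD : 0 ≤ √m * Δ / 4 * d := by positivity
  refine add_le_add ?_ ?_
  · rw [← mul_assoc]
    refine mul_le_mul_of_nonneg_right ?_ hU0
    rw [← mul_div_assoc]
    refine div_le_div_of_nonneg_right ?_ hmm.le
    linarith
  · rw [← mul_assoc]
    refine mul_le_mul_of_nonneg_right ?_ hD
    rw [← mul_div_assoc]
    refine div_le_div_of_nonneg_right ?_ hmm.le
    linarith

theorem pairNorm_le_of_potential_le (h : AppaData Q R m q ρ s β Δ ε) (hq : 0 ≤ q) {x x₀ : E}
    {y y₀ : F} {xh xo : E} {t : ℕ}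
    (ht : appaPotential Q R m s Δ x y xh xo ≤
      (1 - 1 / (8 * s)) ^ t * appaPotential Q R m s Δ x₀ y₀ x₀ 0) :
    pairNorm x y ≤ (13 + 8 * ρ) * Δ * (1 - 1 / (8 * s)) ^ t * pairNorm x₀ y₀ := by
  have hm := h.m_pos
  have hρ := h.rho_nonneg
  have hΔ := h.delta_nonneg
  have hs := h.two_le_s
  have hmm : 0 < √m := Real.sqrt_pos.2 hm
  have hp : 0 ≤ (1 - 1 / (8 * s)) ^ t := by
    refine pow_nonneg ?_ t
    rw [sub_nonneg, div_le_one (by linarith)]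
    linarith
  have h0 := pairNorm_nonneg x₀ y₀
  calc pairNorm x y ≤ (10 + 6 * ρ) / √m * appaPotential Q R m s Δ x y xh xo :=
        h.pairNorm_le_potential hq x y xh xo
    _ ≤ (10 + 6 * ρ) / √m *
        ((1 - 1 / (8 * s)) ^ t * (5 / 4 * (√m * Δ) * pairNorm x₀ y₀)) := by
        gcongr
        exact ht.trans (mul_le_mul_of_nonneg_left (h.potential_init x₀ y₀) hp)
    _ = (10 + 6 * ρ) * (5 / 4) * (Δ * (1 - 1 / (8 * s)) ^ t * pairNorm x₀ y₀) := by
        field_simp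
    _ ≤ (13 + 8 * ρ) * (Δ * (1 - 1 / (8 * s)) ^ t * pairNorm x₀ y₀) := by
        refine mul_le_mul_of_nonneg_right ?_ (by positivity)
        linarith
    _ = _ := by ring

end AppaData

end InexactProximalPoint

section PairNorm

variable {E F E' F' : Type*} [NormedAddCommGroup E] [NormedAddCommGroup F]
  [NormedAddCommGroup E'] [NormedAddCommGroup F']

theorem pairNorm_le_mul {x : E} {y : F} {a : E'} {b : F'} {c : ℝ} (hc : 0 ≤ c) (h1 : ‖a‖ ≤ c * ‖x‖)
    (h2 : ‖b‖ ≤ c * ‖y‖) : pairNorm a b ≤ c * pairNorm x y := by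
  refine abs_le_of_sq_le_sq' ?_ (mul_nonneg hc (pairNorm_nonneg _ _)) |>.2
  rw [mul_pow, pairNorm_sq, pairNorm_sq, mul_add, ← mul_pow, ← mul_pow]
  exact add_le_add (pow_le_pow_left₀ (norm_nonneg _) h1 2) (pow_le_pow_left₀ (norm_nonneg _) h2 2)

theorem pairNorm_neg_right (x : E) (y : F) : pairNorm x (-y) = pairNorm x y := by
  refine (pow_left_inj₀ (pairNorm_nonneg _ _) (pairNorm_nonneg _ _) two_ne_zero).1 ?_
  rw [pairNorm_sq, pairNorm_sq, norm_neg]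

end PairNorm

/-! ### Saddle point operators and their Schur complements. -/

section SaddleOperator

open scoped InnerProductSpace

variable {E F : Type*} [NormedAddCommGroup E] [InnerProductSpace ℝ E] [NormedAddCommGroup F]
  [InnerProductSpace ℝ F]

/-- `B` and `Bt` are adjoint to each other, with norm at most `c`. -/
structure IsCoupling (B : F →ₗ[ℝ] E) (Bt : E →ₗ[ℝ] F) (c : ℝ) : Prop where
  adjoint : ∀ x y, ⟪Bt x, y⟫_ℝ = ⟪x, B y⟫_ℝ
  norm_le : ∀ y, ‖B y‖ ≤ c * ‖y‖
  norm_transpose_le : ∀ x, ‖Bt x‖ ≤ c * ‖x‖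

theorem IsCoupling.swap {B : F →ₗ[ℝ] E} {Bt : E →ₗ[ℝ] F} {c : ℝ} (h : IsCoupling B Bt c) :
    IsCoupling Bt B c where
  adjoint x y := by rw [real_inner_comm, ← h.adjoint, real_inner_comm]
  norm_le := h.norm_transpose_le
  norm_transpose_le := h.norm_le

theorem inner_add_inner_le_pairNorm (x a : E) (y b : F) :
    ⟪x, a⟫_ℝ + ⟪y, b⟫_ℝ ≤ pairNorm x y * pairNorm a b :=
  real_inner_le_norm (WithLp.toLp 2 (x, y) : WithLp 2 (E × F)) (WithLp.toLp 2 (a, b))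

theorem pairNorm_saddle_le {A : E →ₗ[ℝ] E} {B : F →ₗ[ℝ] E} {Bt : E →ₗ[ℝ] F} {C : F →ₗ[ℝ] F}
    {μ l c : ℝ} (hA : HasBounds A μ l) (hC : HasBounds C μ l) (hB : IsCoupling B Bt c)
    (hμ : 0 ≤ μ) (hl : 0 ≤ l) (hc : 0 ≤ c) (x : E) (y : F) :
    pairNorm (A x + B y) (Bt x - C y) ≤ (l + c) * pairNorm x y := by
  rw [show Bt x - C y = -C y + Bt x by abel]
  refine (pairNorm_add_le _ _ _ _).trans ?_
  rw [add_mul]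
  refine add_le_add (pairNorm_le_mul hl (hA.norm_apply_le hμ hl x) ?_) ?_
  · rw [norm_neg]; exact hC.norm_apply_le hμ hl y
  · rw [← pairNorm_swap x y]
    exact pairNorm_le_mul hc (hB.norm_le y) (hB.norm_transpose_le x)

/-- Testing against `(x, -y)` cancels the coupling and leaves the two definite blocks. -/
theorem le_pairNorm_saddle {A : E →ₗ[ℝ] E} {B : F →ₗ[ℝ] E} {Bt : E →ₗ[ℝ] F} {C : F →ₗ[ℝ] F}
    {μ l c : ℝ} (hA : HasBounds A μ l) (hC : HasBounds C μ l) (hB : IsCoupling B Bt c)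
    (x : E) (y : F) : μ * pairNorm x y ≤ pairNorm (A x + B y) (Bt x - C y) := by
  have h1 := inner_add_inner_le_pairNorm x (A x + B y) (-y) (Bt x - C y)
  rw [pairNorm_neg_right, inner_add_right, inner_sub_right, inner_neg_left, inner_neg_left,
    ← hB.adjoint, real_inner_comm y (Bt x)] at h1
  have h2 := hA.lower x
  have h3 := hC.lower y
  have h4 := pairNorm_sq x y
  by_cases h0 : pairNorm x y = 0
  · rw [h0, mul_zero]; exact pairNorm_nonneg _ _
  have h0 : 0 < pairNorm x y := lt_of_le_of_ne (pairNorm_nonneg _ _) (Ne.symm h0)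
  refine le_of_mul_le_mul_left ?_ h0
  have h5 : pairNorm x y * (μ * pairNorm x y) = μ * (‖x‖ ^ 2 + ‖y‖ ^ 2) := by rw [← h4]; ring
  linarith

/-- The Schur complement that remains when one of the variables is eliminated. -/
theorem HasBounds.schur {C : E →ₗ[ℝ] E} {m l : ℝ} (hC : HasBounds C m l) {N : E →ₗ[ℝ] F}
    {Nt : F →ₗ[ℝ] E} {c : ℝ} (hN : IsCoupling N Nt c) {Di : F →ₗ[ℝ] F} {μ : ℝ}
    (hμ : 0 < μ) (hs : ∀ x y, ⟪Di x, y⟫_ℝ = ⟪x, Di y⟫_ℝ) (hn : ∀ x, μ * ‖Di x‖ ≤ ‖x‖)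
    (hp : ∀ x, 0 ≤ ⟪x, Di x⟫_ℝ) :
    HasBounds (C + Nt ∘ₗ Di ∘ₗ N) m (l + c ^ 2 / μ) where
  symm x y := by
    simp only [LinearMap.add_apply, LinearMap.comp_apply, inner_add_left, inner_add_right]
    rw [hC.symm, hN.adjoint, hs, ← hN.swap.adjoint]
  lower x := by
    have h1 := hC.lower x
    have h2 := hp (N x)
    simp only [LinearMap.add_apply, LinearMap.comp_apply, inner_add_right]
    rw [← hN.swap.adjoint]
    linarith
  upper x := by
    have h1 := hC.upper x
    simp only [LinearMap.add_apply, LinearMap.comp_apply, inner_add_right]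
    rw [← hN.swap.adjoint, add_mul]
    refine add_le_add h1 ((real_inner_le_norm _ _).trans ?_)
    have h2 : ‖Di (N x)‖ ≤ ‖N x‖ / μ := by rw [le_div_iff₀ hμ]; linarith [hn (N x)]
    calc ‖N x‖ * ‖Di (N x)‖ ≤ ‖N x‖ * (‖N x‖ / μ) := by gcongr
      _ = ‖N x‖ ^ 2 / μ := by ring
      _ ≤ (c * ‖x‖) ^ 2 / μ := by gcongr; exact hN.norm_le x
      _ = c ^ 2 / μ * ‖x‖ ^ 2 := by ring

/-- Existence of the exact proximal point. -/
theorem HasBounds.exists_prox [FiniteDimensional ℝ E] {Q : E →ₗ[ℝ] E} {m q : ℝ}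
    (hQ : HasBounds Q m q) (hm : 0 < m) {β : ℝ} (hβ : 0 ≤ β) (xh : E) :
    ∃ xp, Q xp = (2 * β) • (xh - xp) := by
  obtain ⟨Ki, hK, -⟩ := (hQ.add_smul_id (2 * β)).exists_inverse (by linarith)
  refine ⟨Ki ((2 * β) • xh), ?_⟩
  have := hK ((2 * β) • xh)
  simp only [LinearMap.add_apply, LinearMap.smul_apply, LinearMap.id_apply] at this
  rw [smul_sub, eq_sub_iff_add_eq, this]

end SaddleOperator

/-! ### Consequences of the standing assumptions, and the precision parameters. -/

namespace Params.Standing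

variable {p : Params}

theorem my_pos (h : p.Standing) : 0 < p.my := h.mx_pos.trans h.mx_lt_my
theorem Lxy_pos (h : p.Standing) : 0 < p.Lxy := h.my_pos.trans h.my_lt_Lxy
theorem Lxy_le_L (_ : p.Standing) : p.Lxy ≤ p.L := (le_max_left _ _).trans (le_max_right _ _)
theorem Lx_le_L (_ : p.Standing) : p.Lx ≤ p.L := le_max_left _ _
theorem L_pos (h : p.Standing) : 0 < p.L := h.Lxy_pos.trans_le h.Lxy_le_L
theorem my_le_Lx (h : p.Standing) : p.my ≤ p.Lx := h.Lx_eq_Ly ▸ h.my_le_Ly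
theorem Lx_pos (h : p.Standing) : 0 < p.Lx := h.my_pos.trans_le h.my_le_Lx
theorem max_mx (h : p.Standing) : max p.mx p.Lxy = p.Lxy :=
  max_eq_right (h.mx_lt_my.trans h.my_lt_Lxy).le
theorem max_my (h : p.Standing) : max p.my p.Lxy = p.Lxy := max_eq_right h.my_lt_Lxy.le
theorem min_eq (h : p.Standing) : min p.mx p.my = p.mx := min_eq_left h.mx_lt_my.le
theorem one_le_L_div_my (h : p.Standing) : 1 ≤ p.L / p.my :=
  (one_le_div h.my_pos).2 (h.my_lt_Lxy.le.trans h.Lxy_le_L)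
theorem L_div_my_le (h : p.Standing) : p.L / p.my ≤ p.L / p.mx :=
  div_le_div_of_nonneg_left h.L_pos.le h.mx_pos h.mx_lt_my.le
theorem one_le_L_div_mx (h : p.Standing) : 1 ≤ p.L / p.mx := h.one_le_L_div_my.trans h.L_div_my_le
theorem cond_eq (_ : p.Standing) : p.cond = p.L / p.mx * (p.L / p.my) := by
  unfold Params.cond
  rw [div_mul_div_comm, sq]
theorem one_le_Lxy_div_my (h : p.Standing) : 1 ≤ p.Lxy / p.my :=
  (one_le_div h.my_pos).2 h.my_lt_Lxy.le
theorem Lxy_div_my_le (h : p.Standing) : p.Lxy / p.my ≤ p.L / p.my :=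
  div_le_div_of_nonneg_right h.Lxy_le_L h.my_pos.le

end Params.Standing

theorem rpow_three_halves {x : ℝ} (hx : 0 < x) : x ^ (3 / 2 : ℝ) = x * √x := by
  rw [show (3 / 2 : ℝ) = 1 + 1 / 2 by norm_num, Real.rpow_add hx, Real.rpow_one, Real.sqrt_eq_rpow]

theorem rpow_five_halves {x : ℝ} (hx : 0 < x) : x ^ (5 / 2 : ℝ) = x ^ 2 * √x := by
  rw [show (5 / 2 : ℝ) = 2 + 1 / 2 by norm_num, Real.rpow_add hx, Real.rpow_two,
    Real.sqrt_eq_rpow]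

namespace Params

/-- The relative precision parameter of Alternating Best Response. -/
noncomputable def innerPrecision (p : Params) : ℝ :=
  96 * p.L ^ (5 / 2 : ℝ) / (p.mx * p.my ^ (3 / 2 : ℝ))

/-- The precision parameter of the middle loop of Proximal Best Response. -/
noncomputable def middlePrecision (p : Params) : ℝ :=
  80 * p.L ^ 3 / (p.mx ^ (3 / 2 : ℝ) * p.my ^ (3 / 2 : ℝ))

variable {p : Params}

theorem innerPrecision_eq (h : p.Standing) :
    p.innerPrecision = 96 * (p.L / p.mx * (p.L / p.my) * √(p.L / p.my)) := by
  have := h.mx_pos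
  have := h.my_pos
  have := Real.sqrt_pos.2 h.my_pos
  rw [innerPrecision, rpow_five_halves h.L_pos, rpow_three_halves h.my_pos,
    Real.sqrt_div h.L_pos.le]
  field_simp

theorem middlePrecision_eq (h : p.Standing) : p.middlePrecision =
    80 * (p.L / p.mx * (p.L / p.my) * (√(p.L / p.mx) * √(p.L / p.my))) := by
  have := h.mx_pos
  have := h.my_pos
  have := Real.sqrt_pos.2 h.my_pos
  have := Real.sqrt_pos.2 h.mx_pos
  have hL : √p.L ^ 2 = p.L := Real.sq_sqrt h.L_pos.le
  rw [middlePrecision, rpow_three_halves h.mx_pos, rpow_three_halves h.my_pos,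
    Real.sqrt_div h.L_pos.le, Real.sqrt_div h.L_pos.le]
  have : p.L / p.mx * (p.L / p.my) * (√p.L / √p.mx * (√p.L / √p.my)) =
      p.L ^ 2 * √p.L ^ 2 / (p.mx * √p.mx * (p.my * √p.my)) := by field_simp
  rw [this, hL]
  ring

theorem le_innerPrecision (h : p.Standing) :
    96 * (p.L / p.mx * (p.L / p.my)) ≤ p.innerPrecision := by
  rw [innerPrecision_eq h]
  have h1 := Real.one_le_sqrt.2 h.one_le_L_div_my
  have h2 : 0 ≤ p.L / p.mx * (p.L / p.my) :=
    mul_nonneg (zero_le_one.trans h.one_le_L_div_mx) (zero_le_one.trans h.one_le_L_div_my)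
  nlinarith

end Params

theorem norm_ZSpace_eq_pairNorm {n m : ℕ} (z : ZSpace n m) : ‖z‖ = pairNorm z.fst z.snd := by
  refine (pow_left_inj₀ (norm_nonneg _) (pairNorm_nonneg _ _) two_ne_zero).1 ?_
  rw [pairNorm_sq, norm_ZSpace_sq]

/-- The cost of one call of Alternating Best Response, if each partial gradient costs `c`. -/
noncomputable def abrCost (p : Params) (c : ℝ) : ℝ :=
  ((abrRounds (3 * p.L / (2 * p.Lxy)) (1 / p.innerPrecision) + 1 : ℕ) : ℝ) *
    (agdSteps (3 * p.L / (2 * p.Lxy)) * c + agdSteps (3 * p.L / (2 * p.Lxy)) * c)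

theorem abrCost_nonneg (p : Params) {c : ℝ} (hc : 0 ≤ c) : 0 ≤ abrCost p c :=
  mul_nonneg (Nat.cast_nonneg _)
    (add_nonneg (mul_nonneg (Nat.cast_nonneg _) hc) (mul_nonneg (Nat.cast_nonneg _) hc))

/-- The square root scale of the middle loop. -/
noncomputable def middleScale (p : Params) : ℝ := 2 * √(p.Lxy / p.my)

theorem appaTheta_eq (κ : ℝ) : appaTheta κ = (2 * √κ - 1) / (2 * √κ + 1) := rfl

theorem appaTau_eq {κ : ℝ} (hκ : 0 ≤ κ) : appaTau κ = 1 / (2 * √κ + (2 * √κ) ^ 2) := by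
  rw [appaTau, mul_pow, Real.sq_sqrt hκ]
  norm_num

/-! ### The middle loop of Proximal Best Response. -/

section MiddleLoop

open scoped InnerProductSpace

variable {n m : ℕ} {p : Params}
  {gX : EuclideanSpace ℝ (Fin n) → EuclideanSpace ℝ (Fin m) → Counted (EuclideanSpace ℝ (Fin n))}
  {gY : EuclideanSpace ℝ (Fin n) → EuclideanSpace ℝ (Fin m) → Counted (EuclideanSpace ℝ (Fin m))}
  {A : EuclideanSpace ℝ (Fin n) →ₗ[ℝ] EuclideanSpace ℝ (Fin n)}
  {B : EuclideanSpace ℝ (Fin m) →ₗ[ℝ] EuclideanSpace ℝ (Fin n)}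
  {Bt : EuclideanSpace ℝ (Fin n) →ₗ[ℝ] EuclideanSpace ℝ (Fin m)}
  {C : EuclideanSpace ℝ (Fin m) →ₗ[ℝ] EuclideanSpace ℝ (Fin m)}
  {u : EuclideanSpace ℝ (Fin n)} {v : EuclideanSpace ℝ (Fin m)}

/-- The primary variable is `y`, and `x` has been eliminated. The outer regularisation makes `A` at
least `2 L_xy`, so the best response has norm at most `1/2` and the Schur complement is at most `L +
L_xy/2`. The requirement on `Δ²` is `(3/4 + 1 + 9/16) L/m_y`, which is below `(8/5)² L/m_y`. -/
theorem middle_appaData (hp : p.Standing) {Ai : EuclideanSpace ℝ (Fin n) →ₗ[ℝ]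
    EuclideanSpace ℝ (Fin n)} (hs : ∀ x y, ⟪Ai x, y⟫_ℝ = ⟪x, Ai y⟫_ℝ)
    (hn : ∀ x, 2 * p.Lxy * ‖Ai x‖ ≤ ‖x‖) (hpos : ∀ x, 0 ≤ ⟪x, Ai x⟫_ℝ)
    (hC : HasBounds C p.my p.L) (hB : IsCoupling B Bt p.Lxy) :
    AppaData (C + Bt ∘ₗ Ai ∘ₗ B) (-(Ai ∘ₗ B)) p.my (3 / 2 * p.L) (1 / 2) (middleScale p) p.Lxy
      (8 / 5 * √(p.L / p.my)) (1 / p.innerPrecision) := by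
  have hLxy := hp.Lxy_pos
  have hmy := hp.my_pos
  have hb := hp.one_le_L_div_my
  have ha := hp.one_le_L_div_mx
  have hκ := hp.one_le_Lxy_div_my
  have hκb := hp.Lxy_div_my_le
  have hM := Params.le_innerPrecision hp
  have hsq : middleScale p ^ 2 = 4 * (p.Lxy / p.my) := by
    rw [middleScale, mul_pow, Real.sq_sqrt (by linarith)]; norm_num
  have hs2 : 2 ≤ middleScale p := by
    have := Real.one_le_sqrt.2 hκ
    unfold middleScale
    linarith
  have hM96 : 96 * (p.L / p.my) ≤ p.innerPrecision := by nlinarith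
  have hMpos : 0 < p.innerPrecision := by linarith
  refine ⟨(hC.schur hB (μ := 2 * p.Lxy) (by linarith) hs hn hpos).mono le_rfl ?_, hmy, fun y => ?_,
    by norm_num, hs2, ?_, by positivity, ?_, by positivity, ?_, ?_⟩
  · rw [show p.Lxy ^ 2 / (2 * p.Lxy) = p.Lxy / 2 by field_simp]
    linarith [hp.Lxy_le_L]
  · rw [LinearMap.neg_apply, norm_neg, LinearMap.comp_apply]
    refine le_of_mul_le_mul_left ?_ (by linarith : 0 < 2 * p.Lxy)
    linarith [hn (B y), hB.norm_le y]
  · rw [hsq]; field_simp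
  · rw [mul_pow, Real.sq_sqrt (by linarith)]
    have h1 : (middleScale p + 1 / middleScale p) ^ 2 ≤ middleScale p ^ 2 + 2 + 1 / 4 := by
      have h2 : middleScale p * (1 / middleScale p) = 1 := by
        rw [mul_one_div, div_self (by linarith)]
      have h3 : 1 / middleScale p ≤ 1 / 2 := by gcongr
      have h4 : 0 ≤ 1 / middleScale p := by positivity
      nlinarith
    have h5 : 3 / 2 * p.L / (2 * p.my) = 3 / 4 * (p.L / p.my) := by field_simp; ring
    rw [h5]
    rw [hsq] at h1
    linarith
  · rw [one_div_mul_eq_div, div_le_iff₀ hMpos]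
    linarith
  · have h1 : √(p.Lxy / p.my) ≤ √(p.L / p.my) := Real.sqrt_le_sqrt hκb
    have h2 : √(p.L / p.my) * √(p.Lxy / p.my) ≤ p.L / p.my := by
      calc √(p.L / p.my) * √(p.Lxy / p.my) ≤ √(p.L / p.my) * √(p.L / p.my) := by gcongr
        _ = p.L / p.my := Real.mul_self_sqrt (by linarith)
    have : 10 * (1 / p.innerPrecision) * (8 / 5 * √(p.L / p.my)) * (1 + 1 / 2) * middleScale p =
        48 * (√(p.L / p.my) * √(p.Lxy / p.my)) / p.innerPrecision := by
      unfold middleScale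
      ring
    rw [this, div_le_iff₀ hMpos]
    linarith

/-- One proximal subproblem of the middle loop, solved by Alternating Best Response. -/
theorem middle_round_spec (hp : p.Standing) {c : ℝ}
    (hgX : ∀ x y, (gX x y).Spec c (· = A x + B y + u))
    (hgY : ∀ x y, (gY x y).Spec c (· = Bt x - C y + v))
    (hA : HasBounds A (2 * p.Lxy) (3 * p.L)) (hC : HasBounds C p.my p.L)
    (hB : IsCoupling B Bt p.Lxy) {xs : EuclideanSpace ℝ (Fin n)} {ys : EuclideanSpace ℝ (Fin m)}
    (hxs : A xs + B ys + u = 0) (hys : Bt xs - C ys + v = 0)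
    {Ai : EuclideanSpace ℝ (Fin n) →ₗ[ℝ] EuclideanSpace ℝ (Fin n)} (hAi : ∀ x, A (Ai x) = x)
    {yp yh : EuclideanSpace ℝ (Fin m)}
    (hyp : (C + Bt ∘ₗ Ai ∘ₗ B) yp = (2 * p.Lxy) • (yh - ys - yp)) (z : ZSpace n m) :
    (abr gX (fun x y => do let g ← gY x y; pure (g - (2 * p.Lxy) • (y - yh)))
        z (1 / p.innerPrecision) (2 * p.Lxy) (2 * p.Lxy) (3 * p.L) (3 * p.L)).Spec
      (abrCost p c) fun z' => pairNorm (z'.snd - ys - yp) (z'.fst - xs - (-(Ai ∘ₗ B)) yp) ≤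
        1 / p.innerPrecision *
          pairNorm (z.snd - ys - yp) (z.fst - xs - (-(Ai ∘ₗ B)) yp) := by
  have hLxy := hp.Lxy_pos
  have hmx := hp.mx_pos
  have hmy := hp.my_pos
  have hL := hp.L_pos
  have hLL := hp.Lxy_le_L
  have hmL := hp.my_lt_Lxy
  have habr := abr_spec (gX := gX) (A := A) (B := B) (Bt := Bt) (u := u) (c := c)
    (gY := fun x y => do let g ← gY x y; pure (g - (2 * p.Lxy) • (y - yh)))
    (C := C + (2 * p.Lxy) • LinearMap.id) (v := v + (2 * p.Lxy) • yh)
    (μ := 2 * p.Lxy) (l := 3 * p.L) (ε := 1 / p.innerPrecision)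
    -- The saddle point of the regularised problem: the exact proximal point in `y` and the best
    -- response of `x` to it.
    (xs := xs + (-(Ai ∘ₗ B)) yp) (ys := ys + yp) hgX
    (fun x y => Counted.Spec.bind_pure (hgY x y) fun a ha => by
      rw [ha]
      simp only [LinearMap.add_apply, LinearMap.smul_apply, LinearMap.id_apply]
      module)
    (by linarith) (by linarith) hA
    ((hC.add_smul_id _).mono (by linarith) (by linarith))
    (fun y => by
      rw [mul_div_cancel_left₀ _ two_ne_zero]; exact hB.norm_le y)
    (fun x => by
      rw [mul_div_cancel_left₀ _ two_ne_zero]; exact hB.norm_transpose_le x)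
    (by
      have := Params.le_innerPrecision hp
      have h1 : 0 < p.L / p.mx * (p.L / p.my) := by positivity
      refine one_div_pos.2 (by linarith))
    (by
      rw [map_add, map_add, LinearMap.neg_apply, map_neg, LinearMap.comp_apply, hAi,
        ← hxs]
      abel)
    (by
      have h2 : C yp + Bt (Ai (B yp)) = (2 * p.Lxy) • (yh - ys - yp) := hyp
      have h3 : C yp = (2 * p.Lxy) • (yh - ys - yp) - Bt (Ai (B yp)) := by
        rw [← h2]; abel
      simp only [LinearMap.add_apply, LinearMap.smul_apply, LinearMap.id_apply, map_add, h3,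
        LinearMap.neg_apply, map_neg, LinearMap.comp_apply]
      rw [← hys]
      module) z
  refine habr.mono le_rfl fun z' hz' => ?_
  rw [norm_ZSpace_eq_pairNorm, norm_ZSpace_eq_pairNorm] at hz'
  rw [pairNorm_swap, pairNorm_swap (z.fst - xs - _)]
  rw [sub_sub, sub_sub, sub_sub, sub_sub]
  exact hz'

/-- The loop is stopped by the gradient norm, which lies between `m_y` and `4 L` times the distance
to the saddle point. This equivalence is used once to show that `T` rounds trigger the test, and
once to read the test as a bound on the distance. -/
theorem appaAbr_spec (hp : p.Standing) {c : ℝ} (hc : 0 ≤ c)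
    (hgX : ∀ x y, (gX x y).Spec c (· = A x + B y + u))
    (hgY : ∀ x y, (gY x y).Spec c (· = Bt x - C y + v))
    (hA : HasBounds A (2 * p.Lxy) (3 * p.L)) (hC : HasBounds C p.my p.L)
    (hB : IsCoupling B Bt p.Lxy) {xs : EuclideanSpace ℝ (Fin n)} {ys : EuclideanSpace ℝ (Fin m)}
    (hxs : A xs + B ys + u = 0) (hys : Bt xs - C ys + v = 0) {M₁ : ℝ} (hM₁ : 0 < M₁) {T : ℕ}
    (hT : 0 < T)
    (hTM : 17 * (8 / 5 * √(p.L / p.my)) * (1 - 1 / (8 * middleScale p)) ^ T * (4 * p.L) ≤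
      p.mx / (9 * p.L * M₁) * p.my) (z₀ : ZSpace n m) :
    (appaAbr p gX gY z₀ M₁).Spec (2 * c + T * (abrCost p c + 2 * c)) fun z =>
      ‖z - mkZ xs ys‖ ≤ p.mx / (9 * p.L * M₁) * (4 * p.L) / p.my * ‖z₀ - mkZ xs ys‖ := by
  have hLxy := hp.Lxy_pos
  have hmx := hp.mx_pos
  have hmy := hp.my_pos
  have hL := hp.L_pos
  have hLL := hp.Lxy_le_L
  have hmL := hp.my_lt_Lxy
  obtain ⟨Ai, hAi, -, hAs, hAn, hAp⟩ := hA.exists_inverse (by linarith)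
  have hdata := middle_appaData hp hAs hAn hAp hC hB
  set Q := C + Bt ∘ₗ Ai ∘ₗ B with hQ
  set R := -(Ai ∘ₗ B) with hR
  set s := middleScale p with hs
  set Δ := 8 / 5 * √(p.L / p.my) with hΔ
  set G : ZSpace n m → ℝ := fun z =>
    pairNorm (A (z.fst - xs) + B (z.snd - ys)) (Bt (z.fst - xs) - C (z.snd - ys)) with hG
  set η := p.mx / (9 * p.L * M₁) with hη
  have hη0 : 0 ≤ η := by positivity
  have hpair : ∀ z : ZSpace n m, ‖z - mkZ xs ys‖ = pairNorm (z.fst - xs) (z.snd - ys) :=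
    fun z => norm_ZSpace_eq_pairNorm _
  have hGle : ∀ z, G z ≤ 4 * p.L * ‖z - mkZ xs ys‖ := fun z => by
    rw [hpair]
    refine (pairNorm_saddle_le (hA.mono (by linarith : p.my ≤ _) le_rfl)
      (hC.mono le_rfl (by linarith : _ ≤ 3 * p.L)) hB hmy.le (by linarith) hLxy.le _ _).trans ?_
    refine mul_le_mul_of_nonneg_right ?_ (pairNorm_nonneg _ _)
    linarith
  have hleG : ∀ z, p.my * ‖z - mkZ xs ys‖ ≤ G z := fun z => by
    rw [hpair]
    exact le_pairNorm_saddle (hA.mono (by linarith : p.my ≤ _) le_rfl)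
      (hC.mono le_rfl (by linarith : _ ≤ 3 * p.L)) hB _ _
  have hgrad : ∀ z : ZSpace n m, ((do
      let a ← gX z.fst z.snd
      let b ← gY z.fst z.snd
      pure ‖mkZ a b‖ : Counted ℝ)).Spec (2 * c) (· = G z) := fun z => by
    refine ((hgX z.fst z.snd).bind fun a ha => Counted.Spec.bind_pure (hgY z.fst z.snd)
      fun b hb => ?_).mono (by linarith) fun _ h => h
    rw [ha, hb, hG]
    change pairNorm _ _ = pairNorm _ _
    congr 1
    · rw [map_sub, map_sub, ← sub_zero (A z.fst + B z.snd + u), ← hxs]; abel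
    · rw [map_sub, map_sub, ← sub_zero (Bt z.fst - C z.snd + v), ← hys]; abel
  unfold appaAbr
  refine (hgrad z₀).bind fun g₀ hg₀ => ?_
  subst hg₀
  -- From `m_x < m_y < L_xy`, both `β₁` and `β₂` are `L_xy`.
  rw [hp.max_mx, hp.max_my, hp.min_eq]
  change Counted.Spec (Counted.repeatUntil (fun s : ZSpace n m × EuclideanSpace ℝ (Fin m) => do
      let z ← abr gX (fun x y => do let g ← gY x y; pure (g - (2 * p.Lxy) • (y - s.2)))
        s.1 (1 / p.innerPrecision) (2 * p.Lxy) (2 * p.Lxy) (3 * p.L) (3 * p.L)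
      pure (z, z.snd + appaTheta (p.Lxy / p.my) • (z.snd - s.1.snd) +
        appaTau (p.Lxy / p.my) • (z.snd - s.2))) _ _ >>= _) _ _
  refine Counted.Spec.bind_pure (R := fun s : ZSpace n m × EuclideanSpace ℝ (Fin m) =>
    G s.1 ≤ η * G z₀) ?_ ?_
  · refine (Counted.Spec.repeatUntil (c := abrCost p c) (c' := 2 * c) (T := T)
      -- The exact proximal point changes from round to round, so the invariant only asserts that
      -- one exists.
      (fun t st => ∃ xo, appaPotential Q R p.my s Δ (st.1.snd - ys) (st.1.fst - xs)
        (st.2 - ys) xo ≤ (1 - 1 / (8 * s)) ^ t *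
        appaPotential Q R p.my s Δ (z₀.snd - ys) (z₀.fst - xs) (z₀.snd - ys) 0)
      (fun st => G st.1 ≤ η * G z₀) (add_nonneg (abrCost_nonneg p hc) (by linarith)) hT
      ⟨0, by rw [pow_zero, one_mul]⟩
      ?_ ?_ ?_).mono le_rfl ?_
    · rintro t ⟨z, yh⟩ ⟨xo, hxo⟩
      obtain ⟨yp, hyp⟩ := hdata.bounds.exists_prox hmy hLxy.le (yh - ys)
      refine Counted.Spec.bind_pure (middle_round_spec hp hgX hgY hA hC hB hxs hys hAi hyp z)
        fun z' hz' => ⟨yp, ?_⟩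
      have hstep := hdata.potential_step (x := z.snd - ys) (x' := z'.snd - ys) (xh := yh - ys)
        (xh' := z'.snd + appaTheta (p.Lxy / p.my) • (z'.snd - z.snd) +
          appaTau (p.Lxy / p.my) • (z'.snd - yh) - ys) (xo := xo) (y := z.fst - xs)
        (y' := z'.fst - xs) hyp hz'
        (by
          rw [appaTheta_eq, appaTau_eq (by positivity), hs, middleScale]
          module)
      refine hstep.trans ?_
      rw [pow_succ', mul_assoc]
      refine mul_le_mul_of_nonneg_left hxo ?_
      rw [sub_nonneg, div_le_one] <;> linarith [hdata.two_le_s]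
    · exact fun st => Counted.Spec.bind_pure (hgrad st.1) fun a ha => by rw [ha]
    · rintro ⟨z, yh⟩ ⟨xo, hxo⟩
      have h1 := hdata.pairNorm_le_of_potential_le (by positivity) hxo
      rw [pairNorm_swap, pairNorm_swap (z₀.fst - xs), ← hpair, ← hpair] at h1
      calc G z ≤ 4 * p.L * ‖z - mkZ xs ys‖ := hGle z
        _ ≤ 4 * p.L * ((13 + 8 * (1 / 2)) * Δ * (1 - 1 / (8 * s)) ^ T * ‖z₀ - mkZ xs ys‖) := by
            gcongr
        _ = 17 * Δ * (1 - 1 / (8 * s)) ^ T * (4 * p.L) * ‖z₀ - mkZ xs ys‖ := by ring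
        _ ≤ η * p.my * ‖z₀ - mkZ xs ys‖ := by gcongr
        _ = η * (p.my * ‖z₀ - mkZ xs ys‖) := by ring
        _ ≤ η * G z₀ := by gcongr; exact hleG z₀
    · intro st hst
      exact hst.2
  · rintro ⟨z, yh⟩ hz
    have h1 : p.my * ‖z - mkZ xs ys‖ ≤ η * (4 * p.L * ‖z₀ - mkZ xs ys‖) :=
      (hleG z).trans (hz.trans (mul_le_mul_of_nonneg_left (hGle z₀) hη0))
    rw [div_mul_eq_mul_div, le_div_iff₀ hmy]
    linarith

end MiddleLoop

/-! ### Matrices as operators, saddle points and residuals. -/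

namespace QuadProblem

open scoped InnerProductSpace

variable {n m : ℕ}

/-- The operator form of `QuadProblem.InClass`. -/
structure OpBounds (P : QuadProblem n m) (p : Params) : Prop where
  boundsA : HasBounds (Matrix.toEuclideanLin P.A) p.mx p.Lx
  boundsC : HasBounds (Matrix.toEuclideanLin P.C) p.my p.Ly
  coupling : IsCoupling (Matrix.toEuclideanLin P.B) (Matrix.toEuclideanLin P.B.transpose) p.Lxy

end QuadProblem

open scoped InnerProductSpace in
theorem hasBounds_toEuclideanLin {d : ℕ} {M : Matrix (Fin d) (Fin d) ℝ} {μ l : ℝ}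
    (h1 : (M - μ • (1 : Matrix (Fin d) (Fin d) ℝ)).PosSemidef)
    (h2 : (l • (1 : Matrix (Fin d) (Fin d) ℝ) - M).PosSemidef) :
    HasBounds (Matrix.toEuclideanLin M) μ l := by
  have hone : ∀ x : EuclideanSpace ℝ (Fin d), Matrix.toEuclideanLin 1 x = x := fun x => by
    rw [Matrix.toLpLin_apply, Matrix.one_mulVec]
  rw [← Matrix.isPositive_toEuclideanLin_iff, map_sub, map_smul] at h1 h2
  refine ⟨fun x y => ?_, fun x => ?_, fun x => ?_⟩
  · have := h1.isSymmetric x y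
    simp only [LinearMap.sub_apply, LinearMap.smul_apply, hone, inner_sub_left, inner_sub_right,
      real_inner_smul_left, real_inner_smul_right] at this
    linarith
  · have := h1.inner_nonneg_right x
    simp only [LinearMap.sub_apply, LinearMap.smul_apply, hone, inner_sub_right,
      real_inner_smul_right, real_inner_self_eq_norm_sq] at this
    linarith
  · have := h2.inner_nonneg_right x
    simp only [LinearMap.sub_apply, LinearMap.smul_apply, hone, inner_sub_right,
      real_inner_smul_right, real_inner_self_eq_norm_sq] at this
    linarith

open scoped InnerProductSpace in
theorem inner_toEuclideanLin_transpose {n m : ℕ} (M : Matrix (Fin n) (Fin m) ℝ)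
    (x : EuclideanSpace ℝ (Fin n)) (y : EuclideanSpace ℝ (Fin m)) :
    ⟪Matrix.toEuclideanLin M.transpose x, y⟫_ℝ = ⟪x, Matrix.toEuclideanLin M y⟫_ℝ := by
  rw [← Matrix.conjTranspose_eq_transpose_of_trivial, Matrix.toEuclideanLin_conjTranspose_eq_adjoint,
    LinearMap.adjoint_inner_left]

open scoped InnerProductSpace in
theorem isCoupling_toEuclideanLin {n m : ℕ} {M : Matrix (Fin n) (Fin m) ℝ} {c : ℝ}
    (h : ‖LinearMap.toContinuousLinearMap (Matrix.toEuclideanLin M)‖ ≤ c) :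
    IsCoupling (Matrix.toEuclideanLin M) (Matrix.toEuclideanLin M.transpose) c := by
  have h1 : ∀ y, ‖Matrix.toEuclideanLin M y‖ ≤ c * ‖y‖ := fun y =>
    (LinearMap.toContinuousLinearMap (Matrix.toEuclideanLin M)).le_of_opNorm_le h y
  refine ⟨inner_toEuclideanLin_transpose M, h1, fun x => ?_⟩
  set w := Matrix.toEuclideanLin M.transpose x with hw
  have h2 : ‖w‖ * ‖w‖ ≤ c * ‖x‖ * ‖w‖ := by
    rw [← real_inner_self_eq_norm_mul_norm]
    calc ⟪w, w⟫_ℝ = ⟪x, Matrix.toEuclideanLin M w⟫_ℝ := inner_toEuclideanLin_transpose M x w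
      _ ≤ ‖x‖ * ‖Matrix.toEuclideanLin M w‖ := real_inner_le_norm _ _
      _ ≤ ‖x‖ * (c * ‖w‖) := by gcongr; exact h1 w
      _ = c * ‖x‖ * ‖w‖ := by ring
  by_cases h0 : ‖w‖ = 0
  · rw [h0]
    have : 0 ≤ c := (norm_nonneg _).trans h
    positivity
  · exact le_of_mul_le_mul_right h2 (lt_of_le_of_ne (norm_nonneg _) (Ne.symm h0))

namespace QuadProblem

open scoped InnerProductSpace

variable {n m : ℕ}

theorem InClass.opBounds {P : QuadProblem n m} {p : Params} (h : P.InClass p) : P.OpBounds p where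
  boundsA := hasBounds_toEuclideanLin h.A_lower h.A_upper
  boundsC := hasBounds_toEuclideanLin h.C_lower h.C_upper
  coupling := isCoupling_toEuclideanLin h.B_norm

/-- `(x, y)` solves `J z = b`. -/
structure IsStationary (P : QuadProblem n m) (x : EuclideanSpace ℝ (Fin n))
    (y : EuclideanSpace ℝ (Fin m)) : Prop where
  fst_eq : Matrix.toEuclideanLin P.A x + Matrix.toEuclideanLin P.B y + P.u = 0
  snd_eq : Matrix.toEuclideanLin P.B.transpose x - Matrix.toEuclideanLin P.C y + P.v = 0

theorem eq_zero_of_forall_quadratic_nonneg {b c : ℝ} (h : ∀ t : ℝ, 0 ≤ b * t + c * t ^ 2) :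
    b = 0 := by
  have := (sqrt_add_le_of_quadratic_nonneg (a := 0) (b := c) (c := b / 2)
    fun t => by linarith [h t]).1
  rw [zero_mul] at this
  nlinarith [sq_nonneg (b / 2)]

/-- Along the line in the direction of a partial gradient `g`, the saddle inequality is a quadratic
in `t` with linear coefficient `±‖g‖²`. It is nonnegative for `t` of both signs, so `g = 0`. -/
theorem IsSaddlePoint.isStationary {P : QuadProblem n m} {p : Params} (hP : P.OpBounds p)
    {z : ZSpace n m} (hz : P.IsSaddlePoint z) : P.IsStationary z.fst z.snd := by
  set A := Matrix.toEuclideanLin P.A with hA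
  set B := Matrix.toEuclideanLin P.B with hB
  set C := Matrix.toEuclideanLin P.C with hC
  constructor
  · obtain ⟨g, hg⟩ : ∃ g, g = A z.fst + B z.snd + P.u := ⟨_, rfl⟩
    rw [← hg]
    have key : ∀ t : ℝ, 0 ≤ ⟪g, g⟫_ℝ * t + 1 / 2 * ⟪g, A g⟫_ℝ * t ^ 2 := by
      intro t
      have h1 := (hz (z.fst + t • g) z.snd).1
      have e1 : ⟪z.fst + t • g, A (z.fst + t • g)⟫_ℝ =
          ⟪z.fst, A z.fst⟫_ℝ + 2 * ⟪A z.fst, g⟫_ℝ * t + ⟪g, A g⟫_ℝ * t ^ 2 := by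
        rw [quadratic_line hP.boundsA.symm, ← hP.boundsA.symm z.fst g]
      have e2 : ⟪z.fst + t • g, B z.snd⟫_ℝ = ⟪z.fst, B z.snd⟫_ℝ + t * ⟪B z.snd, g⟫_ℝ := by
        rw [inner_add_left, real_inner_smul_left, real_inner_comm g]
      have h2 : ⟪g, g⟫_ℝ = ⟪A z.fst, g⟫_ℝ + ⟪B z.snd, g⟫_ℝ + ⟪P.u, g⟫_ℝ := by
        nth_rw 1 [hg]
        rw [inner_add_left, inner_add_left]
      unfold f at h1
      rw [e1, e2, inner_add_right P.u, real_inner_smul_right P.u] at h1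
      rw [h2]
      linarith
    exact inner_self_eq_zero.1 (eq_zero_of_forall_quadratic_nonneg key)
  · obtain ⟨g, hg⟩ : ∃ g, g = Matrix.toEuclideanLin P.B.transpose z.fst - C z.snd + P.v := ⟨_, rfl⟩
    rw [← hg]
    have key : ∀ t : ℝ, 0 ≤ (-⟪g, g⟫_ℝ) * t + 1 / 2 * ⟪g, C g⟫_ℝ * t ^ 2 := by
      intro t
      have h1 := (hz z.fst (z.snd + t • g)).2
      have e1 : ⟪z.snd + t • g, C (z.snd + t • g)⟫_ℝ =
          ⟪z.snd, C z.snd⟫_ℝ + 2 * ⟪C z.snd, g⟫_ℝ * t + ⟪g, C g⟫_ℝ * t ^ 2 := by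
        rw [quadratic_line hP.boundsC.symm, ← hP.boundsC.symm z.snd g]
      have e2 : ⟪z.fst, B (z.snd + t • g)⟫_ℝ = ⟪z.fst, B z.snd⟫_ℝ +
          t * ⟪Matrix.toEuclideanLin P.B.transpose z.fst, g⟫_ℝ := by
        rw [map_add, map_smul, inner_add_right, real_inner_smul_right, hP.coupling.adjoint]
      have h2 : ⟪g, g⟫_ℝ = ⟪Matrix.toEuclideanLin P.B.transpose z.fst, g⟫_ℝ - ⟪C z.snd, g⟫_ℝ +
          ⟪P.v, g⟫_ℝ := by
        nth_rw 1 [hg]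
        rw [inner_add_left, inner_sub_left]
      unfold f at h1
      rw [e1, e2, inner_add_right P.v, real_inner_smul_right P.v] at h1
      rw [h2]
      linarith
    have := eq_zero_of_forall_quadratic_nonneg key
    exact inner_self_eq_zero.1 (neg_eq_zero.1 this)

/-- The value of `QuadProblem.residualNorm`. -/
noncomputable def residual (P : QuadProblem n m) (z : ZSpace n m) : ℝ :=
  pairNorm (Matrix.toEuclideanLin P.A z.fst + Matrix.toEuclideanLin P.B z.snd + P.u)
    (Matrix.toEuclideanLin P.B.transpose z.fst - Matrix.toEuclideanLin P.C z.snd + P.v)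

theorem gradX_spec (P : QuadProblem n m) (x : EuclideanSpace ℝ (Fin n))
    (y : EuclideanSpace ℝ (Fin m)) :
    (P.gradX x y).Spec 2 (· = Matrix.toEuclideanLin P.A x + Matrix.toEuclideanLin P.B y + P.u) := by
  refine ((matVec_spec P.A x).bind fun a ha => Counted.Spec.bind_pure (matVec_spec P.B y)
    fun b hb => ?_).mono (by norm_num) fun _ h => h
  rw [ha, hb]

theorem gradY_spec (P : QuadProblem n m) (x : EuclideanSpace ℝ (Fin n))
    (y : EuclideanSpace ℝ (Fin m)) :
    (P.gradY x y).Spec 2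
      (· = Matrix.toEuclideanLin P.B.transpose x - Matrix.toEuclideanLin P.C y + P.v) := by
  refine ((matVec_spec P.B.transpose x).bind fun a ha => Counted.Spec.bind_pure
    (matVec_spec P.C y) fun b hb => ?_).mono (by norm_num) fun _ h => h
  rw [ha, hb]

theorem residualNorm_spec (P : QuadProblem n m) (z : ZSpace n m) :
    (P.residualNorm z).Spec 4 (· = P.residual z) := by
  refine ((P.gradX_spec z.fst z.snd).bind fun a ha => Counted.Spec.bind_pure
    (P.gradY_spec z.fst z.snd) fun b hb => ?_).mono (by norm_num) fun _ h => h
  rw [residual, ← ha, ← hb, ← pairNorm_neg_right]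
  rfl

theorem IsStationary.residual_eq {P : QuadProblem n m} {xs : EuclideanSpace ℝ (Fin n)}
    {ys : EuclideanSpace ℝ (Fin m)} (h : P.IsStationary xs ys) (z : ZSpace n m) :
    P.residual z = pairNorm
      (Matrix.toEuclideanLin P.A (z.fst - xs) + Matrix.toEuclideanLin P.B (z.snd - ys))
      (Matrix.toEuclideanLin P.B.transpose (z.fst - xs) -
        Matrix.toEuclideanLin P.C (z.snd - ys)) := by
  unfold residual
  congr 1
  · rw [map_sub, map_sub, ← sub_zero (_ + P.u), ← h.fst_eq]; abel
  · rw [map_sub, map_sub, ← sub_zero (_ + P.v), ← h.snd_eq]; abel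

theorem residual_nonneg (P : QuadProblem n m) (z : ZSpace n m) : 0 ≤ P.residual z :=
  pairNorm_nonneg _ _

theorem OpBounds.residual_le {P : QuadProblem n m} {p : Params} (hp : p.Standing)
    (hP : P.OpBounds p) {xs : EuclideanSpace ℝ (Fin n)} {ys : EuclideanSpace ℝ (Fin m)}
    (h : P.IsStationary xs ys) (z : ZSpace n m) :
    P.residual z ≤ (p.Lx + p.Lxy) * ‖z - mkZ xs ys‖ := by
  rw [h.residual_eq, norm_ZSpace_eq_pairNorm]
  exact pairNorm_saddle_le hP.boundsA (hP.boundsC.mono hp.mx_lt_my.le hp.Lx_eq_Ly.ge) hP.coupling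
    hp.mx_pos.le hp.Lx_pos.le hp.Lxy_pos.le _ _

theorem OpBounds.le_residual {P : QuadProblem n m} {p : Params} (hp : p.Standing)
    (hP : P.OpBounds p) {xs : EuclideanSpace ℝ (Fin n)} {ys : EuclideanSpace ℝ (Fin m)}
    (h : P.IsStationary xs ys) (z : ZSpace n m) :
    p.mx * ‖z - mkZ xs ys‖ ≤ P.residual z := by
  rw [h.residual_eq, norm_ZSpace_eq_pairNorm]
  exact le_pairNorm_saddle hP.boundsA (hP.boundsC.mono hp.mx_lt_my.le hp.Lx_eq_Ly.ge) hP.coupling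
    _ _

end QuadProblem

/-! ### The outer loop of Proximal Best Response. -/

/-- The square root scale of the outer loop. -/
noncomputable def outerScale (p : Params) : ℝ := 2 * √(p.Lxy / p.mx)

/-- The relative precision to which the middle loop solves its problem. -/
noncomputable def Params.middleAccuracy (p : Params) : ℝ :=
  p.mx / (9 * p.L * p.middlePrecision) * (4 * p.L) / p.my

/-- The bound on the cost of one call of the middle loop, if it makes `T` rounds. -/
noncomputable def middleCost (p : Params) (T : ℕ) : ℝ := 2 * 2 + T * (abrCost p 2 + 2 * 2)

theorem middleCost_nonneg (p : Params) (T : ℕ) : 0 ≤ middleCost p T := by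
  have := abrCost_nonneg p (c := 2) (by norm_num)
  unfold middleCost
  positivity

theorem Params.middlePrecision_pos {p : Params} (hp : p.Standing) : 0 < p.middlePrecision := by
  have := hp.mx_pos
  have := hp.my_pos
  have := hp.L_pos
  unfold Params.middlePrecision
  positivity

section OuterLoop

open scoped InnerProductSpace

variable {n m : ℕ} {p : Params}

/-- Now `y` is eliminated, and only `m_y I ≼ C` is available for that. The best response therefore
has norm up to `L_xy/m_y`, and the Schur complement is bounded by `2 L²/m_y`. This larger
conditioning is what the high accuracy of the middle loop has to pay for. -/
theorem outer_appaData (hp : p.Standing)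
    {A : EuclideanSpace ℝ (Fin n) →ₗ[ℝ] EuclideanSpace ℝ (Fin n)}
    {B : EuclideanSpace ℝ (Fin m) →ₗ[ℝ] EuclideanSpace ℝ (Fin n)}
    {Bt : EuclideanSpace ℝ (Fin n) →ₗ[ℝ] EuclideanSpace ℝ (Fin m)}
    {Ci : EuclideanSpace ℝ (Fin m) →ₗ[ℝ] EuclideanSpace ℝ (Fin m)}
    (hs : ∀ x y, ⟪Ci x, y⟫_ℝ = ⟪x, Ci y⟫_ℝ)
    (hn : ∀ x, p.my * ‖Ci x‖ ≤ ‖x‖) (hpos : ∀ x, 0 ≤ ⟪x, Ci x⟫_ℝ)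
    (hA : HasBounds A p.mx p.L) (hB : IsCoupling B Bt p.Lxy) :
    AppaData (A + B ∘ₗ Ci ∘ₗ Bt) (Ci ∘ₗ Bt) p.mx (2 * p.L * (p.L / p.my)) (p.Lxy / p.my)
      (outerScale p) p.Lxy (5 / 3 * (√(p.L / p.mx) * √(p.L / p.my))) p.middleAccuracy := by
  have hLxy := hp.Lxy_pos
  have hL := hp.L_pos
  have hmx := hp.mx_pos
  have hmy := hp.my_pos
  have hb := hp.one_le_L_div_my
  have ha := hp.one_le_L_div_mx
  have hba := hp.L_div_my_le
  have hκb := hp.Lxy_div_my_le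
  have hκa : p.Lxy / p.mx ≤ p.L / p.mx := div_le_div_of_nonneg_right hp.Lxy_le_L hmx.le
  have hκ1 : 1 ≤ p.Lxy / p.mx := (one_le_div hmx).2 (hp.mx_lt_my.trans hp.my_lt_Lxy).le
  have hsq : outerScale p ^ 2 = 4 * (p.Lxy / p.mx) := by
    rw [outerScale, mul_pow, Real.sq_sqrt (by linarith)]; norm_num
  have hs2 : 2 ≤ outerScale p := by
    have := Real.one_le_sqrt.2 hκ1
    unfold outerScale
    linarith
  have hεeq : p.middleAccuracy = 4 / 9 * (p.mx / p.my) / p.middlePrecision := by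
    have := Params.middlePrecision_pos hp
    unfold Params.middleAccuracy
    field_simp
  set a := p.L / p.mx with had
  set b := p.L / p.my with hbd
  have hsa : 1 ≤ √a := Real.one_le_sqrt.2 ha
  have hsb : 1 ≤ √b := Real.one_le_sqrt.2 hb
  have hqa : √a * √a = a := Real.mul_self_sqrt (by linarith)
  have hqb : √b * √b = b := Real.mul_self_sqrt (by linarith)
  -- In terms of `a = L/m_x` and `b = L/m_y`, every requirement on the accuracy becomes a monomial
  -- inequality in numbers that are at least `1`.
  have hε : p.middleAccuracy = 1 / (180 * (a * a * (√a * √b))) := by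
    have : p.mx / p.my = b / a := by rw [had, hbd]; field_simp
    rw [hεeq, Params.middlePrecision_eq hp, this, ← had, ← hbd]
    field_simp
    norm_num
  have hεpos : 0 < p.middleAccuracy := by rw [hε]; positivity
  have hab : 1 ≤ √a * √b := one_le_mul_of_one_le_of_one_le hsa hsb
  refine ⟨(hA.schur hB.swap hmy hs hn hpos).mono le_rfl ?_, hmx, fun x => ?_,
    by positivity, hs2, ?_, by positivity, ?_, hεpos.le, ?_, ?_⟩
  · have h1 : p.Lxy ^ 2 / p.my ≤ p.L * b := by
      rw [hbd, ← mul_div_assoc, ← sq]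
      exact div_le_div_of_nonneg_right (pow_le_pow_left₀ hLxy.le hp.Lxy_le_L 2) hmy.le
    have h2 : p.L * 1 ≤ p.L * b := mul_le_mul_of_nonneg_left hb hL.le
    linarith
  · rw [LinearMap.comp_apply, div_mul_eq_mul_div, le_div_iff₀ hmy]
    linarith [hn (Bt x), hB.norm_transpose_le x]
  · rw [hsq]; field_simp
  · have h1 : (outerScale p + 1 / outerScale p) ^ 2 ≤ outerScale p ^ 2 + 2 + 1 / 4 := by
      have h2 : outerScale p * (1 / outerScale p) = 1 := by
        rw [mul_one_div, div_self (by linarith)]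
      have h3 : 1 / outerScale p ≤ 1 / 2 := by gcongr
      have h4 : 0 ≤ 1 / outerScale p := by positivity
      nlinarith
    have h5 : 2 * p.L * b / (2 * p.mx) = a * b := by rw [had]; field_simp
    have h6 : (5 / 3 * (√a * √b)) ^ 2 = 25 / 9 * (a * b) := by
      rw [mul_pow, mul_pow, Real.sq_sqrt (by linarith), Real.sq_sqrt (by linarith)]; norm_num
    have h7 : a * 1 ≤ a * b := mul_le_mul_of_nonneg_left hb (by linarith)
    rw [h5, h6]
    rw [hsq] at h1
    linarith
  · rw [hε, one_div_mul_eq_div, div_le_iff₀ (by positivity)]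
    have h1 : a * 1 ≤ a * a := mul_le_mul_of_nonneg_left ha (by linarith)
    have h2 : a * a * 1 ≤ a * a * (√a * √b) := mul_le_mul_of_nonneg_left hab (by positivity)
    linarith
  · have h1 : √(p.Lxy / p.mx) ≤ √a := Real.sqrt_le_sqrt hκa
    have h2 : 10 * p.middleAccuracy * (5 / 3 * (√a * √b)) * (1 + p.Lxy / p.my) * outerScale p =
        10 * (5 / 3) * (1 + p.Lxy / p.my) * outerScale p / (180 * (a * a)) := by
      rw [hε]
      field_simp
    rw [h2, div_le_one (by positivity)]
    have h3 : outerScale p ≤ 2 * a := by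
      unfold outerScale
      nlinarith
    calc 10 * (5 / 3) * (1 + p.Lxy / p.my) * outerScale p
        ≤ 10 * (5 / 3) * (2 * a) * (2 * a) := by gcongr; linarith
      _ ≤ 180 * (a * a) := by nlinarith

/-- Proximal Best Response terminates once the number of rounds `T` of the outer loop and the
number of rounds `T'` of each middle loop make the respective geometric factors small enough. -/
theorem pbr_spec (hp : p.Standing) {P : QuadProblem n m} (hP : P.OpBounds p)
    {xs : EuclideanSpace ℝ (Fin n)} {ys : EuclideanSpace ℝ (Fin m)} (hst : P.IsStationary xs ys)
    {ε : ℝ} (hε : 0 < ε) {T T' : ℕ} (hT : 0 < T) (hT' : 0 < T')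
    (hTM' : 17 * (8 / 5 * √(p.L / p.my)) * (1 - 1 / (8 * middleScale p)) ^ T' * (4 * p.L) ≤
      p.mx / (9 * p.L * p.middlePrecision) * p.my)
    (hTM : (13 + 8 * (p.Lxy / p.my)) * (5 / 3 * (√(p.L / p.mx) * √(p.L / p.my))) *
      (1 - 1 / (8 * outerScale p)) ^ T * (p.Lx + p.Lxy) ≤ p.tol ε * p.mx) (z₀ : ZSpace n m) :
    (pbr p P ε z₀).Spec (4 + T * (middleCost p T' + 4)) fun z =>
      P.residual z ≤ p.tol ε * P.residual z₀ := by
  have hLxy := hp.Lxy_pos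
  have hmx := hp.mx_pos
  have hmy := hp.my_pos
  have hL := hp.L_pos
  have hLx := hp.Lx_pos
  have hLL := hp.Lxy_le_L
  have hLxL := hp.Lx_le_L
  have hmL := hp.my_lt_Lxy
  have htol : 0 < p.tol ε := by unfold Params.tol; positivity
  set A := Matrix.toEuclideanLin P.A with hA
  set B := Matrix.toEuclideanLin P.B with hB
  set Bt := Matrix.toEuclideanLin P.B.transpose with hBt
  set C := Matrix.toEuclideanLin P.C with hC
  obtain ⟨Ci, hCi, -, hCs, hCn, hCp⟩ := hP.boundsC.exists_inverse hmy
  have hdata := outer_appaData hp hCs hCn hCp (hP.boundsA.mono le_rfl hLxL) hP.coupling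
  rw [← hA, ← hB, ← hBt] at hdata
  set Q := A + B ∘ₗ Ci ∘ₗ Bt with hQ
  set R := Ci ∘ₗ Bt with hR
  set s := outerScale p with hs
  set Δ := 5 / 3 * (√(p.L / p.mx) * √(p.L / p.my)) with hΔ
  have hpair : ∀ z : ZSpace n m, ‖z - mkZ xs ys‖ = pairNorm (z.fst - xs) (z.snd - ys) :=
    fun z => norm_ZSpace_eq_pairNorm _
  unfold pbr
  refine (P.residualNorm_spec z₀).bind fun g₀ hg₀ => ?_
  subst hg₀
  rw [hp.max_mx]
  change Counted.Spec (Counted.repeatUntil (fun s : ZSpace n m × EuclideanSpace ℝ (Fin n) => do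
      let z ← appaAbr p (fun x y => do
          let g ← P.gradX x y
          pure (g + (2 * p.Lxy) • (x - s.2))) P.gradY s.1 p.middlePrecision
      pure (z, z.fst + appaTheta (p.Lxy / p.mx) • (z.fst - s.1.fst) +
        appaTau (p.Lxy / p.mx) • (z.fst - s.2))) _ _ >>= _) _ _
  refine Counted.Spec.bind_pure (R := fun s : ZSpace n m × EuclideanSpace ℝ (Fin n) =>
    P.residual s.1 ≤ p.tol ε * P.residual z₀) ?_ fun a ha => ha
  refine Counted.Spec.mono (Counted.Spec.repeatUntil (c := middleCost p T') (c' := 4) (T := T)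
    (fun t st => ∃ xo, appaPotential Q R p.mx s Δ (st.1.fst - xs) (st.1.snd - ys)
      (st.2 - xs) xo ≤ (1 - 1 / (8 * s)) ^ t *
      appaPotential Q R p.mx s Δ (z₀.fst - xs) (z₀.snd - ys) (z₀.fst - xs) 0)
    (fun st => P.residual st.1 ≤ p.tol ε * P.residual z₀)
    (add_nonneg (middleCost_nonneg p T') (by norm_num)) hT
    ⟨0, by rw [pow_zero, one_mul]⟩ ?_ ?_ ?_) le_rfl ?_
  · rintro t ⟨z, xh⟩ ⟨xo, hxo⟩
    obtain ⟨xp, hxp⟩ := hdata.bounds.exists_prox hmx hLxy.le (xh - xs)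
    have hround := appaAbr_spec hp (c := 2) (by norm_num)
      (gX := fun x y => do
        let g ← P.gradX x y
        pure (g + (2 * p.Lxy) • (x - xh))) (gY := P.gradY)
      (A := A + (2 * p.Lxy) • LinearMap.id) (B := B) (Bt := Bt) (C := C)
      -- The middle loop acts as the inexact proximal solver: its saddle point is the exact proximal
      -- point together with the response `R xp`.
      (u := P.u - (2 * p.Lxy) • xh) (v := P.v) (xs := xs + xp) (ys := ys + R xp)
      (fun x y => Counted.Spec.bind_pure (P.gradX_spec x y) fun g hg => by
        rw [hg]
        simp only [LinearMap.add_apply, LinearMap.smul_apply, LinearMap.id_apply]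
        module)
      P.gradY_spec ((hP.boundsA.add_smul_id _).mono (by linarith) (by linarith))
      (hP.boundsC.mono le_rfl (hp.Lx_eq_Ly ▸ hLxL)) hP.coupling
      (by
        have h2 : A xp + B (R xp) = (2 * p.Lxy) • (xh - xs - xp) := hxp
        have h3 : A xp = (2 * p.Lxy) • (xh - xs - xp) - B (R xp) := by
          rw [← h2]; abel
        simp only [LinearMap.add_apply, LinearMap.smul_apply, LinearMap.id_apply, map_add, h3]
        rw [← hst.fst_eq]
        module)
      (by
        rw [map_add, map_add, hR, LinearMap.comp_apply, hCi, ← hst.snd_eq]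
        abel)
      (Params.middlePrecision_pos hp) hT' hTM' z
    refine Counted.Spec.bind_pure hround fun z' hz' => ⟨xp, ?_⟩
    have hstep := hdata.potential_step (x := z.fst - xs) (x' := z'.fst - xs) (xh := xh - xs)
      (xh' := z'.fst + appaTheta (p.Lxy / p.mx) • (z'.fst - z.fst) +
        appaTau (p.Lxy / p.mx) • (z'.fst - xh) - xs) (xo := xo) (y := z.snd - ys)
      (y' := z'.snd - ys) hxp
      (by
        rw [norm_ZSpace_eq_pairNorm, norm_ZSpace_eq_pairNorm] at hz'
        rw [sub_sub, sub_sub, sub_sub, sub_sub]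
        exact hz')
      (by
        rw [appaTheta_eq, appaTau_eq (by positivity), hs, outerScale]
        module)
    refine hstep.trans ?_
    rw [pow_succ', mul_assoc]
    refine mul_le_mul_of_nonneg_left hxo ?_
    rw [sub_nonneg, div_le_one] <;> linarith [hdata.two_le_s]
  · exact fun st => Counted.Spec.bind_pure (P.residualNorm_spec st.1) fun a ha => by rw [ha]
  · rintro ⟨z, xh⟩ ⟨xo, hxo⟩
    have h1 := hdata.pairNorm_le_of_potential_le (by positivity) hxo
    rw [← hpair, ← hpair] at h1
    calc P.residual z ≤ (p.Lx + p.Lxy) * ‖z - mkZ xs ys‖ := hP.residual_le hp hst z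
      _ ≤ (p.Lx + p.Lxy) * ((13 + 8 * (p.Lxy / p.my)) * Δ * (1 - 1 / (8 * s)) ^ T *
          ‖z₀ - mkZ xs ys‖) := by gcongr
      _ = (13 + 8 * (p.Lxy / p.my)) * Δ * (1 - 1 / (8 * s)) ^ T * (p.Lx + p.Lxy) *
          ‖z₀ - mkZ xs ys‖ := by ring
      _ ≤ p.tol ε * p.mx * ‖z₀ - mkZ xs ys‖ := by gcongr
      _ = p.tol ε * (p.mx * ‖z₀ - mkZ xs ys‖) := by ring
      _ ≤ p.tol ε * P.residual z₀ := by gcongr; exact hP.le_residual hp hst z₀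
  · intro st hst'
    exact hst'.2

end OuterLoop

/-! ### Numbers of rounds and the cost of Proximal Best Response. -/

theorem log_le_natCast {c : ℝ} {k : ℕ} (hc : 0 < c) (h : c ≤ (27 / 10) ^ k) : Real.log c ≤ k := by
  rw [Real.log_le_iff_le_exp hc, ← mul_one (k : ℝ), Real.exp_nat_mul]
  refine h.trans (pow_le_pow_left₀ (by norm_num) ?_ k)
  linarith [Real.exp_one_gt_d9]

/-- The number of rounds that a linearly convergent loop needs. -/
theorem exists_rounds {q K H : ℝ} (hq : 0 < q) (hq1 : q ≤ 1) (hK : 0 < K) (hH : 1 ≤ H)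
    (h : Real.log K ≤ H) :
    ∃ T : ℕ, 0 < T ∧ K * (1 - q) ^ T ≤ 1 ∧ (T : ℝ) ≤ 2 / q * H := by
  have hHq : 1 ≤ H / q := (one_le_div hq).2 (hq1.trans hH)
  refine ⟨⌈H / q⌉₊, Nat.ceil_pos.2 (by linarith), ?_, ?_⟩
  · have h1 : H ≤ q * (⌈H / q⌉₊ : ℝ) := by
      have := Nat.le_ceil (H / q)
      rw [div_le_iff₀ hq] at this
      linarith
    calc K * (1 - q) ^ ⌈H / q⌉₊ ≤ K * Real.exp (-(q * ⌈H / q⌉₊)) := by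
          gcongr; exact pow_one_sub_le_exp hq1 _
      _ ≤ K * Real.exp (-Real.log K) := by gcongr; linarith
      _ = 1 := by rw [Real.exp_neg, Real.exp_log hK, mul_inv_cancel₀ hK.ne']
  · have := (Nat.ceil_lt_add_one (by linarith : 0 ≤ H / q)).le
    rw [show 2 / q * H = H / q + H / q by ring]
    linarith

/-- The leading factor of the complexity bound. -/
noncomputable def Params.scale (p : Params) : ℝ := p.Lxy / √(p.mx * p.my) + √(p.Lx / p.mx)

section PBRCost

variable {p : Params} {X : ℝ}

theorem Params.Standing.one_le_cond (hp : p.Standing) : 1 ≤ p.cond := by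
  rw [hp.cond_eq]
  exact one_le_mul_of_one_le_of_one_le hp.one_le_L_div_mx hp.one_le_L_div_my

/-- All logarithms of precisions and condition numbers are measured in the single unit `X ≥ 1 + log
κ`. Any quantity polynomial in `κ` then has a logarithm of order `X`. -/
theorem log_le_mul {K c : ℝ} {k j : ℕ} (hp : p.Standing) (hX : 1 + Real.log p.cond ≤ X)
    (hK : 0 < K) (hc : 0 < c) (hKc : K ≤ c * p.cond ^ j) (hck : c ≤ (27 / 10) ^ k) (hjk : j ≤ k) :
    Real.log K ≤ k * X := by
  have hκ := hp.one_le_cond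
  have hlog : 0 ≤ Real.log p.cond := Real.log_nonneg hκ
  have h1 := Real.log_le_log hK hKc
  rw [Real.log_mul hc.ne' (pow_pos (by linarith) j).ne', Real.log_pow] at h1
  have h2 := log_le_natCast hc hck
  have h3 : (j : ℝ) ≤ k := by exact_mod_cast hjk
  have h4 : (j : ℝ) * Real.log p.cond ≤ k * Real.log p.cond := by gcongr
  have h5 : (k : ℝ) * (1 + Real.log p.cond) ≤ k * X := by gcongr
  linarith

theorem one_le_of_log_le (hp : p.Standing) (hX : 1 + Real.log p.cond ≤ X) : 1 ≤ X := by
  linarith [Real.log_nonneg hp.one_le_cond]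

theorem sqrt_le_self_of_one_le {x : ℝ} (hx : 1 ≤ x) : √x ≤ x := by
  rw [Real.sqrt_le_iff]
  exact ⟨by linarith, by nlinarith⟩

/-- After both regularisations the blocks have condition number `3L/(2 L_xy)`, which gives the
square root. One factor `X` comes from the rounds and one from the gradient steps in each. -/
theorem abrCost_le (hp : p.Standing) (hX : 1 + Real.log p.cond ≤ X) :
    abrCost p 2 ≤ 810 * √(p.L / p.Lxy) * X ^ 2 := by
  have hLxy := hp.Lxy_pos
  have hmy := hp.my_pos
  have hL := hp.L_pos
  have ha := hp.one_le_L_div_mx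
  have hb := hp.one_le_L_div_my
  have hX1 := one_le_of_log_le hp hX
  have hLL : 1 ≤ p.L / p.Lxy := (one_le_div hLxy).2 hp.Lxy_le_L
  have hLb : p.L / p.Lxy ≤ p.L / p.my := div_le_div_of_nonneg_left hL.le hmy hp.my_lt_Lxy.le
  have hκeq : 3 * p.L / (2 * p.Lxy) = 3 / 2 * (p.L / p.Lxy) := by ring
  have hbκ : p.L / p.my ≤ p.cond := by
    rw [hp.cond_eq]; exact le_mul_of_one_le_left (by linarith) ha
  have hκ1 := hp.one_le_cond
  set g := p.L / p.Lxy with hg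
  have hM : p.innerPrecision ≤ 96 * p.cond ^ 2 := by
    rw [Params.innerPrecision_eq hp, ← hp.cond_eq, sq]
    gcongr
    exact (sqrt_le_self_of_one_le hb).trans hbκ
  have hMpos : 0 < p.innerPrecision := by
    have := Params.le_innerPrecision hp
    rw [← hp.cond_eq] at this
    linarith
  -- the number of rounds
  have hr : ((abrRounds (3 * p.L / (2 * p.Lxy)) (1 / p.innerPrecision) + 1 : ℕ) : ℝ) ≤ 18 * X := by
    rw [hκeq]
    unfold abrRounds
    have hsq : 1 ≤ √(3 / 2 * g + 3 / 2 * g) := Real.one_le_sqrt.2 (by linarith)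
    have hy : 4 * √(3 / 2 * g + 3 / 2 * g) / (1 / p.innerPrecision) ≤ 1152 * p.cond ^ 3 := by
      rw [div_div_eq_mul_div, div_one]
      have h1 : √(3 / 2 * g + 3 / 2 * g) ≤ 3 * p.cond := by
        refine (sqrt_le_self_of_one_le (by linarith)).trans ?_
        linarith
      calc 4 * √(3 / 2 * g + 3 / 2 * g) * p.innerPrecision
          ≤ 4 * (3 * p.cond) * (96 * p.cond ^ 2) := by gcongr
        _ = 1152 * p.cond ^ 3 := by ring
    have hlog := log_le_mul (k := 8) hp hX (by positivity) (by norm_num) hy (by norm_num)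
      (by norm_num)
    -- Passing to base `2` at most doubles the bound, since `log 2 > 1/2`.
    have hlog2 : Real.logb 2 (4 * √(3 / 2 * g + 3 / 2 * g) / (1 / p.innerPrecision)) ≤ 16 * X := by
      rw [Real.logb, div_le_iff₀ (Real.log_pos (by norm_num))]
      have := Real.log_two_gt_d9
      push_cast at hlog
      nlinarith
    have h2 : ((⌈16 * X⌉₊ : ℕ) : ℝ) ≤ 16 * X + 1 := (Nat.ceil_lt_add_one (by linarith)).le
    have h3 : ((⌈Real.logb 2 (4 * √(3 / 2 * g + 3 / 2 * g) / (1 / p.innerPrecision))⌉₊ : ℕ) : ℝ) ≤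
        ⌈16 * X⌉₊ := by exact_mod_cast Nat.ceil_mono hlog2
    push_cast
    linarith
  -- the number of gradient steps
  have hs : (agdSteps (3 * p.L / (2 * p.Lxy)) : ℝ) ≤ 9 * √(3 / 2 * g) * X := by
    rw [hκeq]
    unfold agdSteps
    have hsq : 1 ≤ √(3 / 2 * g) := Real.one_le_sqrt.2 (by linarith)
    have hlog := log_le_mul (K := 24 * (3 / 2 * g)) (c := 36) (k := 4) (j := 1) hp hX
      (by positivity) (by norm_num) (by linarith) (by norm_num) (by norm_num)
    push_cast at hlog
    have h1 : 2 * √(3 / 2 * g) * Real.log (24 * (3 / 2 * g)) ≤ 2 * √(3 / 2 * g) * (4 * X) := by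
      gcongr
    have h2 : ((⌈2 * √(3 / 2 * g) * (4 * X)⌉₊ : ℕ) : ℝ) ≤ 2 * √(3 / 2 * g) * (4 * X) + 1 :=
      (Nat.ceil_lt_add_one (by positivity)).le
    have h3 : ((⌈2 * √(3 / 2 * g) * Real.log (24 * (3 / 2 * g))⌉₊ : ℕ) : ℝ) ≤
        ⌈2 * √(3 / 2 * g) * (4 * X)⌉₊ := by exact_mod_cast Nat.ceil_mono h1
    have h4 : 1 ≤ √(3 / 2 * g) * X := one_le_mul_of_one_le_of_one_le hsq hX1
    linarith
  have hsg : √(3 / 2 * g) ≤ 5 / 4 * √g := by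
    rw [Real.sqrt_mul (by norm_num)]
    gcongr
    rw [Real.sqrt_le_iff]
    norm_num
  unfold abrCost
  calc _ ≤ 18 * X * (9 * √(3 / 2 * g) * X * 2 + 9 * √(3 / 2 * g) * X * 2) * 1 := by
        rw [mul_one]
        gcongr
    _ = 648 * √(3 / 2 * g) * X ^ 2 := by ring
    _ ≤ 648 * (5 / 4 * √g) * X ^ 2 := by gcongr
    _ = _ := by ring

theorem exists_middle_rounds (hp : p.Standing) (hX : 1 + Real.log p.cond ≤ X) :
    ∃ T : ℕ, 0 < T ∧
      17 * (8 / 5 * √(p.L / p.my)) * (1 - 1 / (8 * middleScale p)) ^ T * (4 * p.L) ≤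
        p.mx / (9 * p.L * p.middlePrecision) * p.my ∧
      (T : ℝ) ≤ 384 * √(p.Lxy / p.my) * X := by
  have hmx := hp.mx_pos
  have hmy := hp.my_pos
  have hL := hp.L_pos
  have ha := hp.one_le_L_div_mx
  have hb := hp.one_le_L_div_my
  have hX1 := one_le_of_log_le hp hX
  have hκ1 := hp.one_le_cond
  have hM := Params.middlePrecision_pos hp
  have hr : 1 ≤ √(p.Lxy / p.my) := Real.one_le_sqrt.2 hp.one_le_Lxy_div_my
  have hbκ : p.L / p.my ≤ p.cond := by
    rw [hp.cond_eq]; exact le_mul_of_one_le_left (by linarith) ha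
  have haκ : p.L / p.mx ≤ p.cond := by
    rw [hp.cond_eq]; exact le_mul_of_one_le_right (by linarith) hb
  set K := 17 * (8 / 5 * √(p.L / p.my)) * (4 * p.L) /
    (p.mx / (9 * p.L * p.middlePrecision) * p.my) with hK
  have hKle : K ≤ 78336 * p.cond ^ 4 := by
    have : K = 4896 / 5 * √(p.L / p.my) * (p.L / p.mx * (p.L / p.my)) * p.middlePrecision := by
      rw [hK]; field_simp; norm_num
    rw [this, Params.middlePrecision_eq hp, ← hp.cond_eq]
    have h1 : √(p.L / p.my) ≤ p.cond := (sqrt_le_self_of_one_le hb).trans hbκ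
    have h2 : √(p.L / p.mx) * √(p.L / p.my) ≤ p.cond := by
      rw [hp.cond_eq]
      gcongr
      · exact sqrt_le_self_of_one_le ha
      · exact sqrt_le_self_of_one_le hb
    calc _ ≤ 4896 / 5 * p.cond * p.cond * (80 * (p.cond * p.cond)) := by gcongr
      _ = _ := by ring
  have hlog := log_le_mul (k := 12) hp hX (by positivity : 0 < K) (by norm_num) hKle (by norm_num)
    (by norm_num)
  push_cast at hlog
  obtain ⟨T, h1, h2, h3⟩ := exists_rounds (q := 1 / (8 * middleScale p)) (K := K) (H := 12 * X)
    (by unfold middleScale; positivity)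
    (by rw [div_le_one] <;> unfold middleScale <;> linarith) (by positivity) (by linarith) hlog
  refine ⟨T, h1, ?_, ?_⟩
  · rw [hK, div_mul_eq_mul_div, div_le_one (by positivity)] at h2
    linarith
  · refine h3.trans (le_of_eq ?_)
    unfold middleScale
    rw [div_div_eq_mul_div]
    ring

theorem exists_outer_rounds (hp : p.Standing) (hX : 1 + Real.log p.cond ≤ X) {ε : ℝ}
    (hε : 0 < ε) :
    ∃ T : ℕ, 0 < T ∧
      (13 + 8 * (p.Lxy / p.my)) * (5 / 3 * (√(p.L / p.mx) * √(p.L / p.my))) *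
        (1 - 1 / (8 * outerScale p)) ^ T * (p.Lx + p.Lxy) ≤ p.tol ε * p.mx ∧
      (T : ℝ) ≤ 192 * √(p.Lxy / p.mx) * (X * max 1 (Real.log (1 / ε))) := by
  have hmx := hp.mx_pos
  have hmy := hp.my_pos
  have hL := hp.L_pos
  have hLx := hp.Lx_pos
  have hLxy := hp.Lxy_pos
  have ha := hp.one_le_L_div_mx
  have hb := hp.one_le_L_div_my
  have hX1 := one_le_of_log_le hp hX
  have hκ1 := hp.one_le_cond
  have hr : 1 ≤ √(p.Lxy / p.mx) :=
    Real.one_le_sqrt.2 ((one_le_div hmx).2 (hp.mx_lt_my.trans hp.my_lt_Lxy).le)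
  have htol : 0 < p.tol ε := by unfold Params.tol; positivity
  have hℓ : 1 ≤ max 1 (Real.log (1 / ε)) := le_max_left _ _
  set K := (13 + 8 * (p.Lxy / p.my)) * (5 / 3 * (√(p.L / p.mx) * √(p.L / p.my))) *
    (p.Lx + p.Lxy) / (p.tol ε * p.mx) with hK
  have hKle : K ≤ 140 * p.cond ^ 3 * (1 / ε) := by
    have : K = (13 + 8 * (p.Lxy / p.my)) * (5 / 3 * (√(p.L / p.mx) * √(p.L / p.my))) *
        ((p.Lx + p.Lxy) / p.mx) ^ 2 * (1 / ε) := by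
      rw [hK, Params.tol]; field_simp; ring
    rw [this]
    refine mul_le_mul_of_nonneg_right ?_ (by positivity)
    have h1 : 13 + 8 * (p.Lxy / p.my) ≤ 21 * (p.L / p.my) := by linarith [hp.Lxy_div_my_le]
    have h2 : (p.Lx + p.Lxy) / p.mx ≤ 2 * (p.L / p.mx) := by
      rw [← mul_div_assoc]
      exact div_le_div_of_nonneg_right (by linarith [hp.Lx_le_L, hp.Lxy_le_L]) hmx.le
    have h3 : √(p.L / p.mx) * √(p.L / p.my) ≤ p.L / p.mx * (p.L / p.my) := by
      gcongr
      · exact sqrt_le_self_of_one_le ha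
      · exact sqrt_le_self_of_one_le hb
    calc _ ≤ 21 * (p.L / p.my) * (5 / 3 * (p.L / p.mx * (p.L / p.my))) *
          (2 * (p.L / p.mx)) ^ 2 := by gcongr
      _ = 140 * ((p.L / p.mx) ^ 3 * (p.L / p.my) ^ 2 * 1) := by ring
      _ ≤ 140 * ((p.L / p.mx) ^ 3 * (p.L / p.my) ^ 2 * (p.L / p.my)) := by gcongr
      _ = _ := by rw [hp.cond_eq]; ring
  have hlog : Real.log K ≤ 6 * (X * max 1 (Real.log (1 / ε))) := by
    have h1 := Real.log_le_log (by positivity) hKle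
    rw [Real.log_mul (by positivity) (by positivity)] at h1
    have h2 := log_le_mul (K := 140 * p.cond ^ 3) (k := 5) hp hX (by positivity) (by norm_num)
      le_rfl (by norm_num) (by norm_num)
    push_cast at h2
    have h3 : Real.log (1 / ε) ≤ max 1 (Real.log (1 / ε)) := le_max_right _ _
    nlinarith
  obtain ⟨T, h1, h2, h3⟩ := exists_rounds (q := 1 / (8 * outerScale p)) (K := K)
    (H := 6 * (X * max 1 (Real.log (1 / ε)))) (by unfold outerScale; positivity)
    (by rw [div_le_one] <;> unfold outerScale <;> linarith) (by positivity) (by nlinarith) hlog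
  refine ⟨T, h1, ?_, ?_⟩
  · rw [hK, div_mul_eq_mul_div, div_le_one (by positivity)] at h2
    linarith
  · refine h3.trans (le_of_eq ?_)
    unfold outerScale
    rw [div_div_eq_mul_div]
    ring

/-- If `L = L_x = L_y`, this is the second summand of the scale. If `L = L_xy`, then `m_y < L_xy`
bounds the root by the first summand. -/
theorem sqrt_L_div_mx_le_scale (hp : p.Standing) : √(p.L / p.mx) ≤ p.scale := by
  have hmx := hp.mx_pos
  have hmy := hp.my_pos
  have hLxy := hp.Lxy_pos
  have h1 : √(p.Lxy / p.mx) ≤ p.Lxy / √(p.mx * p.my) := by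
    rw [Real.sqrt_le_iff]
    refine ⟨by positivity, ?_⟩
    rw [div_pow, Real.sq_sqrt (by positivity), div_le_div_iff₀ hmx (by positivity)]
    have := hp.my_lt_Lxy
    nlinarith [mul_pos hLxy hmx]
  unfold Params.scale Params.L
  rcases le_total p.Lx (max p.Lxy p.Ly) with h | h
  · rw [max_eq_right h]
    rcases le_total p.Lxy p.Ly with h' | h'
    · rw [max_eq_right h', ← hp.Lx_eq_Ly]
      linarith [(by positivity : 0 ≤ p.Lxy / √(p.mx * p.my))]
    · rw [max_eq_left h']
      linarith [Real.sqrt_nonneg (p.Lx / p.mx)]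
  · rw [max_eq_left h]
    linarith [(by positivity : 0 ≤ p.Lxy / √(p.mx * p.my))]

theorem pbr_cost {n m : ℕ} (hp : p.Standing) (hX : 1 + Real.log p.cond ≤ X) {P : QuadProblem n m}
    (hP : P.OpBounds p) {xs : EuclideanSpace ℝ (Fin n)} {ys : EuclideanSpace ℝ (Fin m)}
    (hst : P.IsStationary xs ys) {ε : ℝ} (hε : 0 < ε) (z₀ : ZSpace n m) :
    (pbr p P ε z₀).Spec
      (10 ^ 8 * X ^ 4 * (p.Lxy / p.my) ^ 2 * p.scale * max 1 (Real.log (1 / ε)))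
      fun z => P.residual z ≤ p.tol ε * P.residual z₀ := by
  obtain ⟨T', hT', hTM', hTc'⟩ := exists_middle_rounds hp hX
  obtain ⟨T, hT, hTM, hTc⟩ := exists_outer_rounds hp hX hε
  refine (pbr_spec hp hP hst hε hT hT' hTM' hTM z₀).mono ?_ fun _ h => h
  have hmx := hp.mx_pos
  have hmy := hp.my_pos
  have hL := hp.L_pos
  have hLxy := hp.Lxy_pos
  have hX1 := one_le_of_log_le hp hX
  have hr := hp.one_le_Lxy_div_my
  have habr := abrCost_le hp hX
  have hsc := sqrt_L_div_mx_le_scale hp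
  have h1r : 1 ≤ √(p.Lxy / p.my) := Real.one_le_sqrt.2 hr
  have h1a : 1 ≤ √(p.Lxy / p.mx) :=
    Real.one_le_sqrt.2 ((one_le_div hmx).2 (hp.mx_lt_my.trans hp.my_lt_Lxy).le)
  have h1g : 1 ≤ √(p.L / p.Lxy) := Real.one_le_sqrt.2 ((one_le_div hLxy).2 hp.Lxy_le_L)
  -- The outer and the inner conditioning multiply to `L/m_x`; the factor `√(L_xy/m_y)` of the
  -- middle loop is the only excess over the scale.
  have hmul : √(p.Lxy / p.mx) * √(p.L / p.Lxy) = √(p.L / p.mx) := by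
    rw [← Real.sqrt_mul (by positivity)]
    congr 1
    field_simp
  have hrr : √(p.Lxy / p.my) ≤ (p.Lxy / p.my) ^ 2 := by
    refine (sqrt_le_self_of_one_le hr).trans ?_
    nlinarith
  set ℓ := max 1 (Real.log (1 / ε)) with hℓd
  have hℓ : 1 ≤ ℓ := le_max_left _ _
  set r' := √(p.Lxy / p.my)
  set g' := √(p.L / p.Lxy)
  set a' := √(p.Lxy / p.mx)
  have hgX : 1 ≤ g' * X ^ 2 := one_le_mul_of_one_le_of_one_le h1g (one_le_pow₀ hX1)
  have hrX : 1 ≤ r' * X := one_le_mul_of_one_le_of_one_le h1r hX1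
  have haX : 1 ≤ a' * (X * ℓ) :=
    one_le_mul_of_one_le_of_one_le h1a (one_le_mul_of_one_le_of_one_le hX1 hℓ)
  have hin : 1 ≤ r' * X * (g' * X ^ 2) := one_le_mul_of_one_le_of_one_le hrX hgX
  have hmid : middleCost p T' + 4 ≤ 350000 * (r' * X * (g' * X ^ 2)) := by
    unfold middleCost
    have h1 : abrCost p 2 + 2 * 2 ≤ 820 * (g' * X ^ 2) := by linarith
    have h2 : (T' : ℝ) * (abrCost p 2 + 2 * 2) ≤ 384 * r' * X * (820 * (g' * X ^ 2)) :=
      mul_le_mul hTc' h1 (add_nonneg (abrCost_nonneg p (by norm_num)) (by norm_num))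
        (by positivity)
    linarith
  have hall : (T : ℝ) * (middleCost p T' + 4) ≤
      192 * a' * (X * ℓ) * (350000 * (r' * X * (g' * X ^ 2))) :=
    mul_le_mul hTc hmid (add_nonneg (middleCost_nonneg p T') (by norm_num)) (by positivity)
  have hbig : 1 ≤ a' * (X * ℓ) * (r' * X * (g' * X ^ 2)) :=
    one_le_mul_of_one_le_of_one_le haX hin
  have heq : a' * (X * ℓ) * (r' * X * (g' * X ^ 2)) = X ^ 4 * r' * (a' * g') * ℓ := by ring
  calc 4 + (T : ℝ) * (middleCost p T' + 4)
      ≤ 10 ^ 8 * (a' * (X * ℓ) * (r' * X * (g' * X ^ 2))) := by linarith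
    _ = 10 ^ 8 * X ^ 4 * r' * √(p.L / p.mx) * ℓ := by rw [heq, hmul]; ring
    -- The excess `√(L_xy/m_y)` is deliberately weakened to the square, which is the form `ratio 1 ^
    -- 2` that the induction over the depth preserves.
    _ ≤ 10 ^ 8 * X ^ 4 * (p.Lxy / p.my) ^ 2 * p.scale * ℓ := by gcongr

end PBRCost

/-! ### Contraction of the splitting iteration in the norm of `P⁻¹`. -/

section Hss

open scoped InnerProductSpace

variable {H : Type*} [NormedAddCommGroup H] [InnerProductSpace ℝ H]

/-- The splitting `J = G + S` with preconditioner `P` (inverse `Pi`) and parameter `η`. -/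
structure HssData (P Pi G S : H →ₗ[ℝ] H) (p₀ p₁ η r : ℝ) : Prop where
  boundsP : HasBounds P p₀ p₁
  p₀_pos : 0 < p₀
  apply_inv : ∀ x, P (Pi x) = x
  inv_apply : ∀ x, Pi (P x) = x
  inv_symm : ∀ x y, ⟪Pi x, y⟫_ℝ = ⟪x, Pi y⟫_ℝ
  inv_nonneg : ∀ x, 0 ≤ ⟪x, Pi x⟫_ℝ
  symmG : ∀ x y, ⟪G x, y⟫_ℝ = ⟪x, G y⟫_ℝ
  nonnegG : ∀ x, 0 ≤ ⟪x, G x⟫_ℝ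
  skewS : ∀ x, ⟪x, S x⟫_ℝ = 0
  η_pos : 0 < η
  one_le_r : 1 ≤ r
  G_le : ∀ x, ⟪x, G x⟫_ℝ ≤ r * η * ⟪x, P x⟫_ℝ
  le_G : ∀ x, η ^ 2 * ⟪x, P x⟫_ℝ ≤ (η * r + η / r) * ⟪x, G x⟫_ℝ

/-- The norm of the residual space in which the splitting is a contraction. -/
noncomputable def hssNorm (Pi : H →ₗ[ℝ] H) (w : H) : ℝ := √⟪w, Pi w⟫_ℝ

namespace HssData

variable {P Pi G S : H →ₗ[ℝ] H} {p₀ p₁ η r : ℝ}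

theorem hssNorm_nonneg (w : H) : 0 ≤ hssNorm Pi w := Real.sqrt_nonneg _

theorem hssNorm_sq (h : HssData P Pi G S p₀ p₁ η r) (w : H) :
    hssNorm Pi w ^ 2 = ⟪w, Pi w⟫_ℝ := Real.sq_sqrt (h.inv_nonneg w)

theorem hssNorm_add_le (h : HssData P Pi G S p₀ p₁ η r) (v w : H) :
    hssNorm Pi (v + w) ≤ hssNorm Pi v + hssNorm Pi w :=
  psd_sqrt_add_le h.inv_symm h.inv_nonneg v w

theorem hssNorm_neg (w : H) : hssNorm Pi (-w) = hssNorm Pi w := by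
  unfold hssNorm
  rw [map_neg, inner_neg_neg]

theorem hssNorm_sub_le (h : HssData P Pi G S p₀ p₁ η r) (v w : H) :
    hssNorm Pi (v - w) ≤ hssNorm Pi v + hssNorm Pi w := by
  rw [sub_eq_add_neg, ← hssNorm_neg w]
  exact h.hssNorm_add_le v (-w)

theorem sqrt_mul_hssNorm_le (h : HssData P Pi G S p₀ p₁ η r) (w : H) :
    √p₀ * hssNorm Pi w ≤ ‖w‖ := by
  refine abs_le_of_sq_le_sq' ?_ (norm_nonneg _) |>.2
  have := h.boundsP.mul_inner_le h.p₀_pos.le (Pi w)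
  rw [h.apply_inv, real_inner_comm] at this
  rwa [mul_pow, Real.sq_sqrt h.p₀_pos.le, h.hssNorm_sq]

theorem norm_le_sqrt_mul (h : HssData P Pi G S p₀ p₁ η r) (hp₁ : 0 ≤ p₁) (w : H) :
    ‖w‖ ≤ √p₁ * hssNorm Pi w := by
  refine abs_le_of_sq_le_sq' ?_ (mul_nonneg (Real.sqrt_nonneg _) (hssNorm_nonneg _)) |>.2
  have := h.boundsP.norm_sq_apply_le h.p₀_pos.le hp₁ (Pi w)
  rw [h.apply_inv, real_inner_comm] at this
  rwa [mul_pow, Real.sq_sqrt hp₁, h.hssNorm_sq]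

/-- Expansion of the squared residual norm of `(η P + t T) c`. -/
theorem hssNorm_sq_add (h : HssData P Pi G S p₀ p₁ η r) (T : H →ₗ[ℝ] H) (t : ℝ) (c : H) :
    hssNorm Pi (η • P c + t • T c) ^ 2 =
      η ^ 2 * ⟪c, P c⟫_ℝ + 2 * η * t * ⟪c, T c⟫_ℝ + t ^ 2 * ⟪T c, Pi (T c)⟫_ℝ := by
  rw [h.hssNorm_sq]
  simp only [map_add, map_smul, inner_add_left, inner_add_right, real_inner_smul_left,
    real_inner_smul_right, h.inv_apply]
  rw [← h.inv_symm (P c) (T c), h.inv_apply, real_inner_comm c (P c), real_inner_comm c (T c)]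
  ring

theorem inner_G_inv_le (h : HssData P Pi G S p₀ p₁ η r) (c : H) :
    ⟪G c, Pi (G c)⟫_ℝ ≤ r * η * ⟪c, G c⟫_ℝ := by
  have hr := h.one_le_r
  have hη := h.η_pos
  refine inner_inv_le h.symmG h.nonnegG (by positivity) ((h.G_le _).trans_eq ?_)
  rw [h.apply_inv, real_inner_comm]

/-- The factor contributed by the symmetric part. -/
theorem hssNorm_sub_G_le (h : HssData P Pi G S p₀ p₁ η r) (c : H) :
    hssNorm Pi (η • P c - G c) ≤ (1 - 2 / (5 * r)) * hssNorm Pi (η • P c + G c) := by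
  have hr := h.one_le_r
  have hη := h.η_pos
  have hr1 : 1 / r ≤ 1 := by rw [div_le_one] <;> linarith
  have hθ : 0 ≤ 1 - 2 / (5 * r) := by
    rw [show 2 / (5 * r) = 2 / 5 * (1 / r) by field_simp]; linarith
  refine abs_le_of_sq_le_sq' ?_ (mul_nonneg hθ (hssNorm_nonneg _)) |>.2
  have e1 := h.hssNorm_sq_add G (-1) c
  have e2 := h.hssNorm_sq_add G 1 c
  rw [neg_one_smul, ← sub_eq_add_neg] at e1
  rw [one_smul] at e2
  rw [mul_pow, e1, e2]
  have h1 := h.inner_G_inv_le c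
  have h2 := h.le_G c
  have h3 := h.nonnegG c
  set Y := 2 * η * ⟪c, G c⟫_ℝ with hY
  set X := η ^ 2 * ⟪c, P c⟫_ℝ + ⟪G c, Pi (G c)⟫_ℝ with hX
  have hY0 : 0 ≤ Y := by positivity
  -- The squared norms to be compared are `X - Y` and `X + Y`. The lower bound on `G` gives `η² P ≼
  -- 2 η r G`, and the upper bound gives `G P⁻¹ G ≼ r η G`. Hence `2Y/(X + Y) ≥ 4/(5r)`.
  have h4 : X ≤ 3 / 2 * r * Y := by
    have h5 : η / r * ⟪c, G c⟫_ℝ ≤ η * r * ⟪c, G c⟫_ℝ := by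
      refine mul_le_mul_of_nonneg_right ?_ h3
      rw [div_le_iff₀ (by linarith), mul_assoc]
      exact le_mul_of_one_le_right hη.le (one_le_mul_of_one_le_of_one_le hr hr)
    rw [hX, hY]
    linarith
  have h5 : X - Y ≤ (1 - 2 / (5 * r)) ^ 2 * (X + Y) := by
    have hX0 : 0 ≤ X + Y := by
      have := h.hssNorm_sq_add G 1 c
      have h7 : 0 ≤ hssNorm Pi (η • P c + (1 : ℝ) • G c) ^ 2 := sq_nonneg _
      rw [this] at h7
      rw [hX, hY]
      linarith
    have h6 : (1 - 4 / 5 * (1 / r)) * (X + Y) ≤ (1 - 2 / (5 * r)) ^ 2 * (X + Y) := by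
      refine mul_le_mul_of_nonneg_right ?_ hX0
      rw [show 2 / (5 * r) = 2 / 5 * (1 / r) by field_simp]
      nlinarith [sq_nonneg (1 / r)]
    refine le_trans ?_ h6
    have h7 : 4 / 5 * (1 / r) * (X + Y) ≤ 4 / 5 * (1 / r) * (3 / 2 * r * Y + Y) := by
      gcongr
    have h8 : 4 / 5 * (1 / r) * (3 / 2 * r * Y + Y) = 6 / 5 * Y + 4 / 5 * (1 / r * Y) := by
      field_simp
      ring
    have h9 : 1 / r * Y ≤ 1 * Y := by gcongr
    linarith
  rw [hX, hY] at h5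
  linarith

/-- The cross term is a multiple of `⟪c, S c⟫ = 0`: the Cayley transform of a skew operator is an
isometry. -/
theorem hssNorm_sub_S (h : HssData P Pi G S p₀ p₁ η r) (c : H) :
    hssNorm Pi (η • P c - S c) = hssNorm Pi (η • P c + S c) := by
  refine (pow_left_inj₀ (hssNorm_nonneg _) (hssNorm_nonneg _) two_ne_zero).1 ?_
  have e1 := h.hssNorm_sq_add S (-1) c
  have e2 := h.hssNorm_sq_add S 1 c
  rw [neg_one_smul, ← sub_eq_add_neg] at e1
  rw [one_smul] at e2
  rw [e1, e2, h.skewS]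
  ring

/-- `G + S` is the difference of `ηP + S` and `ηP - G`. The bound is needed because the tolerance of
the conjugate gradient solve is relative to `J e`, and also to translate the decay of the potential
back to the residual. -/
theorem hssNorm_J_le (h : HssData P Pi G S p₀ p₁ η r) (c : H) :
    hssNorm Pi (G c + S c) ≤ 3 * r * hssNorm Pi (η • P c + S c) := by
  have hr := h.one_le_r
  have hη := h.η_pos
  have e1 := h.hssNorm_sq_add G (-1) c
  have e2 := h.hssNorm_sq_add S 1 c
  rw [neg_one_smul, ← sub_eq_add_neg] at e1
  rw [one_smul, h.skewS] at e2
  have h1 := h.inner_G_inv_le c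
  have h2 := h.G_le c
  have h3 := h.nonnegG c
  have h4 := h.inv_nonneg (S c)
  have h0 := h.boundsP.inner_nonneg h.p₀_pos.le c
  have h5 : hssNorm Pi (η • P c - G c) ≤ 3 / 2 * r * hssNorm Pi (η • P c + S c) := by
    refine abs_le_of_sq_le_sq' ?_ (mul_nonneg (by linarith) (hssNorm_nonneg _)) |>.2
    rw [mul_pow, e1, e2]
    have h6 : r * η * ⟪c, G c⟫_ℝ ≤ r * η * (r * η * ⟪c, P c⟫_ℝ) := by gcongr
    have h7 : η ^ 2 * ⟪c, P c⟫_ℝ * 1 ≤ η ^ 2 * ⟪c, P c⟫_ℝ * r ^ 2 := by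
      gcongr
      nlinarith
    have h8 : 0 ≤ r ^ 2 * ⟪S c, Pi (S c)⟫_ℝ := by positivity
    have h9 : 0 ≤ η * ⟪c, G c⟫_ℝ := by positivity
    have h10 : 0 ≤ η ^ 2 * ⟪c, P c⟫_ℝ * r ^ 2 := by positivity
    nlinarith
  have h6 := h.hssNorm_sub_le (η • P c + S c) (η • P c - G c)
  rw [show η • P c + S c - (η • P c - G c) = G c + S c by abel] at h6
  nlinarith [hssNorm_nonneg (Pi := Pi) (η • P c + S c)]

/-- One inexact iteration: `e`, `c`, `e'` are the errors of `z_t`, of the half step, and of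
`z_{t+1}`. -/
theorem step (h : HssData P Pi G S p₀ p₁ η r) (hp₁ : 0 ≤ p₁) {δ₁ δ₂ : ℝ} (hδ₁ : 0 ≤ δ₁)
    (hδ₂ : 0 ≤ δ₂) (hr₁ : √(p₁ / p₀) * δ₁ * (3 * r) ≤ 1 / (30 * r))
    (hr₂ : √(p₁ / p₀) * δ₂ ≤ 1 / (16 * r)) {e c e' : H}
    (h1 : ‖(η • P c + G c) - (η • P e - S e)‖ ≤ δ₁ * ‖G e + S e‖)
    (h2 : ‖(η • P e' + S e') - (η • P c - G c)‖ ≤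
      δ₂ * ‖(η • P e + S e) - (η • P c - G c)‖) :
    hssNorm Pi (η • P e' + S e') ≤ (1 - 1 / (6 * r)) * hssNorm Pi (η • P e + S e) := by
  have hr := h.one_le_r
  have hp₀ : 0 < √p₀ := Real.sqrt_pos.2 h.p₀_pos
  have hir : 1 / r ≤ 1 := by rw [div_le_one] <;> linarith
  have hir0 : 0 ≤ 1 / r := by positivity
  rw [show 1 / (30 * r) = 1 / 30 * (1 / r) by field_simp] at hr₁
  rw [show 1 / (16 * r) = 1 / 16 * (1 / r) by field_simp] at hr₂
  set q := 1 / r with hq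
  set N := hssNorm Pi with hN
  set ν := N (η • P e + S e) with hν
  have hν0 : 0 ≤ ν := hssNorm_nonneg _
  have hsq : √(p₁ / p₀) = √p₁ / √p₀ := Real.sqrt_div hp₁ _
  -- The inner solvers guarantee Euclidean accuracies; measuring them in the norm of `P⁻¹` costs the
  -- root of the condition number of `P`.
  have trans : ∀ {v w : H} {δ : ℝ}, 0 ≤ δ → ‖v‖ ≤ δ * ‖w‖ → N v ≤ √(p₁ / p₀) * δ * N w := by
    intro v w δ hδ hvw
    have t1 := h.sqrt_mul_hssNorm_le v
    have t2 := h.norm_le_sqrt_mul hp₁ w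
    rw [hsq, div_mul_eq_mul_div, div_mul_eq_mul_div, le_div_iff₀ hp₀]
    calc N v * √p₀ = √p₀ * N v := mul_comm _ _
      _ ≤ δ * ‖w‖ := t1.trans hvw
      _ ≤ δ * (√p₁ * N w) := by gcongr
      _ = √p₁ * δ * N w := by ring
  -- the half step
  have s1 : N ((η • P c + G c) - (η • P e - S e)) ≤ 1 / 30 * q * ν := by
    refine (trans hδ₁ h1).trans ?_
    have := h.hssNorm_J_le e
    calc √(p₁ / p₀) * δ₁ * N (G e + S e) ≤ √(p₁ / p₀) * δ₁ * (3 * r * ν) := by gcongr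
      _ = √(p₁ / p₀) * δ₁ * (3 * r) * ν := by ring
      _ ≤ _ := by gcongr
  have s2 : N (η • P c + G c) ≤ (1 + 1 / 30 * q) * ν := by
    have := h.hssNorm_add_le (η • P e - S e) ((η • P c + G c) - (η • P e - S e))
    rw [add_sub_cancel, h.hssNorm_sub_S] at this
    linarith
  have s3 : N (η • P c - G c) ≤ (1 - 2 / 5 * q) * ((1 + 1 / 30 * q) * ν) := by
    have t := h.hssNorm_sub_G_le c
    rw [show 2 / (5 * r) = 2 / 5 * q by rw [hq]; field_simp] at t
    refine t.trans (mul_le_mul_of_nonneg_left s2 ?_)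
    linarith
  have s4 : N ((η • P e + S e) - (η • P c - G c)) ≤ 3 * ν := by
    refine (h.hssNorm_sub_le _ _).trans ?_
    have h1 : (1 - 2 / 5 * q) * (1 + 1 / 30 * q) ≤ 2 := by nlinarith
    have h2 := mul_le_mul_of_nonneg_right h1 hν0
    linarith
  have s5 : N ((η • P e' + S e') - (η • P c - G c)) ≤ 1 / 16 * q * (3 * ν) := by
    refine (trans hδ₂ h2).trans ?_
    exact mul_le_mul hr₂ s4 (hssNorm_nonneg _) (by positivity)
  have s6 := h.hssNorm_add_le (η • P c - G c) ((η • P e' + S e') - (η • P c - G c))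
  rw [add_sub_cancel] at s6
  rw [show 1 / (6 * r) = 1 / 6 * q by rw [hq]; field_simp]
  -- The budget in units of `q = 1/r`: a gain of `2/5`, a loss of `1/30` in the half step and of
  -- `3/16` in the recursive solve. This leaves more than `1/6`.
  have s7 : 0 ≤ q * ν := by positivity
  have s8 : 0 ≤ q * (q * ν) := by positivity
  nlinarith

end HssData

end Hss

/-! ### How the parameters change under the recursion. -/

namespace Params

/-- The ratio `(L_xy / m_y) ^ (1/k)` by which RHSS(k) rescales `m_x` and `m_y`. -/
noncomputable def ratio (p : Params) (k : ℕ) : ℝ := (p.Lxy / p.my) ^ (1 / (k : ℝ))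

namespace Standing

variable {p : Params} {k : ℕ}

theorem ratio_one (p : Params) : p.ratio 1 = p.Lxy / p.my := by simp [ratio]

theorem one_lt_ratio (hp : p.Standing) (hk : 1 ≤ k) : 1 < p.ratio k := by
  have hk0 : (0 : ℝ) < k := by exact_mod_cast hk
  exact Real.one_lt_rpow ((one_lt_div hp.my_pos).2 hp.my_lt_Lxy) (by positivity)

theorem ratio_pow (hp : p.Standing) (hk : 1 ≤ k) : p.ratio k ^ k = p.Lxy / p.my := by
  rw [ratio, one_div, Real.rpow_inv_natCast_pow (div_pos hp.Lxy_pos hp.my_pos).le (by omega)]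

theorem ratio_sq_le (hp : p.Standing) (hk : 2 ≤ k) : p.ratio k ^ 2 ≤ p.Lxy / p.my := by
  rw [← hp.ratio_pow (by omega : 1 ≤ k)]
  exact pow_le_pow_right₀ (hp.one_lt_ratio (by omega)).le hk

theorem ratio_sq_mul_my_le (hp : p.Standing) (hk : 2 ≤ k) : p.ratio k ^ 2 * p.my ≤ p.Lxy :=
  (le_div_iff₀ hp.my_pos).1 (hp.ratio_sq_le hk)

theorem ratio_mul_my_lt (hp : p.Standing) (hk : 2 ≤ k) : p.ratio k * p.my < p.Lxy := by
  have h := hp.ratio_sq_mul_my_le hk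
  have h1 := hp.one_lt_ratio (by omega : 1 ≤ k)
  have h2 : p.ratio k * p.my < p.ratio k ^ 2 * p.my := by
    refine mul_lt_mul_of_pos_right ?_ hp.my_pos
    nlinarith
  linarith

theorem hssEta_eq (hp : p.Standing) : p.hssEta k = p.ratio k * p.my := by
  have h := Real.rpow_pos_of_pos hp.my_pos (1 / (k : ℝ))
  rw [hssEta, ratio, Real.div_rpow hp.Lxy_pos.le hp.my_pos.le, Real.rpow_sub hp.my_pos,
    Real.rpow_one]
  field_simp

theorem hssBeta_eq (hp : p.Standing) (hk : 1 ≤ k) :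
    p.hssBeta k = 1 / (p.ratio k ^ 2 * p.my) := by
  have hk0 : (k : ℝ) ≠ 0 := by positivity
  have h := Real.rpow_pos_of_pos hp.my_pos (1 / (k : ℝ))
  have h' := Real.rpow_pos_of_pos hp.Lxy_pos (1 / (k : ℝ))
  have hmy := hp.my_pos
  have e1 : p.Lxy ^ (-2 / (k : ℝ)) = ((p.Lxy ^ (1 / (k : ℝ))) ^ 2)⁻¹ := by
    rw [← Real.rpow_natCast, ← Real.rpow_mul hp.Lxy_pos.le, ← Real.rpow_neg hp.Lxy_pos.le]
    congr 1
    push_cast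
    ring
  have e2 : p.my ^ (-((k : ℝ) - 2) / (k : ℝ)) = (p.my ^ (1 / (k : ℝ))) ^ 2 / p.my := by
    rw [← Real.rpow_natCast, ← Real.rpow_mul hp.my_pos.le, ← Real.rpow_sub_one hp.my_pos.ne']
    congr 1
    push_cast
    field_simp
    ring
  rw [hssBeta, e1, e2, ratio, Real.div_rpow hp.Lxy_pos.le hp.my_pos.le]
  field_simp

theorem sub_my (hp : p.Standing) : (p.sub k).my = p.ratio k * p.my := hp.hssEta_eq

theorem sub_mx (hp : p.Standing) : (p.sub k).mx = p.ratio k * p.mx := by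
  have := hp.my_pos
  change p.hssEta k * p.hssAlpha = _
  rw [hp.hssEta_eq, hssAlpha]
  field_simp

theorem sub_Lx (hp : p.Standing) (hk : 1 ≤ k) :
    (p.sub k).Lx = p.ratio k * p.my + p.Lx / p.ratio k := by
  have := hp.my_pos
  have hr : 0 < p.ratio k := by linarith [hp.one_lt_ratio hk]
  change p.hssEta k * (1 + p.hssBeta k * p.Lx) = _
  rw [hp.hssEta_eq, hp.hssBeta_eq hk]
  field_simp

/-- The inequality that needs `2 ≤ k` is `m_y' = r m_y < L_xy`, which follows from `r² ≤ L_xy/m_y`.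
-/
theorem sub (hp : p.Standing) (hk : 2 ≤ k) : (p.sub k).Standing := by
  have h1 := hp.one_lt_ratio (by omega : 1 ≤ k)
  have hr : 0 < p.ratio k := by linarith
  have e : (p.sub k).Ly = (p.sub k).Lx := by
    change p.hssEta k * (1 + p.hssBeta k * p.Ly) = p.hssEta k * (1 + p.hssBeta k * p.Lx)
    rw [hp.Lx_eq_Ly]
  refine ⟨?_, ?_, ?_, ?_, e.symm⟩
  · rw [hp.sub_mx]; exact mul_pos hr hp.mx_pos
  · rw [hp.sub_mx, hp.sub_my]; exact mul_lt_mul_of_pos_left hp.mx_lt_my hr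
  · rw [hp.sub_my]; exact hp.ratio_mul_my_lt hk
  · rw [e, hp.sub_my, hp.sub_Lx (by omega)]
    linarith [div_pos hp.Lx_pos hr]

/-- Since `m_y` is multiplied by the ratio `r`, the quotient `L_xy/m_y = r^(k+1)` drops to `r^k`,
and one root fewer is taken of it. So all levels of the recursion have the same contraction rate. -/
theorem ratio_sub (hp : p.Standing) (hk : 1 ≤ k) :
    (p.sub (k + 1)).ratio k = p.ratio (k + 1) := by
  have hr : 0 < p.ratio (k + 1) := by linarith [hp.one_lt_ratio (by omega : 1 ≤ k + 1)]
  have hmy := hp.my_pos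
  have h : (p.sub (k + 1)).Lxy / (p.sub (k + 1)).my = p.ratio (k + 1) ^ k := by
    rw [hp.sub_my, mul_comm, ← div_div]
    change p.Lxy / p.my / _ = _
    rw [← hp.ratio_pow (by omega : 1 ≤ k + 1), pow_succ, mul_div_assoc, div_self hr.ne', mul_one]
  nth_rw 1 [ratio]
  rw [h, one_div, Real.pow_rpow_inv_natCast hr.le (by omega)]

theorem sub_L_le (hp : p.Standing) (hk : 2 ≤ k) : (p.sub k).L ≤ 2 * p.L := by
  have h1 := hp.one_lt_ratio (by omega : 1 ≤ k)
  have h2 := hp.ratio_mul_my_lt hk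
  have h3 : p.Lx / p.ratio k ≤ p.Lx := div_le_self hp.Lx_pos.le h1.le
  have h4 := hp.Lx_le_L
  have h5 := hp.Lxy_le_L
  have h6 : (p.sub k).Lx ≤ 2 * p.L := by rw [hp.sub_Lx (by omega)]; linarith
  refine max_le h6 (max_le ?_ ?_)
  · change p.Lxy ≤ _
    linarith [hp.L_pos]
  · rw [← (hp.sub hk).Lx_eq_Ly]; exact h6

/-- The condition number may grow, but by at most `4` per level, so its logarithm grows by at most
`2`. -/
theorem cond_sub_le (hp : p.Standing) (hk : 2 ≤ k) : (p.sub k).cond ≤ 4 * p.cond := by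
  have h1 := hp.one_lt_ratio (by omega : 1 ≤ k)
  have hmx := hp.mx_pos
  have hmy := hp.my_pos
  have hL := hp.sub_L_le hk
  have hL0 := (hp.sub hk).L_pos
  unfold cond
  rw [hp.sub_mx, hp.sub_my]
  calc (p.sub k).L ^ 2 / (p.ratio k * p.mx * (p.ratio k * p.my))
      ≤ (2 * p.L) ^ 2 / (1 * p.mx * (1 * p.my)) := by gcongr
    _ = _ := by ring

theorem sqrt_Lxy_div_mx_le (hp : p.Standing) : √(p.Lxy / p.mx) ≤ p.Lxy / √(p.mx * p.my) := by
  have hmx := hp.mx_pos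
  have hmy := hp.my_pos
  have hLxy := hp.Lxy_pos
  rw [Real.sqrt_le_iff]
  refine ⟨by positivity, ?_⟩
  rw [div_pow, Real.sq_sqrt (by positivity), div_le_div_iff₀ hmx (by positivity)]
  have := hp.my_lt_Lxy
  nlinarith [mul_pos hLxy hmx]

/-- The decisive inequality: the `r` iterations of a level are compensated by the smaller scale of
the subproblem. The first summand is exactly invariant. In the second, `r² m_y ≤ L_xy` bounds the
new part by `L_xy/m_x`, whose root is again below the first summand. -/
theorem ratio_mul_scale_sub_le (hp : p.Standing) (hk : 2 ≤ k) :
    p.ratio k * (p.sub k).scale ≤ 2 * p.scale := by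
  have h1 := hp.one_lt_ratio (by omega : 1 ≤ k)
  have hr : 0 < p.ratio k := by linarith
  have hmx := hp.mx_pos
  have hmy := hp.my_pos
  have hLx := hp.Lx_pos
  unfold scale
  rw [hp.sub_mx, hp.sub_my, hp.sub_Lx (by omega), mul_add]
  have e1 : p.ratio k * ((p.sub k).Lxy / √(p.ratio k * p.mx * (p.ratio k * p.my))) =
      p.Lxy / √(p.mx * p.my) := by
    change p.ratio k * (p.Lxy / _) = _
    rw [show p.ratio k * p.mx * (p.ratio k * p.my) = p.ratio k ^ 2 * (p.mx * p.my) by ring,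
      Real.sqrt_mul (by positivity), Real.sqrt_sq hr.le]
    field_simp
  have e2 : p.ratio k * √((p.ratio k * p.my + p.Lx / p.ratio k) / (p.ratio k * p.mx)) ≤
      √(p.Lxy / p.mx) + √(p.Lx / p.mx) := by
    nth_rw 1 [← Real.sqrt_sq hr.le]
    rw [← Real.sqrt_mul (by positivity)]
    have hLxy := hp.Lxy_pos
    rw [Real.sqrt_le_left (by positivity), add_sq, Real.sq_sqrt (by positivity),
      Real.sq_sqrt (by positivity)]
    have h0 : 0 ≤ 2 * √(p.Lxy / p.mx) * √(p.Lx / p.mx) := by positivity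
    have h2 : p.ratio k ^ 2 * p.my / p.mx ≤ p.Lxy / p.mx := by
      gcongr
      exact hp.ratio_sq_mul_my_le hk
    rw [show p.ratio k ^ 2 * ((p.ratio k * p.my + p.Lx / p.ratio k) / (p.ratio k * p.mx)) =
        p.ratio k ^ 2 * p.my / p.mx + p.Lx / p.mx by field_simp]
    linarith
  rw [e1]
  linarith [hp.sqrt_Lxy_div_mx_le, Real.sqrt_nonneg (p.Lx / p.mx)]

end Standing

end Params

/-! ### Block operators on pairs and the splitting of `J`. -/

section Block

open scoped InnerProductSpace

variable {n m : ℕ}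

theorem inner_ZSpace (z w : ZSpace n m) : ⟪z, w⟫_ℝ = ⟪z.fst, w.fst⟫_ℝ + ⟪z.snd, w.snd⟫_ℝ :=
  WithLp.prod_inner_apply z w

/-- The block diagonal operator `diag(M, N)`. -/
noncomputable def blockDiag (M : EuclideanSpace ℝ (Fin n) →ₗ[ℝ] EuclideanSpace ℝ (Fin n))
    (N : EuclideanSpace ℝ (Fin m) →ₗ[ℝ] EuclideanSpace ℝ (Fin m)) :
    ZSpace n m →ₗ[ℝ] ZSpace n m where
  toFun z := mkZ (M z.fst) (N z.snd)
  map_add' z w := by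
    rw [WithLp.add_fst, WithLp.add_snd, map_add, map_add]; rfl
  map_smul' c z := by
    rw [WithLp.smul_fst, WithLp.smul_snd, map_smul, map_smul]; rfl

/-- The operator `[0, B; -Bt, 0]`. -/
noncomputable def blockSkew (B : EuclideanSpace ℝ (Fin m) →ₗ[ℝ] EuclideanSpace ℝ (Fin n))
    (Bt : EuclideanSpace ℝ (Fin n) →ₗ[ℝ] EuclideanSpace ℝ (Fin m)) :
    ZSpace n m →ₗ[ℝ] ZSpace n m where
  toFun z := mkZ (B z.snd) (-(Bt z.fst))
  map_add' z w := by
    rw [WithLp.add_fst, WithLp.add_snd, map_add, map_add, neg_add]; rfl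
  map_smul' c z := by
    rw [WithLp.smul_fst, WithLp.smul_snd, map_smul, map_smul, ← smul_neg]; rfl

theorem inner_blockDiag (M : EuclideanSpace ℝ (Fin n) →ₗ[ℝ] EuclideanSpace ℝ (Fin n))
    (N : EuclideanSpace ℝ (Fin m) →ₗ[ℝ] EuclideanSpace ℝ (Fin m)) (z : ZSpace n m) :
    ⟪z, blockDiag M N z⟫_ℝ = ⟪z.fst, M z.fst⟫_ℝ + ⟪z.snd, N z.snd⟫_ℝ := inner_ZSpace _ _

theorem HasBounds.blockDiag {M : EuclideanSpace ℝ (Fin n) →ₗ[ℝ] EuclideanSpace ℝ (Fin n)}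
    {N : EuclideanSpace ℝ (Fin m) →ₗ[ℝ] EuclideanSpace ℝ (Fin m)} {μ l : ℝ}
    (hM : HasBounds M μ l) (hN : HasBounds N μ l) : HasBounds (blockDiag M N) μ l where
  symm z w := by
    rw [inner_ZSpace, inner_ZSpace]
    exact congrArg₂ (· + ·) (hM.symm _ _) (hN.symm _ _)
  lower z := by
    rw [inner_blockDiag, norm_ZSpace_sq, mul_add]
    exact add_le_add (hM.lower _) (hN.lower _)
  upper z := by
    rw [inner_blockDiag, norm_ZSpace_sq, mul_add]
    exact add_le_add (hM.upper _) (hN.upper _)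

theorem HasBounds.add {E : Type*} [NormedAddCommGroup E] [InnerProductSpace ℝ E]
    {K K' : E →ₗ[ℝ] E} {μ l μ' l' : ℝ} (h : HasBounds K μ l) (h' : HasBounds K' μ' l') :
    HasBounds (K + K') (μ + μ') (l + l') where
  symm x y := by
    rw [LinearMap.add_apply, LinearMap.add_apply, inner_add_left, inner_add_right, h.symm, h'.symm]
  lower x := by
    rw [LinearMap.add_apply, inner_add_right, add_mul]
    exact add_le_add (h.lower x) (h'.lower x)
  upper x := by
    rw [LinearMap.add_apply, inner_add_right, add_mul]
    exact add_le_add (h.upper x) (h'.upper x)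

theorem inner_blockSkew {B : EuclideanSpace ℝ (Fin m) →ₗ[ℝ] EuclideanSpace ℝ (Fin n)}
    {Bt : EuclideanSpace ℝ (Fin n) →ₗ[ℝ] EuclideanSpace ℝ (Fin m)} {c : ℝ}
    (h : IsCoupling B Bt c) (z : ZSpace n m) : ⟪z, blockSkew B Bt z⟫_ℝ = 0 := by
  rw [inner_ZSpace]
  change ⟪z.fst, B z.snd⟫_ℝ + ⟪z.snd, -(Bt z.fst)⟫_ℝ = 0
  rw [inner_neg_right, ← h.adjoint, real_inner_comm]
  ring

end Block

namespace QuadProblem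

open scoped InnerProductSpace

variable {n m : ℕ}

/-- The symmetric part `G = diag(A, C)` of `J`. -/
noncomputable def symmPart (P : QuadProblem n m) : ZSpace n m →ₗ[ℝ] ZSpace n m :=
  blockDiag (Matrix.toEuclideanLin P.A) (Matrix.toEuclideanLin P.C)

/-- The skew part `S = J - G` of `J`. -/
noncomputable def skewPart (P : QuadProblem n m) : ZSpace n m →ₗ[ℝ] ZSpace n m :=
  blockSkew (Matrix.toEuclideanLin P.B) (Matrix.toEuclideanLin P.B.transpose)

/-- The preconditioner `diag(αI + βA, I + βC)`. -/
noncomputable def precond (P : QuadProblem n m) (p : Params) (k : ℕ) :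
    ZSpace n m →ₗ[ℝ] ZSpace n m :=
  blockDiag (p.hssBeta k • Matrix.toEuclideanLin P.A + p.hssAlpha • LinearMap.id)
    (p.hssBeta k • Matrix.toEuclideanLin P.C + (1 : ℝ) • LinearMap.id)

/-- The right hand side `b = [-u; v]`. -/
noncomputable def rhs (P : QuadProblem n m) : ZSpace n m := mkZ (-P.u) P.v

theorem residual_eq_norm_sub (P : QuadProblem n m) (z : ZSpace n m) :
    P.residual z = ‖P.symmPart z + P.skewPart z - P.rhs‖ := by
  rw [norm_ZSpace_eq_pairNorm, residual, ← pairNorm_neg_right]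
  congr 1
  · change _ = Matrix.toEuclideanLin P.A z.fst + Matrix.toEuclideanLin P.B z.snd - -P.u
    abel
  · change _ = Matrix.toEuclideanLin P.C z.snd + -Matrix.toEuclideanLin P.B.transpose z.fst - P.v
    abel

theorem IsStationary.apply_eq {P : QuadProblem n m} {xs : EuclideanSpace ℝ (Fin n)}
    {ys : EuclideanSpace ℝ (Fin m)} (h : P.IsStationary xs ys) :
    P.symmPart (mkZ xs ys) + P.skewPart (mkZ xs ys) = P.rhs := by
  have h1 := h.fst_eq
  have h2 := h.snd_eq
  change mkZ (Matrix.toEuclideanLin P.A xs + Matrix.toEuclideanLin P.B ys)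
    (Matrix.toEuclideanLin P.C ys + -Matrix.toEuclideanLin P.B.transpose xs) = mkZ (-P.u) P.v
  congr 1
  · exact eq_neg_of_add_eq_zero_left h1
  · rw [eq_comm, ← sub_eq_zero, ← h2]
    abel

theorem IsStationary.residual_eq_norm {P : QuadProblem n m} {xs : EuclideanSpace ℝ (Fin n)}
    {ys : EuclideanSpace ℝ (Fin m)} (h : P.IsStationary xs ys) (z : ZSpace n m) :
    P.residual z = ‖P.symmPart (z - mkZ xs ys) + P.skewPart (z - mkZ xs ys)‖ := by
  rw [residual_eq_norm_sub, ← h.apply_eq, map_sub, map_sub]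
  congr 1
  abel

theorem precond_apply (P : QuadProblem n m) (p : Params) (k : ℕ) (z : ZSpace n m) :
    P.precond p k z =
      mkZ (p.hssAlpha • z.fst + p.hssBeta k • Matrix.toEuclideanLin P.A z.fst)
        (z.snd + p.hssBeta k • Matrix.toEuclideanLin P.C z.snd) := by
  change mkZ (p.hssBeta k • Matrix.toEuclideanLin P.A z.fst + p.hssAlpha • z.fst)
    (p.hssBeta k • Matrix.toEuclideanLin P.C z.snd + (1 : ℝ) • z.snd) = _
  rw [one_smul, add_comm, add_comm z.snd]

theorem toEuclideanLin_one_apply {d : ℕ} (x : EuclideanSpace ℝ (Fin d)) :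
    Matrix.toEuclideanLin (1 : Matrix (Fin d) (Fin d) ℝ) x = x := by
  rw [Matrix.toLpLin_apply, Matrix.one_mulVec]

theorem sub_toEuclideanLin_A (P : QuadProblem n m) (p : Params) (k : ℕ) (w : ZSpace n m) :
    Matrix.toEuclideanLin (P.sub p k w).A =
      p.hssEta k • (p.hssBeta k • Matrix.toEuclideanLin P.A + p.hssAlpha • LinearMap.id) := by
  ext1 x
  change Matrix.toEuclideanLin (p.hssEta k • (p.hssAlpha • (1 : Matrix (Fin n) (Fin n) ℝ) +
    p.hssBeta k • P.A)) x = _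
  rw [map_smul, map_add, map_smul, map_smul]
  simp only [LinearMap.smul_apply, LinearMap.add_apply, toEuclideanLin_one_apply, LinearMap.id_apply]
  rw [add_comm]

theorem sub_toEuclideanLin_C (P : QuadProblem n m) (p : Params) (k : ℕ) (w : ZSpace n m) :
    Matrix.toEuclideanLin (P.sub p k w).C =
      p.hssEta k • (p.hssBeta k • Matrix.toEuclideanLin P.C + (1 : ℝ) • LinearMap.id) := by
  ext1 x
  change Matrix.toEuclideanLin (p.hssEta k • ((1 : Matrix (Fin m) (Fin m) ℝ) +
    p.hssBeta k • P.C)) x = _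
  rw [map_smul, map_add, map_smul]
  simp only [LinearMap.smul_apply, LinearMap.add_apply, toEuclideanLin_one_apply, LinearMap.id_apply,
    one_smul]
  rw [add_comm]

theorem residual_sub (P : QuadProblem n m) (p : Params) (k : ℕ) (w z : ZSpace n m) :
    (P.sub p k w).residual z = ‖p.hssEta k • P.precond p k z + P.skewPart z - w‖ := by
  rw [residual_eq_norm_sub, symmPart, sub_toEuclideanLin_A, sub_toEuclideanLin_C]
  congr 2
  · change mkZ (- -w.fst) w.snd = w
    rw [neg_neg]
    rfl

end QuadProblem

namespace QuadProblem

open scoped InnerProductSpace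

variable {n m : ℕ}

theorem OpBounds.boundsG {P : QuadProblem n m} {p : Params} (hp : p.Standing) (hP : P.OpBounds p) :
    HasBounds P.symmPart p.mx p.Lx :=
  hP.boundsA.blockDiag (hP.boundsC.mono hp.mx_lt_my.le hp.Lx_eq_Ly.ge)

theorem OpBounds.boundsPrecond {P : QuadProblem n m} {p : Params} {k : ℕ} (hp : p.Standing)
    (hk : 1 ≤ k) (hP : P.OpBounds p) :
    HasBounds (P.precond p k) p.hssAlpha (1 + p.hssBeta k * p.Lx) := by
  have hmx := hp.mx_pos
  have hmy := hp.my_pos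
  have hα1 : p.hssAlpha ≤ 1 := (div_le_one hmy).2 hp.mx_lt_my.le
  have hβ : 0 ≤ p.hssBeta k := by
    have := hp.one_lt_ratio hk
    rw [hp.hssBeta_eq hk]
    positivity
  refine HasBounds.blockDiag (((hP.boundsA.smul hβ).add_smul_id _).mono ?_ ?_)
    (((hP.boundsC.smul hβ).add_smul_id _).mono ?_ ?_)
  · exact le_add_of_nonneg_left (mul_nonneg hβ hmx.le)
  · linarith
  · exact hα1.trans (le_add_of_nonneg_left (mul_nonneg hβ hmy.le))
  · rw [hp.Lx_eq_Ly, add_comm]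

/-- The choice of parameters gives `r η β = 1`, so `β G` inside `P` already yields `G ≼ r η P`. For
the other direction `η² β = η/r` and `η² = η r m_y`, and `m_y diag(αI, I) = diag(m_x I, m_y I) ≼ G`.
-/
theorem OpBounds.exists_hssData {P : QuadProblem n m} {p : Params} {k : ℕ} (hp : p.Standing)
    (hk : 1 ≤ k) (hP : P.OpBounds p) :
    ∃ Pi, HssData (P.precond p k) Pi P.symmPart P.skewPart p.hssAlpha (1 + p.hssBeta k * p.Lx)
      (p.hssEta k) (p.ratio k) := by
  have hmx := hp.mx_pos
  have hmy := hp.my_pos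
  have hα : 0 < p.hssAlpha := div_pos hmx hmy
  have hr1 := hp.one_lt_ratio hk
  have hr : 0 < p.ratio k := by linarith
  have hη : 0 < p.hssEta k := by rw [hp.hssEta_eq]; positivity
  obtain ⟨Pi, h1, h2, h3, -, h5⟩ := (hP.boundsPrecond hp hk).exists_inverse hα
  have hinner : ∀ x : ZSpace n m, ⟪x, P.precond p k x⟫_ℝ =
      p.hssBeta k * ⟪x, P.symmPart x⟫_ℝ + (p.hssAlpha * ‖x.fst‖ ^ 2 + ‖x.snd‖ ^ 2) := by
    intro x
    rw [precond, symmPart, inner_blockDiag, inner_blockDiag]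
    simp only [LinearMap.add_apply, LinearMap.smul_apply, LinearMap.id_apply, inner_add_right,
      real_inner_smul_right, real_inner_self_eq_norm_sq]
    ring
  refine ⟨Pi, hP.boundsPrecond hp hk, hα, h1, h2, h3, h5, (hP.boundsG hp).symm,
    (hP.boundsG hp).inner_nonneg hmx.le, inner_blockSkew hP.coupling, hη, hr1.le, fun x => ?_,
    fun x => ?_⟩
  · have h0 : 0 ≤ p.ratio k * p.hssEta k * (p.hssAlpha * ‖x.fst‖ ^ 2 + ‖x.snd‖ ^ 2) := by positivity
    have e : p.ratio k * p.hssEta k * p.hssBeta k = 1 := by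
      rw [hp.hssEta_eq, hp.hssBeta_eq hk]; field_simp
    rw [hinner, mul_add, ← mul_assoc, e, one_mul]
    linarith
  · have e : p.hssEta k ^ 2 * p.hssBeta k = p.hssEta k / p.ratio k := by
      rw [hp.hssEta_eq, hp.hssBeta_eq hk]; field_simp
    have e2 : p.hssEta k ^ 2 = p.hssEta k * p.ratio k * p.my := by rw [hp.hssEta_eq]; ring
    have h6 : p.my * (p.hssAlpha * ‖x.fst‖ ^ 2 + ‖x.snd‖ ^ 2) ≤ ⟪x, P.symmPart x⟫_ℝ := by
      have a1 := hP.boundsA.lower x.fst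
      have a2 := hP.boundsC.lower x.snd
      have e3 : p.my * p.hssAlpha = p.mx := by rw [Params.hssAlpha]; field_simp
      rw [symmPart, inner_blockDiag, mul_add, ← mul_assoc, e3]
      exact add_le_add a1 a2
    rw [hinner, mul_add, ← mul_assoc, e, e2]
    have h7 := mul_le_mul_of_nonneg_left h6 (mul_pos hη hr).le
    linarith

theorem OpBounds.sub {P : QuadProblem n m} {p : Params} {k : ℕ} (hp : p.Standing)
    (hk : 1 ≤ k) (hP : P.OpBounds p) (w : ZSpace n m) : (P.sub p k w).OpBounds (p.sub k) := by
  have hmx := hp.mx_pos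
  have hmy := hp.my_pos
  have hr1 := hp.one_lt_ratio hk
  have hη : 0 < p.hssEta k := by rw [hp.hssEta_eq]; positivity
  have hβ : 0 ≤ p.hssBeta k := by rw [hp.hssBeta_eq hk]; positivity
  refine ⟨?_, ?_, hP.coupling⟩
  · rw [sub_toEuclideanLin_A]
    refine (((hP.boundsA.smul hβ).add_smul_id _).mono ?_ ?_).smul hη.le
    · exact le_add_of_nonneg_left (mul_nonneg hβ hmx.le)
    · rw [add_comm]
      gcongr
      exact (div_le_one hmy).2 hp.mx_lt_my.le
  · rw [sub_toEuclideanLin_C]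
    have := (((hP.boundsC.smul hβ).add_smul_id 1).mono
      (le_add_of_nonneg_left (mul_nonneg hβ hmy.le)) (add_comm _ _).le).smul hη.le
    rwa [mul_one] at this

/-- The subproblems of the recursion come without a given saddle point. On the kernel of `J` the
skew part drops out of `⟪z, J z⟫` and positivity of `G` forces `z = 0`. -/
theorem OpBounds.exists_isStationary {P : QuadProblem n m} {p : Params} (hp : p.Standing)
    (hP : P.OpBounds p) : ∃ xs ys, P.IsStationary xs ys := by
  have hinj : Function.Injective ⇑(P.symmPart + P.skewPart) := by
    refine (injective_iff_map_eq_zero _).2 fun z hz => ?_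
    have h1 := (hP.boundsG hp).lower z
    have h2 : ⟪z, P.symmPart z⟫_ℝ = 0 := by
      have h3 := congrArg (fun y => ⟪z, y⟫_ℝ) hz
      simp only [LinearMap.add_apply, inner_add_right, inner_zero_right] at h3
      have h4 : ⟪z, P.skewPart z⟫_ℝ = 0 := inner_blockSkew hP.coupling z
      linarith
    rw [h2] at h1
    have h5 : ‖z‖ ^ 2 = 0 := by nlinarith [hp.mx_pos, sq_nonneg ‖z‖]
    simpa using h5
  obtain ⟨z, hz⟩ := LinearMap.surjective_of_injective hinj P.rhs
  have h1 : Matrix.toEuclideanLin P.A z.fst + Matrix.toEuclideanLin P.B z.snd = -P.u :=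
    congrArg WithLp.fst hz
  have h2 : Matrix.toEuclideanLin P.C z.snd + -Matrix.toEuclideanLin P.B.transpose z.fst = P.v :=
    congrArg WithLp.snd hz
  refine ⟨z.fst, z.snd, ?_, ?_⟩
  · rw [h1]; abel
  · rw [← h2]; abel

end QuadProblem

/-! ### Precisions and step counts within one iteration. -/

namespace Params.Standing

variable {p : Params} {k : ℕ} {X : ℝ}

theorem hssAlpha_pos (hp : p.Standing) : 0 < p.hssAlpha := div_pos hp.mx_pos hp.my_pos

theorem hssEta_pos (hp : p.Standing) (hk : 1 ≤ k) : 0 < p.hssEta k := by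
  rw [hp.hssEta_eq]
  exact mul_pos (by linarith [hp.one_lt_ratio hk]) hp.my_pos

/-- The loss from changing norms is thus governed by the parameters of the subproblem, which lets it
cancel against the factor `m_x'` in the tolerance of the recursive call. -/
theorem sub_cond_precond (hp : p.Standing) (hk : 1 ≤ k) :
    (1 + p.hssBeta k * p.Lx) / p.hssAlpha = (p.sub k).Lx / (p.sub k).mx :=
  (mul_div_mul_left _ _ (hp.hssEta_pos hk).ne').symm

theorem sub_Lx_div_mx_le (hp : p.Standing) (hk : 1 ≤ k) :
    (p.sub k).Lx / (p.sub k).mx ≤ 2 * (p.L / p.mx) := by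
  have hmx := hp.mx_pos
  have hmy := hp.my_pos
  have h1 := hp.one_lt_ratio hk
  have hr : 0 < p.ratio k := by linarith
  rw [hp.sub_Lx hk, hp.sub_mx, ← mul_div_assoc, div_le_div_iff₀ (by positivity) hmx]
  have h2 : p.Lx / p.ratio k ≤ p.L :=
    (div_le_self hp.Lx_pos.le h1.le).trans hp.Lx_le_L
  have h3 : p.my ≤ p.L := hp.my_lt_Lxy.le.trans hp.Lxy_le_L
  have h4 : p.Lx / p.ratio k ≤ p.ratio k * p.L := h2.trans (le_mul_of_one_le_left hp.L_pos.le h1.le)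
  have h5 : p.ratio k * p.my ≤ p.ratio k * p.L := by gcongr
  calc (p.ratio k * p.my + p.Lx / p.ratio k) * p.mx
      ≤ (p.ratio k * p.L + p.ratio k * p.L) * p.mx := by gcongr
    _ = _ := by ring

theorem ratio_sq_le_L_div_my (hp : p.Standing) (hk : 2 ≤ k) : p.ratio k ^ 2 ≤ p.L / p.my :=
  (hp.ratio_sq_le hk).trans hp.Lxy_div_my_le

theorem cgPrecision_eq (hp : p.Standing) :
    1 / (192 * p.L ^ 5 / (p.mx ^ 2 * p.my ^ 3)) = 1 / (192 * (p.L / p.mx) ^ 2 * (p.L / p.my) ^ 3) := by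
  have hmx := hp.mx_pos
  have hmy := hp.my_pos
  congr 1
  field_simp

theorem cgPrecision_small (hp : p.Standing) (hk : 2 ≤ k) :
    √((1 + p.hssBeta k * p.Lx) / p.hssAlpha) * (1 / (192 * p.L ^ 5 / (p.mx ^ 2 * p.my ^ 3))) *
      (3 * p.ratio k) ≤ 1 / (30 * p.ratio k) := by
  have ha := hp.one_le_L_div_mx
  have hb := hp.one_le_L_div_my
  have h1 := hp.one_lt_ratio (by omega : 1 ≤ k)
  have hr : 0 < p.ratio k := by linarith
  have hs : √((1 + p.hssBeta k * p.Lx) / p.hssAlpha) ≤ 2 * (p.L / p.mx) := by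
    rw [hp.sub_cond_precond (by omega)]
    exact (Real.sqrt_le_sqrt (hp.sub_Lx_div_mx_le (by omega))).trans
      (sqrt_le_self_of_one_le (by linarith))
  have hr2 := hp.ratio_sq_le_L_div_my hk
  rw [hp.cgPrecision_eq, le_div_iff₀ (by positivity)]
  set a := p.L / p.mx
  set b := p.L / p.my
  set r := p.ratio k
  calc _ = √((1 + p.hssBeta k * p.Lx) / p.hssAlpha) * (90 * r ^ 2) / (192 * a ^ 2 * b ^ 3) := by ring
    _ ≤ 2 * a * (90 * b) / (192 * a ^ 2 * b ^ 3) := by gcongr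
    _ ≤ 1 := by
      rw [div_le_one (by positivity)]
      have e1 : a * b ≤ a ^ 2 * b ^ 3 := by
        have : 1 ≤ a * b ^ 2 := one_le_mul_of_one_le_of_one_le ha (one_le_pow₀ hb)
        calc a * b ≤ a * b * (a * b ^ 2) := le_mul_of_one_le_right (by positivity) this
          _ = _ := by ring
      nlinarith

theorem subPrecision_small (hp : p.Standing) (hk : 2 ≤ k) :
    √((1 + p.hssBeta k * p.Lx) / p.hssAlpha) * (p.sub k).tol (1 / (16 * p.Lxy / p.my)) ≤
      1 / (16 * p.ratio k) := by
  have hp' := hp.sub hk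
  have hmx' := hp'.mx_pos
  have hLx' := hp'.Lx_pos
  have hLxy := hp.Lxy_pos
  have hmy := hp.my_pos
  have h1 := hp.one_lt_ratio (by omega : 1 ≤ k)
  have hr : 0 < p.ratio k := by linarith
  have hq : 1 ≤ (p.sub k).Lx / (p.sub k).mx :=
    (one_le_div hmx').2 (hp'.mx_lt_my.le.trans hp'.my_le_Lx)
  rw [hp.sub_cond_precond (by omega), tol]
  change _ * ((p.sub k).mx * _ / (p.Lxy + (p.sub k).Lx)) ≤ _
  calc _ ≤ (p.sub k).Lx / (p.sub k).mx *
        ((p.sub k).mx * (1 / (16 * p.Lxy / p.my)) / (p.Lxy + (p.sub k).Lx)) := by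
        gcongr
        exact sqrt_le_self_of_one_le hq
    _ = (p.sub k).Lx / (p.Lxy + (p.sub k).Lx) * (1 / (16 * (p.Lxy / p.my))) := by field_simp
    _ ≤ 1 * (1 / (16 * p.ratio k)) := by
        gcongr
        · rw [div_le_one (by positivity)]; linarith
        · have := hp.ratio_sq_le hk
          nlinarith
    _ = _ := one_mul _

theorem one_le_scale (hp : p.Standing) : 1 ≤ p.scale :=
  (Real.one_le_sqrt.2 hp.one_le_L_div_mx).trans (sqrt_L_div_mx_le_scale hp)

/-- The number of conjugate gradient steps in an iteration of RHSS(k). -/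
theorem exists_cg_rounds (hp : p.Standing) (hk : 2 ≤ k) (hX : 1 + Real.log p.cond ≤ X) :
    ∃ (s : ℝ) (T : ℕ), 1 ≤ s ∧ 0 < T ∧
      (p.sub k).Lx + p.Lx = (p.sub k).mx * s ^ 2 ∧
      2 * s ^ 2 * (1 - 1 / s) ^ T ≤ (1 / (192 * p.L ^ 5 / (p.mx ^ 2 * p.my ^ 3))) ^ 2 ∧
      (T : ℝ) ≤ 52 * p.scale * X := by
  have hp' := hp.sub hk
  have hmx := hp.mx_pos
  have hmy := hp.my_pos
  have hmx' := hp'.mx_pos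
  have hLx := hp.Lx_pos
  have hLx' := hp'.Lx_pos
  have ha := hp.one_le_L_div_mx
  have hb := hp.one_le_L_div_my
  have hX1 := one_le_of_log_le hp hX
  have hr1 := hp.one_lt_ratio (by omega : 1 ≤ k)
  have hq0 : 1 ≤ (p.sub k).Lx / (p.sub k).mx :=
    (one_le_div hmx').2 (hp'.mx_lt_my.le.trans hp'.my_le_Lx)
  have hq1 := hp.sub_Lx_div_mx_le (by omega : 1 ≤ k)
  have hq2 : p.Lx / (p.sub k).mx ≤ p.L / p.mx := by
    rw [hp.sub_mx]
    exact div_le_div₀ hp.L_pos.le hp.Lx_le_L hmx (le_mul_of_one_le_left hmx.le hr1.le)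
  have hq2' : 0 < p.Lx / (p.sub k).mx := by positivity
  set q := ((p.sub k).Lx + p.Lx) / (p.sub k).mx with hq
  have hqle : q ≤ 3 * (p.L / p.mx) := by rw [hq, add_div]; linarith
  have hqge : 1 ≤ q := by rw [hq, add_div]; linarith
  have hs : 1 ≤ √q := Real.one_le_sqrt.2 hqge
  have hsq : √q ^ 2 = q := Real.sq_sqrt (by linarith)
  have hsle : √q ≤ 2 * p.scale := by
    calc √q ≤ √(2 ^ 2 * (p.L / p.mx)) := Real.sqrt_le_sqrt (by linarith)
      _ = 2 * √(p.L / p.mx) := by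
        rw [Real.sqrt_mul (by norm_num), Real.sqrt_sq (by norm_num)]
      _ ≤ 2 * p.scale := by linarith [sqrt_L_div_mx_le_scale hp]
  set M := 192 * (p.L / p.mx) ^ 2 * (p.L / p.my) ^ 3 with hM
  have hM0 : 0 < M := by positivity
  have hK : 2 * √q ^ 2 * M ^ 2 ≤ 221184 * p.cond ^ 6 := by
    rw [hsq, hM, hp.cond_eq]
    set a := p.L / p.mx
    set b := p.L / p.my
    calc 2 * q * (192 * a ^ 2 * b ^ 3) ^ 2 ≤ 2 * (3 * a) * (192 * a ^ 2 * b ^ 3) ^ 2 := by gcongr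
      _ = 221184 * (a ^ 5 * b ^ 6) := by ring
      _ ≤ 221184 * (a ^ 6 * b ^ 6) := by
        gcongr 221184 * (?_ * _)
        exact pow_le_pow_right₀ ha (by norm_num)
      _ = _ := by ring
  have hlog := log_le_mul (k := 13) hp hX (by positivity : 0 < 2 * √q ^ 2 * M ^ 2) (by norm_num) hK
    (by norm_num) (by norm_num)
  push_cast at hlog
  obtain ⟨T, h1, h2, h3⟩ := exists_rounds (q := 1 / √q) (H := 13 * X) (by positivity)
    ((div_le_one (by linarith)).2 hs) (by positivity) (by linarith) hlog
  refine ⟨√q, T, hs, h1, ?_, ?_, h3.trans ?_⟩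
  · rw [hsq, hq]; field_simp
  · rw [hp.cgPrecision_eq, ← hM, div_pow, one_pow, le_div_iff₀ (by positivity)]
    linarith
  · rw [div_div_eq_mul_div, div_one]
    calc 2 * √q * (13 * X) ≤ 2 * (2 * p.scale) * (13 * X) := by gcongr
      _ = _ := by ring

end Params.Standing

/-! ### One iteration of the recursive splitting. -/

section Step

variable {n m : ℕ} {p : Params} {P : QuadProblem n m} {k : ℕ} {X : ℝ}

theorem rhssStep_spec (hp : p.Standing) (hk : 2 ≤ k) (hX : 1 + Real.log p.cond ≤ X)
    (hP : P.OpBounds p) {xs : EuclideanSpace ℝ (Fin n)} {ys : EuclideanSpace ℝ (Fin m)}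
    (hst : P.IsStationary xs ys) {Pi : ZSpace n m →ₗ[ℝ] ZSpace n m}
    (hD : HssData (P.precond p k) Pi P.symmPart P.skewPart p.hssAlpha (1 + p.hssBeta k * p.Lx)
      (p.hssEta k) (p.ratio k))
    {solve : Params → QuadProblem n m → ℝ → ZSpace n m → Counted (ZSpace n m)} {c : ℝ}
    (z : ZSpace n m)
    (hsolve : ∀ w, (solve (p.sub k) (P.sub p k w) (1 / (16 * p.Lxy / p.my)) z).Spec c fun z' =>
      (P.sub p k w).residual z' ≤
        (p.sub k).tol (1 / (16 * p.Lxy / p.my)) * (P.sub p k w).residual z) :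
    (rhssStep solve k p P z).Spec (112 * p.scale * X + c) fun z' =>
      hssNorm Pi (p.hssEta k • P.precond p k (z' - mkZ xs ys) + P.skewPart (z' - mkZ xs ys)) ≤
        (1 - 1 / (6 * p.ratio k)) *
          hssNorm Pi (p.hssEta k • P.precond p k (z - mkZ xs ys) + P.skewPart (z - mkZ xs ys)) := by
  have hX1 := one_le_of_log_le hp hX
  have hη := hp.hssEta_pos (by omega : 1 ≤ k)
  have hL := hp.L_pos
  have hmx := hp.mx_pos
  have hmy := hp.my_pos
  obtain ⟨s, T, hs, hT, hsl, hTε, hTc⟩ := hp.exists_cg_rounds hk hX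
  set K := p.hssEta k • P.precond p k + P.symmPart with hK
  have hKb : HasBounds K (p.sub k).mx ((p.sub k).Lx + p.Lx) :=
    (((hP.boundsPrecond hp (by omega)).smul hη.le).add (hP.boundsG hp)).mono
      (le_add_of_nonneg_right hmx.le) le_rfl
  have hmx' := (hp.sub hk).mx_pos
  obtain ⟨Ki, hKi, -⟩ := hKb.exists_inverse hmx'
  have hmul : ∀ q : ZSpace n m, Counted.Spec (do
      let aq ← matVec P.A q.fst
      let cq ← matVec P.C q.snd
      pure (mkZ (p.hssEta k • (p.hssAlpha • q.fst + p.hssBeta k • aq) + aq)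
        (p.hssEta k • (q.snd + p.hssBeta k • cq) + cq)) : Counted (ZSpace n m)) 2 (· = K q) := by
    intro q
    refine ((matVec_spec P.A q.fst).bind fun a ha => Counted.Spec.bind_pure (matVec_spec P.C q.snd)
      fun b hb => ?_).mono (by norm_num) fun _ h => h
    rw [ha, hb, hK, LinearMap.add_apply, LinearMap.smul_apply, QuadProblem.precond_apply]
    rfl
  have hJ := hst.apply_eq
  set zs := mkZ xs ys with hzs
  -- Four products for the right-hand side, two for the initial residual and two for each conjugate
  -- gradient step, two for the second right-hand side, and the recursive call. With `T ≤ 52 * scale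
  -- * X` this is at most `(104 + 8) * scale * X + c`.
  have hcost : (1 : ℝ) + (1 + (1 + (1 + ((2 + T * 2) + (1 + (1 + c)))))) ≤
      112 * p.scale * X + c := by
    have : 1 ≤ p.scale * X := one_le_mul_of_one_le_of_one_le hp.one_le_scale hX1
    linarith
  refine Counted.Spec.mono ((matVec_spec P.A z.fst).bind ?_) hcost fun _ h => h
  rintro _ rfl
  refine (matVec_spec P.B z.snd).bind ?_
  rintro _ rfl
  refine (matVec_spec P.B.transpose z.fst).bind ?_
  rintro _ rfl
  refine (matVec_spec P.C z.snd).bind ?_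
  rintro _ rfl
  refine (conjGrad_spec (by norm_num) hmul hKb hmx' hs hsl _ z _ (hKi _)
    (by positivity) hT hTε).bind fun zh hzh => ?_
  refine (matVec_spec P.A zh.fst).bind ?_
  rintro _ rfl
  refine (matVec_spec P.C zh.snd).bind ?_
  rintro _ rfl
  refine (hsolve _).mono le_rfl fun z' hz' => ?_
  have er : mkZ (p.hssEta k • (p.hssAlpha • z.fst +
        p.hssBeta k • Matrix.toEuclideanLin P.A z.fst) - Matrix.toEuclideanLin P.B z.snd - P.u)
      (Matrix.toEuclideanLin P.B.transpose z.fst +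
        p.hssEta k • (z.snd + p.hssBeta k • Matrix.toEuclideanLin P.C z.snd) + P.v) =
      p.hssEta k • P.precond p k z - P.skewPart z + P.rhs := by
    rw [QuadProblem.precond_apply]
    change _ = mkZ (_ - Matrix.toEuclideanLin P.B z.snd + -P.u)
      (p.hssEta k • (z.snd + p.hssBeta k • Matrix.toEuclideanLin P.C z.snd) -
        -Matrix.toEuclideanLin P.B.transpose z.fst + P.v)
    rw [sub_neg_eq_add, add_comm (Matrix.toEuclideanLin P.B.transpose z.fst), ← sub_eq_add_neg]
    rfl
  have ew : mkZ (p.hssEta k • (p.hssAlpha • zh.fst +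
        p.hssBeta k • Matrix.toEuclideanLin P.A zh.fst) - Matrix.toEuclideanLin P.A zh.fst - P.u)
      (p.hssEta k • (zh.snd + p.hssBeta k • Matrix.toEuclideanLin P.C zh.snd) -
        Matrix.toEuclideanLin P.C zh.snd + P.v) =
      p.hssEta k • P.precond p k zh - P.symmPart zh + P.rhs := by
    rw [QuadProblem.precond_apply]
    change _ = mkZ (_ - Matrix.toEuclideanLin P.A zh.fst + -P.u) (_ - _ + _)
    rw [← sub_eq_add_neg]
    rfl
  rw [er] at hzh
  rw [ew, QuadProblem.residual_sub, QuadProblem.residual_sub] at hz'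
  have hp1 : 0 ≤ 1 + p.hssBeta k * p.Lx := by
    have := (hp.sub hk).Lx_pos
    exact (pos_of_mul_pos_right this hη.le).le
  have hδ₂ : 0 ≤ (p.sub k).tol (1 / (16 * p.Lxy / p.my)) := by
    have := (hp.sub hk).Lx_pos
    have := (hp.sub hk).Lxy_pos
    have := hp.Lxy_pos
    unfold Params.tol
    positivity
  refine hD.step hp1 (by positivity) hδ₂ (hp.cgPrecision_small hk) (hp.subPrecision_small hk)
    (e := z - zs) (c := zh - zs) (e' := z' - zs) ?_ ?_
  · have e1 : p.hssEta k • P.precond p k (zh - zs) + P.symmPart (zh - zs) -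
        (p.hssEta k • P.precond p k (z - zs) - P.skewPart (z - zs)) =
        -(p.hssEta k • P.precond p k z - P.skewPart z + P.rhs - K zh) := by
      rw [← hJ, hK, LinearMap.add_apply, LinearMap.smul_apply]
      simp only [map_sub]
      module
    -- Conjugate gradients start at `z`, where the residual of the half-step system is `-J e`.
    have e2 : P.symmPart (z - zs) + P.skewPart (z - zs) =
        -(p.hssEta k • P.precond p k z - P.skewPart z + P.rhs - K z) := by
      rw [← hJ, hK, LinearMap.add_apply, LinearMap.smul_apply]
      simp only [map_sub]
      module
    rw [e1, e2, norm_neg, norm_neg]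
    exact hzh
  · have e1 : ∀ y : ZSpace n m, p.hssEta k • P.precond p k (y - zs) + P.skewPart (y - zs) -
        (p.hssEta k • P.precond p k (zh - zs) - P.symmPart (zh - zs)) =
        p.hssEta k • P.precond p k y + P.skewPart y -
          (p.hssEta k • P.precond p k zh - P.symmPart zh + P.rhs) := by
      intro y
      rw [← hJ]
      simp only [map_sub]
      module
    rw [e1, e1]
    exact hz'

end Step

/-! ### The recursion over the depth. -/

section Recursion

open scoped InnerProductSpace

variable {n m : ℕ} {p : Params} {P : QuadProblem n m} {k : ℕ} {X : ℝ}

theorem QuadProblem.OpBounds.norm_shift_le (hp : p.Standing) (hk : 2 ≤ k) (hP : P.OpBounds p)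
    (e : ZSpace n m) :
    ‖p.hssEta k • P.precond p k e + P.skewPart e‖ ≤ ((p.sub k).Lx + p.Lxy) * ‖e‖ := by
  -- The norm in question is the residual of the subproblem with zero right-hand side, whose
  -- solution is the origin, so the general residual bound applies.
  have h0 : (P.sub p k 0).IsStationary 0 0 := by
    constructor
    · rw [map_zero, map_zero]
      change (0 : EuclideanSpace ℝ (Fin n)) + 0 + -0 = 0
      simp
    · rw [map_zero, map_zero]
      change (0 : EuclideanSpace ℝ (Fin m)) - 0 + 0 = 0
      simp
  have h := (hP.sub hp (by omega : 1 ≤ k) 0).residual_le (hp.sub hk) h0 e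
  rw [QuadProblem.residual_sub, sub_zero] at h
  have e0 : e - mkZ 0 0 = e := by
    have : (mkZ 0 0 : ZSpace n m) = 0 := rfl
    rw [this, sub_zero]
  rwa [e0] at h

theorem Params.Standing.ratio_le_L_div_my (hp : p.Standing) (hk : 2 ≤ k) :
    p.ratio k ≤ p.L / p.my := by
  have h1 := hp.one_lt_ratio (by omega : 1 ≤ k)
  refine le_trans ?_ (hp.ratio_sq_le_L_div_my hk)
  nlinarith

/-- The number of iterations of RHSS(k). -/
theorem Params.Standing.exists_hss_rounds (hp : p.Standing) (hk : 2 ≤ k)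
    (hX : 1 + Real.log p.cond ≤ X) {ε : ℝ} (hε : 0 < ε) :
    ∃ T : ℕ, 0 < T ∧
      √((1 + p.hssBeta k * p.Lx) / p.hssAlpha) * (3 * p.ratio k) *
        (1 - 1 / (6 * p.ratio k)) ^ T * ((p.sub k).Lx + p.Lxy) ≤ p.tol ε * p.mx ∧
      (T : ℝ) ≤ 60 * p.ratio k * (X * max 1 (Real.log (1 / ε))) := by
  have hmx := hp.mx_pos
  have hmy := hp.my_pos
  have hL := hp.L_pos
  have hLx := hp.Lx_pos
  have hLxy := hp.Lxy_pos
  have hLx' := (hp.sub hk).Lx_pos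
  have ha := hp.one_le_L_div_mx
  have hb := hp.one_le_L_div_my
  have hX1 := one_le_of_log_le hp hX
  have hκ1 := hp.one_le_cond
  have hr1 := hp.one_lt_ratio (by omega : 1 ≤ k)
  have hr : 0 < p.ratio k := by linarith
  have htol : 0 < p.tol ε := by unfold Params.tol; positivity
  have hα := hp.hssAlpha_pos
  have hp1 : 0 < 1 + p.hssBeta k * p.Lx :=
    pos_of_mul_pos_right hLx' (hp.hssEta_pos (by omega)).le
  have hs : √((1 + p.hssBeta k * p.Lx) / p.hssAlpha) ≤ 2 * (p.L / p.mx) := by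
    rw [hp.sub_cond_precond (by omega)]
    exact (Real.sqrt_le_sqrt (hp.sub_Lx_div_mx_le (by omega))).trans
      (sqrt_le_self_of_one_le (by linarith))
  set K := √((1 + p.hssBeta k * p.Lx) / p.hssAlpha) * (3 * p.ratio k) *
    ((p.sub k).Lx + p.Lxy) / (p.tol ε * p.mx) with hK
  have hKpos : 0 < K := by
    have : 0 < √((1 + p.hssBeta k * p.Lx) / p.hssAlpha) := Real.sqrt_pos.2 (div_pos hp1 hα)
    positivity
  have hKle : K ≤ 36 * p.cond ^ 3 * (1 / ε) := by
    have : K = √((1 + p.hssBeta k * p.Lx) / p.hssAlpha) * (3 * p.ratio k) *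
        (((p.sub k).Lx + p.Lxy) / p.mx) * ((p.Lx + p.Lxy) / p.mx) * (1 / ε) := by
      rw [hK, Params.tol]; field_simp; ring
    rw [this]
    refine mul_le_mul_of_nonneg_right ?_ (by positivity)
    have h1 : ((p.sub k).Lx + p.Lxy) / p.mx ≤ 3 * (p.L / p.mx) := by
      rw [← mul_div_assoc]
      exact div_le_div_of_nonneg_right
        (by linarith [hp.sub_L_le hk, (hp.sub hk).Lx_le_L, hp.Lxy_le_L]) hmx.le
    have h2 : (p.Lx + p.Lxy) / p.mx ≤ 2 * (p.L / p.mx) := by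
      rw [← mul_div_assoc]
      exact div_le_div_of_nonneg_right (by linarith [hp.Lx_le_L, hp.Lxy_le_L]) hmx.le
    have h3 := hp.ratio_le_L_div_my hk
    calc _ ≤ 2 * (p.L / p.mx) * (3 * (p.L / p.my)) * (3 * (p.L / p.mx)) * (2 * (p.L / p.mx)) := by
          gcongr
      _ = 36 * ((p.L / p.mx) ^ 3 * (p.L / p.my)) := by ring
      _ ≤ 36 * ((p.L / p.mx) ^ 3 * (p.L / p.my) ^ 3) := by
          gcongr 36 * (_ * ?_)
          exact le_self_pow₀ hb (by norm_num)
      _ = _ := by rw [hp.cond_eq]; ring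
  have hℓ : 1 ≤ max 1 (Real.log (1 / ε)) := le_max_left _ _
  have hlog : Real.log K ≤ 5 * (X * max 1 (Real.log (1 / ε))) := by
    have h1 := Real.log_le_log (by positivity) hKle
    rw [Real.log_mul (by positivity) (by positivity)] at h1
    have h2 := log_le_mul (K := 36 * p.cond ^ 3) (k := 4) hp hX (by positivity) (by norm_num)
      le_rfl (by norm_num) (by norm_num)
    push_cast at h2
    have h3 : Real.log (1 / ε) ≤ max 1 (Real.log (1 / ε)) := le_max_right _ _
    nlinarith
  obtain ⟨T, h1, h2, h3⟩ := exists_rounds (q := 1 / (6 * p.ratio k)) (K := K)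
    (H := 5 * (X * max 1 (Real.log (1 / ε)))) (by positivity)
    (by rw [div_le_one] <;> linarith) hKpos (by nlinarith) hlog
  refine ⟨T, h1, ?_, ?_⟩
  · rw [hK, div_mul_eq_mul_div, div_le_one (by positivity)] at h2
    linarith
  · refine h3.trans (le_of_eq ?_)
    rw [div_div_eq_mul_div]
    ring

/-- The iteration contracts `R`, while the test compares residuals. The residual is bounded above by
a multiple of `R` through `hssNorm_J_le`, and the initial `R` by a multiple of the initial residual.
The resulting constant is polynomial in `κ` and costs only a logarithmic number of further rounds.
-/
theorem rhss_succ_spec (hp : p.Standing) (hX : 1 + Real.log p.cond ≤ X)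
    (hP : P.OpBounds p) {xs : EuclideanSpace ℝ (Fin n)} {ys : EuclideanSpace ℝ (Fin m)}
    (hst : P.IsStationary xs ys) {ε c : ℝ} (hε : 0 < ε) (hc : 0 ≤ c)
    (hsolve : ∀ w z : ZSpace n m,
      (rhss (k + 1) (p.sub (k + 2)) (P.sub p (k + 2) w) (1 / (16 * p.Lxy / p.my)) z).Spec c fun z' =>
        (P.sub p (k + 2) w).residual z' ≤
          (p.sub (k + 2)).tol (1 / (16 * p.Lxy / p.my)) * (P.sub p (k + 2) w).residual z)
    (z₀ : ZSpace n m) :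
    (rhss (k + 2) p P ε z₀).Spec
      (4 + 60 * p.ratio (k + 2) * (X * max 1 (Real.log (1 / ε))) *
        (112 * p.scale * X + c + 4))
      fun z => P.residual z ≤ p.tol ε * P.residual z₀ := by
  have hk : 2 ≤ k + 2 := by omega
  have hX1 := one_le_of_log_le hp hX
  have hmx := hp.mx_pos
  have hsc := hp.one_le_scale
  have hr1 := hp.one_lt_ratio (by omega : 1 ≤ k + 2)
  have hr : 0 < p.ratio (k + 2) := by linarith
  have hα := hp.hssAlpha_pos
  have hLx' := (hp.sub hk).Lx_pos
  have hLxy := hp.Lxy_pos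
  have hp1 : 0 < 1 + p.hssBeta (k + 2) * p.Lx :=
    pos_of_mul_pos_right hLx' (hp.hssEta_pos (by omega)).le
  obtain ⟨T, hT, hTε, hTc⟩ := hp.exists_hss_rounds hk hX hε
  obtain ⟨Pi, hD⟩ := hP.exists_hssData hp (by omega : 1 ≤ k + 2)
  have hcost : 0 ≤ 112 * p.scale * X + c + 4 := by positivity
  have hq : 0 ≤ 1 - 1 / (6 * p.ratio (k + 2)) := by
    rw [sub_nonneg, div_le_one] <;> linarith
  set R : ZSpace n m → ℝ := fun e =>
    hssNorm Pi (p.hssEta (k + 2) • P.precond p (k + 2) e + P.skewPart e) with hR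
  have hR0 : √p.hssAlpha * R (z₀ - mkZ xs ys) * p.mx ≤
      ((p.sub (k + 2)).Lx + p.Lxy) * P.residual z₀ := by
    have h1 := (hD.sqrt_mul_hssNorm_le _).trans (hP.norm_shift_le hp hk (z₀ - mkZ xs ys))
    have h2 := hP.le_residual hp hst z₀
    calc _ ≤ ((p.sub (k + 2)).Lx + p.Lxy) * ‖z₀ - mkZ xs ys‖ * p.mx := by gcongr
      _ = ((p.sub (k + 2)).Lx + p.Lxy) * (p.mx * ‖z₀ - mkZ xs ys‖) := by ring
      _ ≤ _ := by gcongr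
  rw [rhss]
  refine Counted.Spec.mono (N := 4 + T * ((112 * p.scale * X + c) + 4))
    ((P.residualNorm_spec z₀).bind fun g₀ hg₀ => ?_) ?_ fun _ h => h
  swap
  · have := mul_le_mul_of_nonneg_right hTc hcost
    linarith
  subst hg₀
  refine Counted.Spec.mono (Counted.Spec.repeatUntil (c := 112 * p.scale * X + c) (c' := 4) (T := T)
    (fun t z => R (z - mkZ xs ys) ≤
      (1 - 1 / (6 * p.ratio (k + 2))) ^ t * R (z₀ - mkZ xs ys))
    (fun z => P.residual z ≤ p.tol ε * P.residual z₀) hcost hT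
    (by rw [pow_zero, one_mul]) ?_ ?_ ?_) le_rfl ?_
  · intro t z hz
    refine (rhssStep_spec hp hk hX hP hst hD z fun w => hsolve w z).mono le_rfl fun z' hz' => ?_
    refine hz'.trans ?_
    rw [pow_succ', mul_assoc]
    exact mul_le_mul_of_nonneg_left hz hq
  · intro z
    refine Counted.Spec.bind_pure (P.residualNorm_spec z) fun g hg => ?_
    rw [hg]
  · intro z hz
    have h1 := (hD.norm_le_sqrt_mul hp1.le _).trans
      (mul_le_mul_of_nonneg_left (hD.hssNorm_J_le (z - mkZ xs ys)) (Real.sqrt_nonneg _))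
    rw [← hst.residual_eq_norm] at h1
    have hα' : 0 < √p.hssAlpha := Real.sqrt_pos.2 hα
    rw [Real.sqrt_div hp1.le] at hTε
    refine le_of_mul_le_mul_right ?_ hmx
    set q := (1 - 1 / (6 * p.ratio (k + 2))) ^ T with hqT
    have hq0 : 0 ≤ q := pow_nonneg hq T
    set s₁ := √(1 + p.hssBeta (k + 2) * p.Lx) with hs₁
    set s₀ := √p.hssAlpha with hs₀
    calc P.residual z * p.mx
        ≤ s₁ * (3 * p.ratio (k + 2) * R (z - mkZ xs ys)) * p.mx := by gcongr
      _ ≤ s₁ * (3 * p.ratio (k + 2) * (q * R (z₀ - mkZ xs ys))) * p.mx := by gcongr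
      _ = s₁ / s₀ * (3 * p.ratio (k + 2)) * q * (s₀ * R (z₀ - mkZ xs ys) * p.mx) := by
        field_simp
      _ ≤ s₁ / s₀ * (3 * p.ratio (k + 2)) * q *
          (((p.sub (k + 2)).Lx + p.Lxy) * P.residual z₀) := by gcongr
      _ = s₁ / s₀ * (3 * p.ratio (k + 2)) * q * ((p.sub (k + 2)).Lx + p.Lxy) * P.residual z₀ := by
        ring
      _ ≤ p.tol ε * p.mx * P.residual z₀ := by
        gcongr
        exact P.residual_nonneg z₀
      _ = _ := by ring
  · intro st hst; exact hst.2

/-- In the inductive step the recursive call costs of order `Q r² scale' X`, and `r * scale' ≤ 2 *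
scale` turns this into `Q r scale X`. Multiplying by the roughly `r X` iterations restores `r²`, so
a level adds only a factor polynomial in `X`. One `X` serves all levels: the term `2 (k + 1)` makes
room for the growth of `log κ` down the recursion. -/
theorem rhss_cost (k : ℕ) : ∀ {p : Params} {P : QuadProblem n m} {X : ℝ}, p.Standing →
    1 + Real.log p.cond + 2 * (k + 1) ≤ X → P.OpBounds p → ∀ {ε : ℝ}, 0 < ε → ∀ z₀ : ZSpace n m,
    (rhss (k + 1) p P ε z₀).Spec
      ((10 ^ 8 * X ^ 4) ^ (k + 1) * p.ratio (k + 1) ^ 2 * p.scale * max 1 (Real.log (1 / ε)))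
      fun z => P.residual z ≤ p.tol ε * P.residual z₀ := by
  induction k with
  | zero =>
    intro p P X hp hX hP ε hε z₀
    obtain ⟨xs, ys, hst⟩ := hP.exists_isStationary hp
    have h := pbr_cost hp (X := X) (by push_cast at hX; linarith) hP hst hε z₀
    refine Counted.Spec.mono h (le_of_eq ?_) fun _ h => h
    rw [zero_add, pow_one, Params.Standing.ratio_one]
  | succ k ih =>
    intro p P X hp hX hP ε hε z₀
    push_cast at hX
    obtain ⟨xs, ys, hst⟩ := hP.exists_isStationary hp
    have hk : 2 ≤ k + 2 := by omega
    have hXp : 1 + Real.log p.cond ≤ X := by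
      have : (0 : ℝ) ≤ k := k.cast_nonneg
      linarith
    have hX1 := one_le_of_log_le hp hXp
    have hp' := hp.sub hk
    have hmy := hp.my_pos
    have hLxy := hp.Lxy_pos
    have hr1 := hp.one_lt_ratio (by omega : 1 ≤ k + 2)
    have hsc := hp.one_le_scale
    have hsc' := hp'.one_le_scale
    have hX' : 1 + Real.log (p.sub (k + 2)).cond + 2 * (k + 1) ≤ X := by
      have h1 := Real.log_le_log (by linarith [hp'.one_le_cond]) (hp.cond_sub_le hk)
      rw [Real.log_mul (by norm_num) (by linarith [hp.one_le_cond])] at h1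
      have h2 : Real.log 4 ≤ (2 : ℕ) := log_le_natCast (by norm_num) (by norm_num)
      push_cast at h2
      linarith
    have hM : 0 < 1 / (16 * p.Lxy / p.my) := by positivity
    have hlogM : max 1 (Real.log (1 / (1 / (16 * p.Lxy / p.my)))) ≤ 3 * X := by
      refine max_le (by linarith) ?_
      rw [one_div_one_div]
      have h1 : 16 * p.Lxy / p.my ≤ 16 * p.cond ^ 1 := by
        rw [mul_div_assoc, pow_one, hp.cond_eq]
        gcongr
        exact hp.Lxy_div_my_le.trans
          (le_mul_of_one_le_left (by linarith [hp.one_le_L_div_my]) hp.one_le_L_div_mx)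
      have := log_le_mul (k := 3) hp hXp (by positivity) (by norm_num) h1 (by norm_num)
        (by norm_num)
      push_cast at this
      exact this
    have hrsc := hp.ratio_mul_scale_sub_le hk
    have hrs : (p.sub (k + 2)).ratio (k + 1) = p.ratio (k + 2) := hp.ratio_sub (by omega)
    set r := p.ratio (k + 2) with hr
    have hr0 : 0 < r := by linarith
    set Q := (10 ^ 8 * X ^ 4) ^ (k + 1) with hQ
    have hX4 : 1 ≤ X ^ 4 := one_le_pow₀ hX1
    have hQ1 : 1 ≤ Q := one_le_pow₀ (by linarith)
    have hsub : ∀ w z : ZSpace n m,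
        (rhss (k + 1) (p.sub (k + 2)) (P.sub p (k + 2) w) (1 / (16 * p.Lxy / p.my)) z).Spec
          (6 * Q * r * p.scale * X) fun z' =>
          (P.sub p (k + 2) w).residual z' ≤
            (p.sub (k + 2)).tol (1 / (16 * p.Lxy / p.my)) * (P.sub p (k + 2) w).residual z := by
      intro w z
      refine (ih hp' hX' (hP.sub hp (by omega) w) hM z).mono ?_ fun _ h => h
      rw [hrs]
      calc Q * r ^ 2 * (p.sub (k + 2)).scale * max 1 (Real.log (1 / (1 / (16 * p.Lxy / p.my))))
          ≤ Q * r ^ 2 * (p.sub (k + 2)).scale * (3 * X) := by gcongr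
        _ = 3 * Q * r * (r * (p.sub (k + 2)).scale) * X := by ring
        _ ≤ 3 * Q * r * (2 * p.scale) * X := by gcongr
        _ = _ := by ring
    refine (rhss_succ_spec hp hXp hP hst hε (by positivity) hsub z₀).mono ?_ fun _ h => h
    set ℓ := max 1 (Real.log (1 / ε)) with hℓd
    have hℓ : 1 ≤ ℓ := le_max_left _ _
    have hsX : 1 ≤ p.scale * X := one_le_mul_of_one_le_of_one_le hsc hX1
    have hQr : 1 ≤ Q * r := one_le_mul_of_one_le_of_one_le hQ1 hr1.le
    have hstep : 112 * p.scale * X + 6 * Q * r * p.scale * X + 4 ≤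
        122 * (Q * r * (p.scale * X)) := by
      have : p.scale * X ≤ Q * r * (p.scale * X) := le_mul_of_one_le_left (by linarith) hQr
      linarith
    have hrX : 1 ≤ r * (X * ℓ) :=
      one_le_mul_of_one_le_of_one_le hr1.le (one_le_mul_of_one_le_of_one_le hX1 hℓ)
    have hbig : 1 ≤ r * (X * ℓ) * (Q * r * (p.scale * X)) :=
      one_le_mul_of_one_le_of_one_le hrX (one_le_mul_of_one_le_of_one_le hQr hsX)
    have hX24 : X ^ 2 ≤ X ^ 4 := pow_le_pow_right₀ hX1 (by norm_num)
    calc 4 + 60 * r * (X * ℓ) * (112 * p.scale * X + 6 * Q * r * p.scale * X + 4)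
        ≤ 4 + 60 * r * (X * ℓ) * (122 * (Q * r * (p.scale * X))) := by gcongr
      _ ≤ 10 ^ 8 * (r * (X * ℓ) * (Q * r * (p.scale * X))) := by linarith
      _ = 10 ^ 8 * X ^ 2 * Q * r ^ 2 * p.scale * ℓ := by ring
      _ ≤ 10 ^ 8 * X ^ 4 * Q * r ^ 2 * p.scale * ℓ := by gcongr
      _ = _ := by rw [hQ]; ring

end Recursion

/-! ### The exponent of the condition number for the balanced depth. -/

/-- The growth rate `√(log s / log log s)` of the recursion depth. -/
noncomputable def depthScale (s : ℝ) : ℝ := √(Real.log s / Real.log (Real.log s))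

/-- The exponent of the condition number in the complexity of RHSS. -/
noncomputable def costExponent (c₁ c₂ s : ℝ) : ℝ :=
  (Real.log 2 + c₂ * depthScale s * (Real.log (10 ^ 8) +
    4 * Real.log (1 + Real.log s + 2 * (c₂ * depthScale s))) +
    2 * (Real.log s / (c₁ * depthScale s))) / Real.log s

/-- With `u = log s`, `l = log u`, `w = √(u/l)` and `v = 1/w`, both `w l` and `u/w` equal `u v`, and
`w ≤ u v`. Every term of the numerator except `log 2` is therefore `O(u v)`. The assumption makes `l
≥ 1`, which matters only in the limit. -/
theorem costExponent_le {c₁ c₂ s : ℝ} (hc₁ : 0 < c₁) (hc₂ : 0 ≤ c₂)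
    (hs : Real.exp 1 ≤ Real.log s) :
    0 ≤ costExponent c₁ c₂ s ∧ costExponent c₁ c₂ s ≤ Real.log 2 / Real.log s +
      (c₂ * (Real.log (10 ^ 8) + 4 * Real.log (2 + 2 * c₂) + 4) + 2 / c₁) *
        √(Real.log (Real.log s) / Real.log s) := by
  have he : 1 ≤ Real.exp 1 := by linarith [Real.add_one_le_exp 1]
  unfold costExponent depthScale
  set u := Real.log s with hu
  have hu1 : 1 ≤ u := he.trans hs
  have hu0 : 0 < u := by linarith
  have hL : 1 ≤ Real.log u := (Real.le_log_iff_exp_le hu0).2 hs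
  set l := Real.log u with hl
  set w := √(u / l) with hw
  set v := √(l / u) with hv
  have hwv : w * v = 1 := by
    rw [hw, hv, ← Real.sqrt_mul (by positivity), div_mul_div_cancel₀ (by positivity),
      div_self hu0.ne', Real.sqrt_one]
  have hv0 : 0 < v := Real.sqrt_pos.2 (by positivity)
  have hw0 : 0 < w := Real.sqrt_pos.2 (by positivity)
  have hvsq : v ^ 2 * u = l := by
    rw [hv, Real.sq_sqrt (by positivity)]; field_simp
  have hwl : w * l = u * v := by
    calc w * l = w * (v ^ 2 * u) := by rw [hvsq]
      _ = w * v * (u * v) := by ring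
      _ = _ := by rw [hwv, one_mul]
  have hwuv : w ≤ u * v := by rw [← hwl]; exact le_mul_of_one_le_right hw0.le hL
  have hwu : w ≤ u := by
    rw [hw, Real.sqrt_le_left hu0.le]
    calc u / l ≤ u := div_le_self hu0.le hL
      _ ≤ u ^ 2 := le_self_pow₀ hu1 (by norm_num)
  have h8 : 0 ≤ Real.log (10 ^ 8 : ℝ) := Real.log_nonneg (by norm_num)
  have h2 : 0 ≤ Real.log 2 := Real.log_nonneg (by norm_num)
  have hc2w : 0 ≤ c₂ * w := by positivity
  have hlogX : Real.log (1 + u + 2 * (c₂ * w)) ≤ Real.log (2 + 2 * c₂) + l := by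
    rw [hl, ← Real.log_mul (by positivity) (by positivity)]
    refine Real.log_le_log (by positivity) ?_
    have : c₂ * w ≤ c₂ * u := by gcongr
    linarith
  have hlogX0 : 0 ≤ Real.log (1 + u + 2 * (c₂ * w)) := Real.log_nonneg (by linarith)
  have hD : 0 ≤ Real.log (2 + 2 * c₂) := Real.log_nonneg (by linarith)
  constructor
  · positivity
  rw [div_le_iff₀ hu0, add_mul, div_mul_cancel₀ _ hu0.ne']
  have e1 : u / (c₁ * w) = u * v / c₁ := by
    rw [div_eq_div_iff (by positivity) (by positivity)]
    calc u * c₁ = u * c₁ * (w * v) := by rw [hwv, mul_one]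
      _ = _ := by ring
  have e2 : c₂ * w * (Real.log (10 ^ 8) + 4 * Real.log (1 + u + 2 * (c₂ * w))) ≤
      c₂ * (Real.log (10 ^ 8) + 4 * Real.log (2 + 2 * c₂) + 4) * (u * v) := by
    calc _ ≤ c₂ * w * (Real.log (10 ^ 8) + 4 * (Real.log (2 + 2 * c₂) + l)) := by gcongr
      _ = c₂ * ((Real.log (10 ^ 8) + 4 * Real.log (2 + 2 * c₂)) * w + 4 * (w * l)) := by ring
      _ ≤ c₂ * ((Real.log (10 ^ 8) + 4 * Real.log (2 + 2 * c₂)) * (u * v) + 4 * (u * v)) := by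
        rw [hwl]; gcongr
      _ = _ := by ring
  rw [e1]
  calc _ ≤ Real.log 2 + c₂ * (Real.log (10 ^ 8) + 4 * Real.log (2 + 2 * c₂) + 4) * (u * v) +
        2 * (u * v / c₁) := by gcongr
    _ = _ := by ring

theorem tendsto_costExponent {c₁ c₂ : ℝ} (hc₁ : 0 < c₁) (hc₂ : 0 ≤ c₂) :
    Tendsto (costExponent c₁ c₂) atTop (𝓝 0) := by
  have hlog := Real.tendsto_log_atTop
  have h1 : Tendsto (fun s => Real.log 2 / Real.log s) atTop (𝓝 0) := hlog.const_div_atTop _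
  have h2 : Tendsto (fun s => √(Real.log (Real.log s) / Real.log s)) atTop (𝓝 0) := by
    have h3 : Tendsto (fun u : ℝ => Real.log u / u) atTop (𝓝 0) :=
      Real.isLittleO_log_id_atTop.tendsto_div_nhds_zero
    have h4 := (h3.comp hlog).sqrt
    rw [Real.sqrt_zero] at h4
    exact h4
  have h3 := h1.add (h2.const_mul
    (c₂ * (Real.log (10 ^ 8) + 4 * Real.log (2 + 2 * c₂) + 4) + 2 / c₁))
  rw [mul_zero, add_zero] at h3
  have hev := hlog.eventually_ge_atTop (Real.exp 1)
  exact tendsto_of_tendsto_of_tendsto_of_le_of_le' tendsto_const_nhds h3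
    (hev.mono fun s hs => (costExponent_le hc₁ hc₂ hs).1)
    (hev.mono fun s hs => (costExponent_le hc₁ hc₂ hs).2)

theorem Params.Standing.scale_le {p : Params} (hp : p.Standing) :
    p.scale ≤ 2 * √(p.Lxy ^ 2 / (p.mx * p.my) + p.Lx / p.mx + p.Ly / p.my) := by
  have hmx := hp.mx_pos
  have hmy := hp.my_pos
  have hLx := hp.Lx_pos
  have hLxy := hp.Lxy_pos
  have hLy : 0 < p.Ly := hp.Lx_eq_Ly ▸ hLx
  have e : p.Lxy / √(p.mx * p.my) = √(p.Lxy ^ 2 / (p.mx * p.my)) := by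
    rw [Real.sqrt_div (by positivity), Real.sqrt_sq hLxy.le]
  have h1 : 0 < p.Lxy ^ 2 / (p.mx * p.my) := by positivity
  have h2 : 0 < p.Lx / p.mx := by positivity
  have h3 : 0 < p.Ly / p.my := by positivity
  rw [scale, e, two_mul]
  exact add_le_add (Real.sqrt_le_sqrt (by linarith)) (Real.sqrt_le_sqrt (by linarith))

/-- The exponent is the logarithm of the left side divided by `log κ`, with `k` replaced by its
upper bound where the expression increases in `k` and by its lower bound in `log r ≤ (log κ)/k`. The
factor `2` is reserved for `scale_le`. -/
theorem overhead_le {p : Params} (hp : p.Standing) {c₁ c₂ : ℝ} (hc₁ : 0 < c₁)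
    {k : ℕ} (hκ : Real.exp 1 < p.cond) (hk₁ : c₁ * depthScale p.cond ≤ k)
    (hk₂ : k ≤ c₂ * depthScale p.cond) :
    2 * (10 ^ 8 * (1 + Real.log p.cond + 2 * k) ^ 4) ^ k * p.ratio k ^ 2 ≤
      p.cond ^ costExponent c₁ c₂ p.cond := by
  have hκ0 : 0 < p.cond := (Real.exp_pos 1).trans hκ
  have hu : 1 < Real.log p.cond := (Real.lt_log_iff_exp_lt hκ0).2 hκ
  have hl : 0 < Real.log (Real.log p.cond) := Real.log_pos hu
  have hw : 0 < depthScale p.cond := Real.sqrt_pos.2 (div_pos (by linarith) hl)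
  have hk0 : (0 : ℝ) < k := (mul_pos hc₁ hw).trans_le hk₁
  have hr0 : 0 < p.Lxy / p.my := div_pos hp.Lxy_pos hp.my_pos
  unfold costExponent
  rw [Real.rpow_def_of_pos hκ0, mul_div_cancel₀ _ (by linarith)]
  set u := Real.log p.cond with hud
  set w := depthScale p.cond with hwd
  rw [Real.exp_add, Real.exp_add, Real.exp_log (by norm_num : (0 : ℝ) < 2)]
  have hX : 0 < 10 ^ 8 * (1 + u + 2 * k) ^ 4 := by positivity
  have h1 : (10 ^ 8 * (1 + u + 2 * k) ^ 4) ^ k ≤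
      Real.exp (c₂ * w * (Real.log (10 ^ 8) + 4 * Real.log (1 + u + 2 * (c₂ * w)))) := by
    rw [← Real.exp_log (pow_pos hX k), Real.exp_le_exp, Real.log_pow,
      Real.log_mul (by norm_num) (by positivity), Real.log_pow (1 + u + 2 * k)]
    have h8 : 0 ≤ Real.log (10 ^ 8 : ℝ) := Real.log_nonneg (by norm_num)
    have h9 : 0 ≤ Real.log (1 + u + 2 * k) := Real.log_nonneg (by linarith)
    have h10 : Real.log (1 + u + 2 * k) ≤ Real.log (1 + u + 2 * (c₂ * w)) :=
      Real.log_le_log (by positivity) (by linarith)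
    push_cast
    have h11 : 0 ≤ Real.log (10 ^ 8 : ℝ) + 4 * Real.log (1 + u + 2 * (c₂ * w)) := by linarith
    calc _ ≤ k * (Real.log (10 ^ 8) + 4 * Real.log (1 + u + 2 * (c₂ * w))) := by gcongr
      _ ≤ _ := by gcongr
  have h2 : p.ratio k ^ 2 ≤ Real.exp (2 * (u / (c₁ * w))) := by
    have h3 : p.ratio k ≤ Real.exp (u / (c₁ * w)) := by
      rw [Params.ratio, Real.rpow_def_of_pos hr0, Real.exp_le_exp, mul_one_div]
      have h4 : Real.log (p.Lxy / p.my) ≤ u := by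
        refine Real.log_le_log hr0 (hp.Lxy_div_my_le.trans ?_)
        rw [hp.cond_eq]
        exact le_mul_of_one_le_left (by linarith [hp.one_le_L_div_my]) hp.one_le_L_div_mx
      gcongr
    have h0 : 0 ≤ p.ratio k := Real.rpow_nonneg hr0.le _
    calc p.ratio k ^ 2 ≤ Real.exp (u / (c₁ * w)) ^ 2 := by gcongr
      _ = _ := by rw [← Real.exp_nat_mul]; norm_num
  gcongr

theorem corollary3 (c₁ c₂ : ℝ) (hc₁ : 0 < c₁) (hc₂ : c₁ ≤ c₂) :
    ∃ ω : ℝ → ℝ, Tendsto ω atTop (𝓝 0) ∧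
      ∀ (n m : ℕ) (p : Params) (P : QuadProblem n m) (k : ℕ) (z₀ zs : ZSpace n m) (ε : ℝ),
        p.Standing → P.InClass p → P.IsSaddlePoint zs →
        Real.exp 1 < p.cond →
        c₁ * √(Real.log p.cond / Real.log (Real.log p.cond)) ≤ (k : ℝ) →
        (k : ℝ) ≤ c₂ * √(Real.log p.cond / Real.log (Real.log p.cond)) →
        0 < ε → ε < ‖z₀ - zs‖ →
        ∃ (z : ZSpace n m) (N : ℕ),
          (rhss k p P (ε / ‖z₀ - zs‖) z₀).Returns z N ∧
          ‖z - zs‖ ≤ ε ∧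
          (N : ℝ) ≤ √(p.Lxy ^ 2 / (p.mx * p.my) + p.Lx / p.mx + p.Ly / p.my) *
            max 1 (Real.log (‖z₀ - zs‖ / ε)) * p.cond ^ ω p.cond := by
  refine ⟨costExponent c₁ c₂, tendsto_costExponent hc₁ (hc₁.le.trans hc₂), ?_⟩
  intro n m p P k z₀ zs ε hp hPc hzs hκ hk₁ hk₂ hε hεd
  have hd : 0 < ‖z₀ - zs‖ := hε.trans hεd
  have hP := hPc.opBounds
  have hst := hzs.isStationary hP
  have hκ0 : 0 < p.cond := (Real.exp_pos 1).trans hκ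
  have hu : 1 < Real.log p.cond := (Real.lt_log_iff_exp_lt hκ0).2 hκ
  -- `κ > e` makes `log log κ` positive, so the lower bound on `k` excludes the irrelevant depth
  -- `0`.
  have hk0 : (0 : ℝ) < k :=
    (mul_pos hc₁ (Real.sqrt_pos.2 (div_pos (by linarith) (Real.log_pos hu)))).trans_le hk₁
  obtain ⟨j, rfl⟩ : ∃ j, k = j + 1 := ⟨k - 1, by have : 0 < k := by exact_mod_cast hk0
                                                 omega⟩
  obtain ⟨z, N, hret, hN, hz⟩ := rhss_cost j (X := 1 + Real.log p.cond + 2 * ((j + 1 : ℕ) : ℝ)) hp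
    (by push_cast; linarith) hP (div_pos hε hd) z₀
  refine ⟨z, N, hret, ?_, hN.trans ?_⟩
  · have hmx := hp.mx_pos
    have hLx := hp.Lx_pos
    have hLxy := hp.Lxy_pos
    have htol : 0 ≤ p.tol (ε / ‖z₀ - zs‖) := by unfold Params.tol; positivity
    refine le_of_mul_le_mul_left ?_ hmx
    -- The tolerance is the relative precision divided by the condition number `(L_x + L_xy)/m_x` of
    -- `J`, exactly what the passage from distance to residual and back loses.
    calc p.mx * ‖z - zs‖ ≤ P.residual z := hP.le_residual hp hst z
      _ ≤ p.tol (ε / ‖z₀ - zs‖) * P.residual z₀ := hz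
      _ ≤ p.tol (ε / ‖z₀ - zs‖) * ((p.Lx + p.Lxy) * ‖z₀ - zs‖) := by
        gcongr
        exact hP.residual_le hp hst z₀
      _ = p.mx * ε := by unfold Params.tol; field_simp; ring
  · rw [one_div_div]
    have h1 := overhead_le hp hc₁ hκ hk₁ hk₂
    have h2 := hp.scale_le
    set Y := (10 ^ 8 * (1 + Real.log p.cond + 2 * ((j + 1 : ℕ) : ℝ)) ^ 4) ^ (j + 1)
    have hY : 0 ≤ Y := by positivity
    set S := √(p.Lxy ^ 2 / (p.mx * p.my) + p.Lx / p.mx + p.Ly / p.my)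
    set ℓ := max 1 (Real.log (‖z₀ - zs‖ / ε)) with hℓ
    have hℓ0 : 0 ≤ ℓ := zero_le_one.trans (le_max_left _ _)
    have hS : 0 ≤ S := Real.sqrt_nonneg _
    calc Y * p.ratio (j + 1) ^ 2 * p.scale * ℓ ≤ Y * p.ratio (j + 1) ^ 2 * (2 * S) * ℓ := by gcongr
      _ = S * ℓ * (2 * Y * p.ratio (j + 1) ^ 2) := by ring
      _ ≤ _ := by gcongr
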